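/- A $3$-polytope is a finite simple graph that is planar and $3$-connected (it has more than three vertices, and deleting fewer than three vertices always leaves a connected graph). The radius of a graph is the minimum over its vertices $v$ of the maximal distance from $v$ to a vertex; so a graph on $p\ge 2$ vertices has radius $1$ if and only if some vertex has degree $p-1$. A finite sequence $s: d_1,\dots,d_p$ of non-negative integers (the order of the terms is immaterial) is called unigraphic as a $3$-polytope of radius $1$ if, up to isomorphism, there is exactly one $3$-polytope of radius $1$ with degree sequence $s$. In a sequence, $d^k$ stands for $k$ terms equal to $d$. Theorem. Let $s$ be a sequence in which exactly two terms are equal to $3$. Then $s$ is unigraphic as a $3$-polytope of radius $1$ if and only if $s$ is one of the following, for some integers $p$ and $x$ as indicated: \begin{align*} A1&:\ p-1,\ 4^{p-3},\ 3^2, && p\ge 5,\ p\text{ odd};\\ A2&:\ p-1,\ p-3,\ 4^{p-4},\ 3^2, && p\ge 8;\\ A3&:\ p-1,\ (x+3)^{(p-5)/(x-1)},\ 4^{(p-5)(x-2)/(x-1)+2},\ 3^2, && p\ge 6,\ x\ge 2,\ (p-5)/(x-1)\in\mathbb{N};\\ A4&:\ p-1,\ x+3,\ p-x,\ 4^{p-5},\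 3^2, && p\ge 8,\ \lfloor (p-1)/2\rfloor\le x\le p-5. \end{align*} -/

import Mathlib

/-- A drawing of the graph `G` in the plane `ℝ × ℝ` without crossings: vertices are distinct
points, and every edge is a simple continuous arc joining its two ends. -/
structure PlaneDrawing {V : Type*} (G : SimpleGraph V) where
  /-- The point that represents a vertex. -/
  pos : V → ℝ × ℝ
  /-- The set of points of the arc that represents an edge. -/
  arc : Sym2 V → Set (ℝ × ℝ)
  pos_injective : Function.Injective pos
  /-- The set drawn for an edge is a simple arc between the two ends of the edge. -/
  isArc : ∀ u v : V, G.Adj u v →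
    ∃ γ : Path (pos u) (pos v), Function.Injective γ ∧ Set.range γ = arc s(u, v)
  /-- An edge passes through no vertex other than its ends. -/
  mem_of_pos_mem_arc : ∀ e ∈ G.edgeSet, ∀ w : V, pos w ∈ arc e → w ∈ e
  /-- Two distinct edges meet at most in common ends. -/
  inter_arc : ∀ e ∈ G.edgeSet, ∀ f ∈ G.edgeSet, e ≠ f → ∀ x ∈ arc e ∩ arc f,
    ∃ w : V, w ∈ e ∧ w ∈ f ∧ x = pos w

/-- A graph is planar if it can be drawn in the plane without crossings. -/
def IsPlanar {V : Type*} (G : SimpleGraph V) : Prop := Nonempty (PlaneDrawing G)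

/-- A finite graph is `3`-connected if it has more than three vertices, and deleting any set of
fewer than three vertices leaves a connected graph. -/
def IsThreeConnected {V : Type*} [Fintype V] (G : SimpleGraph V) : Prop :=
  3 < Fintype.card V ∧
    ∀ S : Finset V, S.card < 3 → (G.induce ((S : Set V)ᶜ)).Connected

/-- A `3`-polytope is, as a graph, a planar `3`-connected graph. -/
def IsThreePolytope {V : Type*} [Fintype V] (G : SimpleGraph V) : Prop :=
  IsPlanar G ∧ IsThreeConnected G

open Classical in
/-- The degree sequence of a finite graph, as a multiset (the order of the terms is
immaterial). -/
noncomputable def degreeSequence {V : Type*} [Fintype V] (G : SimpleGraph V) : Multiset ℕ :=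
  (Finset.univ : Finset V).val.map fun v => G.degree v

/-- `G` is a realisation of the sequence `s` as a `3`-polytope of radius `1`. -/
def IsRadiusOneRealisation {V : Type*} [Fintype V] (G : SimpleGraph V) (s : Multiset ℕ) : Prop :=
  IsThreePolytope G ∧ G.radius = 1 ∧ degreeSequence G = s

/-- The sequence `s` is unigraphic as a `3`-polytope of radius `1`: up to isomorphism there is
exactly one `3`-polytope of radius `1` with degree sequence `s`. A realisation has as many
vertices as `s` has terms, so it may be taken on the vertex set `Fin (Multiset.card s)`. -/
def IsUnigraphicRadiusOne (s : Multiset ℕ) : Prop :=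
  ∃ F : SimpleGraph (Fin (Multiset.card s)), IsRadiusOneRealisation F s ∧
    ∀ F' : SimpleGraph (Fin (Multiset.card s)), IsRadiusOneRealisation F' s → Nonempty (F ≃g F')

/-- Type A1: `p - 1, 4^(p-3), 3^2`, where `p ≥ 5` is odd. -/
def IsTypeA1 (s : Multiset ℕ) : Prop :=
  ∃ p : ℕ, 5 ≤ p ∧ Odd p ∧
    s = {p - 1} + Multiset.replicate (p - 3) 4 + Multiset.replicate 2 3

/-- Type A2: `p - 1, p - 3, 4^(p-4), 3^2`, where `p ≥ 8`. -/
def IsTypeA2 (s : Multiset ℕ) : Prop :=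
  ∃ p : ℕ, 8 ≤ p ∧
    s = {p - 1} + {p - 3} + Multiset.replicate (p - 4) 4 + Multiset.replicate 2 3

/-- Type A3: `p - 1, (x+3)^((p-5)/(x-1)), 4^((p-5)(x-2)/(x-1) + 2), 3^2`, where `p ≥ 6` and
`(p-5)/(x-1)` is a positive integer. -/
def IsTypeA3 (s : Multiset ℕ) : Prop :=
  ∃ p x : ℕ, 6 ≤ p ∧ 2 ≤ x ∧ (x - 1) ∣ (p - 5) ∧
    s = {p - 1} + Multiset.replicate ((p - 5) / (x - 1)) (x + 3)
      + Multiset.replicate ((p - 5) * (x - 2) / (x - 1) + 2) 4 + Multiset.replicate 2 3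

/-- Type A4: `p - 1, x + 3, p - x, 4^(p-5), 3^2`, where `p ≥ 8` and
`⌊(p-1)/2⌋ ≤ x ≤ p - 5`. -/
def IsTypeA4 (s : Multiset ℕ) : Prop :=
  ∃ p x : ℕ, 8 ≤ p ∧ (p - 1) / 2 ≤ x ∧ x ≤ p - 5 ∧
    s = {p - 1} + {x + 3} + {p - x} + Multiset.replicate (p - 5) 4 + Multiset.replicate 2 3

/-! ### Continuous logarithms and the van Kampen obstruction -/

/-! Fix a vertex z of full degree. The other p - 1 vertices form a cycle, the rim
(`IsThreePolytope.exists_isRim`): a cycle avoiding z that misses a vertex has an ear, which either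
lengthens it or gives a K₃,₃ minor. Two crossing chords of the rim would, with z, give a K₅ minor
(`SimpleGraph.IsRim.not_crossing`). So the degree of a rim vertex is 3 plus its number of chords.

If exactly two vertices have degree 3, they cut the rim into two sides. A shortest chord with both
ends on one side would enclose a vertex without a chord, so all chords run from side to side. Since
they do not cross, they are linearly ordered, and the next chord advances by one vertex on the first
side, on the second, or on both. A polytope is thus a word in `fst`, `snd`, `both`, and every word
gives a polytope; exchanging the sides or reversing the word does not change the graph.

The degree sequence amounts to the multiset of chord counts, and this to the number D of steps
`both` and the multiset L of lengths of maximal runs of `fst` or of `snd`: a run of r steps is a fan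
of r + 1 chords at one vertex, and all other counts are 1. Here p is the sum of L plus 2D + 5. So a
sequence is unigraphic if and only if all words with its L and D give isomorphic graphs. This is so
for no runs (A1), one run and D = 1 (A2), equal runs and D = 0 (A3), and two different runs and D =
0 (A4). Otherwise two arrangements are told apart by the degrees seen from the two vertices of
degree 3 (`StripStep.endDegrees_of_iso`): an end next to a `both` sees only p - 1 and 4, an end next
to a run r also sees 4 + r.

Planarity means a drawing by arbitrary arcs. The two minors are excluded by van Kampen's parity
argument with continuous logarithms, without the Jordan curve theorem; word graphs are drawn
explicitly on a parabola. -/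

theorem exists_continuous_log {A : Type*} [TopologicalSpace A] [SimplyConnectedSpace A]
    [LocallyPathConnectedSpace A] {f : A → ℂ} (hf : Continuous f) (h0 : ∀ a, f a ≠ 0) :
    ∃ g : A → ℂ, Continuous g ∧ ∀ a, Complex.exp (g a) = f a := by
  obtain ⟨a₀⟩ : Nonempty A := inferInstance
  obtain ⟨g, ⟨-, hg⟩, -⟩ := Complex.isCoveringMapOn_exp.existsUnique_continuousMap_lifts
    (⟨f, hf⟩ : C(A, ℂ)) (a₀ := a₀) (Complex.exp_log (h0 a₀)) (fun a => h0 a)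
  exact ⟨g, g.continuous, fun a => congrFun hg a⟩

/-- Lifts along `exp` are unique, so after a shift that makes them agree at 0 the two logarithms
coincide. -/
theorem log_increment_unique {g g' : ℝ → ℂ} (hg : Continuous g) (hg' : Continuous g')
    (h : ∀ t, Complex.exp (g t) = Complex.exp (g' t)) : g 1 - g 0 = g' 1 - g' 0 := by
  have key := Complex.isCoveringMapOn_exp.existsUnique_continuousMap_lifts
    (⟨fun t => Complex.exp (g t), by fun_prop⟩ : C(ℝ, ℂ)) (a₀ := (0 : ℝ)) (e₀ := g 0) rfl
    (fun a => Complex.exp_ne_zero _)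
  have e := key.unique (y₁ := ⟨g, hg⟩) (y₂ := ⟨fun t => g' t + (g 0 - g' 0), by fun_prop⟩)
    ⟨rfl, rfl⟩ ⟨by simp, by
      funext t
      simp [Complex.exp_add, Complex.exp_sub, h 0, h t]⟩
  have := DFunLike.congr_fun e 1
  simp only [ContinuousMap.coe_mk] at this
  rw [this]; ring

open Classical in
/-- The increment over `[0, 1]` of a continuous logarithm of `f`. -/
noncomputable def logIncrement (f : ℝ → ℂ) : ℂ :=
  if h : ∃ g : ℝ → ℂ, Continuous g ∧ ∀ t, Complex.exp (g t) = f t then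
    h.choose 1 - h.choose 0 else 0

theorem logIncrement_eq {f g : ℝ → ℂ} (hg : Continuous g) (h : ∀ t, Complex.exp (g t) = f t) :
    logIncrement f = g 1 - g 0 := by
  have hex : ∃ g : ℝ → ℂ, Continuous g ∧ ∀ t, Complex.exp (g t) = f t := ⟨g, hg, h⟩
  rw [logIncrement, dif_pos hex]
  exact log_increment_unique hex.choose_spec.1 hg fun t => by rw [hex.choose_spec.2, h]

/-- The integer records the winding of `f` about 0, measured against fixed logarithms of its end
values. -/
theorem exists_int_logIncrement {f : ℝ → ℂ} (hf : Continuous f) (h0 : ∀ t, f t ≠ 0) {a b : ℂ}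
    (ha : Complex.exp a = f 0) (hb : Complex.exp b = f 1) :
    ∃ n : ℤ, logIncrement f = b - a + n * (2 * Real.pi * Complex.I) := by
  obtain ⟨g, hg, h⟩ := exists_continuous_log hf h0
  rw [logIncrement_eq hg h, ← Complex.exp_eq_exp_iff_exists_int, Complex.exp_sub, Complex.exp_sub,
    h, h, ha, hb]

/-- The function `α s - β t` has no zero, hence a continuous logarithm on the whole plane, whose
increments round the unit square cancel. On two sides the sign is reversed, which shifts the
logarithm by πi and leaves the increment alone. -/
theorem logIncrement_square {α β : ℝ → ℂ} (hα : Continuous α) (hβ : Continuous β)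
    (h : ∀ s t, α s ≠ β t) :
    logIncrement (fun t => β t - α 0) + logIncrement (fun s => α s - β 1)
      - logIncrement (fun t => β t - α 1) - logIncrement (fun s => α s - β 0) = 0 := by
  obtain ⟨L, hL, hexp⟩ := exists_continuous_log (A := ℝ × ℝ) (f := fun p => α p.1 - β p.2)
    (by fun_prop) (fun p => sub_ne_zero.2 (h _ _))
  have flip : ∀ s t, Complex.exp (L (s, t) + Real.pi * Complex.I) = β t - α s := by
    intro s t
    rw [Complex.exp_add, hexp, Complex.exp_pi_mul_I]
    simp
  rw [logIncrement_eq (g := fun t => L (0, t) + Real.pi * Complex.I) (by fun_prop) (flip 0),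
    logIncrement_eq (g := fun t => L (1, t) + Real.pi * Complex.I) (by fun_prop) (flip 1),
    logIncrement_eq (g := fun s => L (s, 1)) (by fun_prop) (fun s => hexp (s, 1)),
    logIncrement_eq (g := fun s => L (s, 0)) (by fun_prop) (fun s => hexp (s, 0))]
  ring

/-- Integers attached to a family of curves in the plane of which independent ones are
disjoint; the right-hand side is the parity of crossings for vertices in convex position. -/
theorem exists_int_of_disjoint_curves {m : ℕ} {x : Fin m → ℂ} (hx : Function.Injective x)
    {K : Fin m → Fin m → Prop} {γ : Fin m → Fin m → ℝ → ℂ}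
    (hγ : ∀ i j, i < j → K i j → Continuous (γ i j) ∧ γ i j 0 = x i ∧ γ i j 1 = x j)
    (hdisj : ∀ i j k l, i < j → k < l → K i j → K k l → i ≠ k → i ≠ l → j ≠ k → j ≠ l →
      ∀ s t, γ i j s ≠ γ k l t) :
    ∃ n : Fin m → Fin m → Fin m → ℤ, ∀ i j k l, i < j → k < l → K i j → K k l →
      i ≠ k → i ≠ l → j ≠ k → j ≠ l →
      n i k l + n l i j - n j k l - n k i j =
        (if i < l then 1 else 0) + (if l < j then 1 else 0) + (if j < k then 1 else 0)
          + (if k < i then 1 else 0) - 2 := by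
  classical
  -- Logarithms of `x v - x u` for which `a u v - a v u` is exactly πi or -πi, with the sign given
  -- by the order of `u` and `v`. This is the source of the convex position pattern.
  let a : Fin m → Fin m → ℂ := fun u v =>
    if u < v then Complex.log (x v - x u) else Complex.log (x u - x v) + Real.pi * Complex.I
  have ha : ∀ u v, u ≠ v → Complex.exp (a u v) = x v - x u := by
    intro u v huv
    have h1 : x v - x u ≠ 0 := sub_ne_zero.2 fun h => huv (hx h).symm
    have h2 : x u - x v ≠ 0 := sub_ne_zero.2 fun h => huv (hx h)
    by_cases hlt : u < v
    · simp only [a, if_pos hlt, Complex.exp_log h1]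
    · simp only [a, if_neg hlt, Complex.exp_add, Complex.exp_log h2, Complex.exp_pi_mul_I]
      ring
  have hant : ∀ u v, u ≠ v →
      a u v - a v u = (1 - 2 * (if u < v then (1 : ℤ) else 0) : ℤ) * (Real.pi * Complex.I) := by
    intro u v huv
    rcases lt_or_gt_of_ne huv with h | h
    · simp only [a, if_pos h, if_neg h.asymm]; push_cast; ring
    · simp only [a, if_pos h, if_neg h.asymm]; push_cast; ring
  -- The integer depends on the vertex `i` and the edge `k l` only, not on the edge at `i`; the
  -- parity argument rests on this. The side conditions stand inside the existential so that
  -- `choose` gives a total function.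
  have hn : ∀ i k l, ∃ n : ℤ, k < l → K k l → i ≠ k → i ≠ l → (∀ t, γ k l t ≠ x i) →
      logIncrement (fun t => γ k l t - x i) = a i l - a i k + n * (2 * Real.pi * Complex.I) := by
    intro i k l
    by_cases h : k < l ∧ K k l ∧ i ≠ k ∧ i ≠ l ∧ ∀ t, γ k l t ≠ x i
    · obtain ⟨h1, h2, h3, h4, h5⟩ := h
      obtain ⟨hc, h0, h1'⟩ := hγ k l h1 h2
      obtain ⟨n, hn⟩ := exists_int_logIncrement (f := fun t => γ k l t - x i) (by fun_prop)
        (fun t => sub_ne_zero.2 (h5 t)) (a := a i k) (b := a i l)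
        (by rw [h0, ha _ _ h3]) (by rw [h1', ha _ _ h4])
      exact ⟨n, fun _ _ _ _ _ => hn⟩
    · exact ⟨0, fun h1 h2 h3 h4 h5 => absurd ⟨h1, h2, h3, h4, h5⟩ h⟩
  choose n hn using hn
  refine ⟨n, fun i j k l hij hkl Kij Kkl hik hil hjk hjl => ?_⟩
  have hd := hdisj i j k l hij hkl Kij Kkl hik hil hjk hjl
  obtain ⟨c1, s1, e1⟩ := hγ i j hij Kij
  obtain ⟨c2, s2, e2⟩ := hγ k l hkl Kkl
  have sq := logIncrement_square c1 c2 hd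
  rw [s1, e1, s2, e2,
    hn i k l hkl Kkl hik hil (fun t => by rw [← s1]; exact (hd 0 t).symm),
    hn j k l hkl Kkl hjk hjl (fun t => by rw [← e1]; exact (hd 1 t).symm),
    hn l i j hij Kij hil.symm hjl.symm (fun t => by rw [← e2]; exact hd t 1),
    hn k i j hij Kij hik.symm hjk.symm (fun t => by rw [← s2]; exact hd t 0)] at sq
  have h1 := hant i l hil
  have h2 := hant l j hjl.symm
  have h3 := hant j k hjk
  have h4 := hant k i hik.symm
  have hpi : (Real.pi * Complex.I : ℂ) ≠ 0 := by
    simp [Real.pi_ne_zero]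
  have hZ : ((2 * (n i k l + n l i j - n j k l - n k i j) : ℤ) : ℂ) * (Real.pi * Complex.I) =
      ((2 * ((if i < l then 1 else 0) + (if l < j then 1 else 0) + (if j < k then 1 else 0)
          + (if k < i then 1 else 0) - 2) : ℤ) : ℂ) * (Real.pi * Complex.I) := by
    have e : ((2 * (n i k l + n l i j - n j k l - n k i j) : ℤ) : ℂ) * (Real.pi * Complex.I) =
      -((a i l - a l i) + (a l j - a j l) + (a j k - a k j) + (a k i - a i k)) := by
      push_cast
      linear_combination sq
    rw [e, h1, h2, h3, h4]
    push_cast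
    ring
  have := mul_right_cancel₀ hpi hZ
  have := Int.cast_injective this
  omega

/-- Add the relations for the fifteen pairs of disjoint edges. Each integer `n i k l` occurs twice,
so the left side is even. A right side is odd exactly when the two edges interleave, which happens
for five pairs. -/
theorem no_disjoint_curves_K5 {x : Fin 5 → ℂ} (hx : Function.Injective x)
    {γ : Fin 5 → Fin 5 → ℝ → ℂ}
    (hγ : ∀ i j, i < j → Continuous (γ i j) ∧ γ i j 0 = x i ∧ γ i j 1 = x j)
    (hdisj : ∀ i j k l, i < j → k < l → i ≠ k → i ≠ l → j ≠ k → j ≠ l →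
      ∀ s t, γ i j s ≠ γ k l t) : False := by
  obtain ⟨n, hn⟩ := exists_int_of_disjoint_curves hx (K := fun _ _ => True)
    (fun i j h _ => hγ i j h) (fun i j k l h h' _ _ => hdisj i j k l h h')
  have H : ∀ i j k l : Fin 5, i < j ∧ k < l ∧ i ≠ k ∧ i ≠ l ∧ j ≠ k ∧ j ≠ l → _ :=
    fun i j k l h => hn i j k l h.1 h.2.1 trivial trivial h.2.2.1 h.2.2.2.1 h.2.2.2.2.1 h.2.2.2.2.2
  have e1 := H 0 1 2 3 (by decide)
  have e2 := H 0 2 1 3 (by decide)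
  have e3 := H 0 3 1 2 (by decide)
  have e4 := H 0 1 2 4 (by decide)
  have e5 := H 0 2 1 4 (by decide)
  have e6 := H 0 4 1 2 (by decide)
  have e7 := H 0 1 3 4 (by decide)
  have e8 := H 0 3 1 4 (by decide)
  have e9 := H 0 4 1 3 (by decide)
  have e10 := H 0 2 3 4 (by decide)
  have e11 := H 0 3 2 4 (by decide)
  have e12 := H 0 4 2 3 (by decide)
  have e13 := H 1 2 3 4 (by decide)
  have e14 := H 1 3 2 4 (by decide)
  have e15 := H 1 4 2 3 (by decide)
  simp only [show ∀ a b : Fin 5, (a < b) = (a.val < b.val) from fun _ _ => rfl] at e1 e2 e3 e4 e5 e6 e7 e8 e9 e10 e11 e12 e13 e14 e15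
  norm_num at e1 e2 e3 e4 e5 e6 e7 e8 e9 e10 e11 e12 e13 e14 e15
  omega

/-- The same count over the eighteen pairs of disjoint edges: each integer occurs twice, and nine
pairs interleave in the order 0, ..., 5. -/
theorem no_disjoint_curves_K33 {x : Fin 6 → ℂ} (hx : Function.Injective x)
    {γ : Fin 6 → Fin 6 → ℝ → ℂ}
    (hγ : ∀ i j : Fin 6, i < 3 → 3 ≤ j → Continuous (γ i j) ∧ γ i j 0 = x i ∧ γ i j 1 = x j)
    (hdisj : ∀ i j k l : Fin 6, i < 3 → 3 ≤ j → k < 3 → 3 ≤ l → i ≠ k → j ≠ l →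
      ∀ s t, γ i j s ≠ γ k l t) : False := by
  obtain ⟨n, hn⟩ := exists_int_of_disjoint_curves hx (K := fun i j => i < 3 ∧ 3 ≤ j)
    (fun i j _ h => hγ i j h.1 h.2)
    (fun i j k l _ _ h h' a _ _ b => hdisj i j k l h.1 h.2 h'.1 h'.2 a b)
  have H : ∀ i j k l : Fin 6, i < j ∧ k < l ∧ (i < 3 ∧ 3 ≤ j) ∧ (k < 3 ∧ 3 ≤ l) ∧
      i ≠ k ∧ i ≠ l ∧ j ≠ k ∧ j ≠ l → _ :=
    fun i j k l h => hn i j k l h.1 h.2.1 h.2.2.1 h.2.2.2.1 h.2.2.2.2.1 h.2.2.2.2.2.1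
      h.2.2.2.2.2.2.1 h.2.2.2.2.2.2.2
  have e1 := H 0 3 1 4 (by decide)
  have e2 := H 0 4 1 3 (by decide)
  have e3 := H 0 3 1 5 (by decide)
  have e4 := H 0 5 1 3 (by decide)
  have e5 := H 0 4 1 5 (by decide)
  have e6 := H 0 5 1 4 (by decide)
  have e7 := H 0 3 2 4 (by decide)
  have e8 := H 0 4 2 3 (by decide)
  have e9 := H 0 3 2 5 (by decide)
  have e10 := H 0 5 2 3 (by decide)
  have e11 := H 0 4 2 5 (by decide)
  have e12 := H 0 5 2 4 (by decide)
  have e13 := H 1 3 2 4 (by decide)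
  have e14 := H 1 4 2 3 (by decide)
  have e15 := H 1 3 2 5 (by decide)
  have e16 := H 1 5 2 3 (by decide)
  have e17 := H 1 4 2 5 (by decide)
  have e18 := H 1 5 2 4 (by decide)
  simp only [show ∀ a b : Fin 6, (a < b) = (a.val < b.val) from fun _ _ => rfl] at e1 e2 e3 e4 e5 e6 e7 e8 e9 e10 e11 e12 e13 e14 e15 e16 e17 e18
  norm_num at e1 e2 e3 e4 e5 e6 e7 e8 e9 e10 e11 e12 e13 e14 e15 e16 e17 e18
  omega

/-! ### Branch sets in a plane drawing -/

/-- Any two vertices of `S` are joined by a walk inside `S`. -/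
def SimpleGraph.JoinedIn {V : Type*} (G : SimpleGraph V) (S : Set V) : Prop :=
  ∀ x ∈ S, ∀ y ∈ S, ∃ p : G.Walk x y, ∀ z ∈ p.support, z ∈ S

namespace PlaneDrawing

variable {V : Type*} {G : SimpleGraph V} (D : PlaneDrawing G)

/-- The part of the plane used by the vertices of `S` and the edges inside `S`. -/
def region (S : Set V) : Set (ℝ × ℝ) :=
  {x | (∃ v ∈ S, x = D.pos v) ∨ ∃ e ∈ G.edgeSet, (∀ v ∈ e, v ∈ S) ∧ x ∈ D.arc e}

/-- Two drawn vertices or edges can meet only in the point of a common vertex, and disjoint sets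
have none. -/
theorem disjoint_region {S T : Set V} (h : Disjoint S T) {x : ℝ × ℝ} (hS : x ∈ D.region S)
    (hT : x ∈ D.region T) : False := by
  have no : ∀ v, v ∈ S → v ∈ T → False := fun v a b => Set.disjoint_left.1 h a b
  rcases hS with ⟨v, hv, rfl⟩ | ⟨e, he, heS, hx⟩
  · rcases hT with ⟨w, hw, hvw⟩ | ⟨f, hf, hfT, hx⟩
    · exact no v hv (D.pos_injective hvw ▸ hw)
    · exact no v hv (hfT v (D.mem_of_pos_mem_arc f hf v hx))
  · rcases hT with ⟨w, hw, rfl⟩ | ⟨f, hf, hfT, hx'⟩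
    · exact no w (heS w (D.mem_of_pos_mem_arc e he w hx)) hw
    · have hne : e ≠ f := by
        rintro rfl
        induction e with | _ a b => exact no a (heS a (by simp)) (hfT a (by simp))
      obtain ⟨w, hwe, hwf, -⟩ := D.inter_arc e he f hf hne x ⟨hx, hx'⟩
      exact no w (heS w hwe) (hfT w hwf)

/-- The arcs of the edges are concatenated. The result need not be simple; the parity argument uses
continuity only. -/
theorem exists_path_of_walk {S : Set V} {u v : V} (p : G.Walk u v) (hp : ∀ z ∈ p.support, z ∈ S) :
    ∃ γ : Path (D.pos u) (D.pos v), ∀ t, γ t ∈ D.region S := by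
  induction p with
  | nil => exact ⟨Path.refl _, fun t => Or.inl ⟨_, hp _ (by simp), rfl⟩⟩
  | @cons u v w huv q ih =>
    obtain ⟨γ, hγ⟩ := ih fun z hz => hp z (by simp [hz])
    obtain ⟨δ, -, hδ⟩ := D.isArc u v huv
    refine ⟨δ.trans γ, fun t => ?_⟩
    have : (δ.trans γ) t ∈ Set.range (δ.trans γ) := ⟨t, rfl⟩
    rw [Path.trans_range] at this
    rcases this with h | ⟨s, hs⟩
    · refine Or.inr ⟨s(u, v), huv, ?_, hδ ▸ h⟩
      intro z hz
      rcases Sym2.mem_iff.1 hz with rfl | rfl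
      · exact hp _ (by simp)
      · exact hp _ (by simp)
    · rw [← hs]; exact hγ s

end PlaneDrawing

theorem SimpleGraph.JoinedIn.union {V : Type*} {G : SimpleGraph V} {S T : Set V} {x y : V}
    (hS : G.JoinedIn S) (hT : G.JoinedIn T) (hx : x ∈ S) (hy : y ∈ T) (hxy : G.Adj x y) :
    G.JoinedIn (S ∪ T) := by
  have key : ∀ a ∈ S, ∀ b ∈ T, ∃ p : G.Walk a b, ∀ z ∈ p.support, z ∈ S ∪ T := by
    intro a ha b hb
    obtain ⟨p, hp⟩ := hS a ha x hx
    obtain ⟨q, hq⟩ := hT y hy b hb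
    refine ⟨p.append (Walk.cons hxy q), fun z hz => ?_⟩
    rw [Walk.mem_support_append_iff, Walk.support_cons, List.mem_cons] at hz
    rcases hz with h | rfl | h
    · exact Or.inl (hp z h)
    · exact Or.inl hx
    · exact Or.inr (hq z h)
  rintro a (ha | ha) b (hb | hb)
  · obtain ⟨p, hp⟩ := hS a ha b hb
    exact ⟨p, fun z hz => Or.inl (hp z hz)⟩
  · exact key a ha b hb
  · obtain ⟨p, hp⟩ := key b hb a ha
    exact ⟨p.reverse, fun z hz => hp z (by simpa using hz)⟩
  · obtain ⟨p, hp⟩ := hT a ha b hb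
    exact ⟨p, fun z hz => Or.inr (hp z hz)⟩

/-- Curves in the complex plane extracted from branch sets of a plane drawing. -/
theorem PlaneDrawing.exists_curves {V : Type*} {G : SimpleGraph V} (D : PlaneDrawing G) {m : ℕ}
    {B : Fin m → Set V} {K : Fin m → Fin m → Prop} (hne : ∀ i, (B i).Nonempty)
    (hj : ∀ i, G.JoinedIn (B i)) (hd : ∀ i j, i ≠ j → Disjoint (B i) (B j))
    (hK : ∀ i j, K i j → ∃ x ∈ B i, ∃ y ∈ B j, G.Adj x y) :
    ∃ (x : Fin m → ℂ) (γ : Fin m → Fin m → ℝ → ℂ), Function.Injective x ∧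
      (∀ i j, K i j → Continuous (γ i j) ∧ γ i j 0 = x i ∧ γ i j 1 = x j) ∧
      ∀ i j k l, K i j → K k l → i ≠ k → i ≠ l → j ≠ k → j ≠ l → ∀ s t, γ i j s ≠ γ k l t := by
  choose r hr using hne
  let e := Complex.equivRealProdCLM.symm
  have hpath : ∀ i j, ∃ γ : ℝ → ℂ, K i j → Continuous γ ∧ γ 0 = e (D.pos (r i)) ∧
      γ 1 = e (D.pos (r j)) ∧ ∀ t, ∃ y ∈ D.region (B i ∪ B j), γ t = e y := by
    intro i j
    by_cases h : K i j
    · obtain ⟨a, ha, b, hb, hab⟩ := hK i j h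
      obtain ⟨p, hp⟩ := (hj i).union (hj j) ha hb hab (r i) (Or.inl (hr i)) (r j) (Or.inr (hr j))
      obtain ⟨γ, hγ⟩ := D.exists_path_of_walk p hp
      refine ⟨fun t => e (γ.extend t), fun _ => ⟨?_, ?_, ?_, fun t => ?_⟩⟩
      · exact e.continuous.comp γ.continuous_extend
      · simp
      · simp
      · refine ⟨_, ?_, rfl⟩
        have : γ.extend t ∈ Set.range γ := by rw [← γ.extend_range]; exact ⟨t, rfl⟩
        obtain ⟨s, hs⟩ := this
        rw [← hs]
        exact hγ s
    · exact ⟨0, fun h' => absurd h' h⟩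
  choose γ hγ using hpath
  refine ⟨fun i => e (D.pos (r i)), γ, fun i j h => ?_, fun i j h => ?_, ?_⟩
  · by_contra hij
    have := D.pos_injective (e.injective h)
    exact Set.disjoint_left.1 (hd i j hij) (hr i) (this ▸ hr j)
  · exact ⟨(hγ i j h).1, (hγ i j h).2.1, (hγ i j h).2.2.1⟩
  · intro i j k l h h' hik hil hjk hjl s t heq
    obtain ⟨y, hy, hys⟩ := (hγ i j h).2.2.2 s
    obtain ⟨z, hz, hzt⟩ := (hγ k l h').2.2.2 t
    rw [hys, hzt] at heq
    obtain rfl := e.injective heq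
    refine D.disjoint_region ?_ hy hz
    rw [Set.disjoint_union_left, Set.disjoint_union_right, Set.disjoint_union_right]
    exact ⟨⟨hd _ _ hik, hd _ _ hil⟩, hd _ _ hjk, hd _ _ hjl⟩

/-- Representatives of two branch sets are joined by a curve inside the region of their union.
Curves for disjoint pairs of indices are then disjoint, which is all that the parity argument asks
for. -/
theorem IsPlanar.no_K5_minor {V : Type*} {G : SimpleGraph V} (hG : IsPlanar G)
    {B : Fin 5 → Set V} (hne : ∀ i, (B i).Nonempty) (hj : ∀ i, G.JoinedIn (B i))
    (hd : ∀ i j, i < j → Disjoint (B i) (B j))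
    (hK : ∀ i j, i < j → ∃ x ∈ B i, ∃ y ∈ B j, G.Adj x y) : False := by
  obtain ⟨D⟩ := hG
  obtain ⟨x, γ, hx, hγ, hdis⟩ := D.exists_curves (K := fun i j => i < j) hne hj
    (fun i j hij => (lt_or_gt_of_ne hij).elim (hd i j) fun h => (hd j i h).symm) hK
  exact no_disjoint_curves_K5 hx hγ hdis

theorem IsPlanar.no_K33_minor {V : Type*} {G : SimpleGraph V} (hG : IsPlanar G)
    {B : Fin 6 → Set V} (hne : ∀ i, (B i).Nonempty) (hj : ∀ i, G.JoinedIn (B i))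
    (hd : ∀ i j, i < j → Disjoint (B i) (B j))
    (hK : ∀ i j : Fin 6, i < 3 → 3 ≤ j → ∃ x ∈ B i, ∃ y ∈ B j, G.Adj x y) : False := by
  obtain ⟨D⟩ := hG
  obtain ⟨x, γ, hx, hγ, hdis⟩ := D.exists_curves (K := fun i j => i < 3 ∧ 3 ≤ j) hne hj
    (fun i j hij => (lt_or_gt_of_ne hij).elim (hd i j) fun h => (hd j i h).symm)
    (fun i j h => hK i j h.1 h.2)
  refine no_disjoint_curves_K33 hx (fun i j h h' => hγ i j ⟨h, h'⟩) ?_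
  intro i j k l hi hj hk hl hik hjl
  exact hdis i j k l ⟨hi, hj⟩ ⟨hk, hl⟩ hik (hi.trans_le hl).ne (hk.trans_le hj).ne' hjl

/-! ### The rim of a radius one polytope is a Hamiltonian cycle of the rest -/

namespace SimpleGraph

variable {V : Type*} {G : SimpleGraph V}

theorem joinedIn_singleton (v : V) : G.JoinedIn {v} := by
  rintro x rfl y rfl
  exact ⟨Walk.nil, by simp⟩

theorem JoinedIn.of_isChain {l : List V} (h : l.IsChain G.Adj) : G.JoinedIn {v | v ∈ l} := by
  induction l with
  | nil => intro x hx; simp at hx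
  | cons a l ih =>
    cases l with
    | nil => simpa using joinedIn_singleton a
    | cons b l =>
      rw [List.isChain_cons_cons] at h
      have := (joinedIn_singleton a).union (ih h.2) rfl (by simp) h.1
      convert this using 1
      ext v; simp

theorem JoinedIn.image_Ico {c : ℕ → V} (h : ∀ t, G.Adj (c t) (c (t + 1))) (a b : ℕ) :
    G.JoinedIn (c '' Set.Ico a b) := by
  induction b with
  | zero => simp [JoinedIn]
  | succ b ih =>
    rcases lt_trichotomy a b with hab | rfl | hab
    · have e : c '' Set.Ico a (b + 1) = c '' Set.Ico a b ∪ {c b} := by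
        rw [← Set.image_singleton, ← Set.image_union]
        congr 1; ext t; simp; omega
      rw [e]
      refine ih.union (joinedIn_singleton _) (x := c (b - 1)) ⟨b - 1, ?_, rfl⟩ rfl ?_
      · simp; omega
      · have := h (b - 1); rwa [Nat.sub_add_cancel (by omega)] at this
    · have e : c '' Set.Ico a (a + 1) = {c a} := by
        rw [← Set.image_singleton]
        congr 1; ext t; simp; omega
      rw [e]; exact joinedIn_singleton _
    · rw [Set.Ico_eq_empty (by omega)]; simp [JoinedIn]

/-- `c :: M` lists the vertices of a cycle avoiding `z`; an edge counts as a cycle. -/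
structure IsCycleList (G : SimpleGraph V) (z c : V) (M : List V) : Prop where
  nodup : (c :: M).Nodup
  notMem : z ∉ c :: M
  chain : (c :: (M ++ [c])).IsChain G.Adj

theorem IsCycleList.rotate {z c c' : V} {M : List V} (h : G.IsCycleList z c M)
    (hc' : c' ∈ c :: M) :
    ∃ M', G.IsCycleList z c' M' ∧ (c' :: M').Perm (c :: M) := by
  rcases List.mem_cons.1 hc' with rfl | hc'
  · exact ⟨M, h, List.Perm.refl _⟩
  · obtain ⟨A, B, rfl⟩ := List.append_of_mem hc'
    have hp : (c' :: (B ++ c :: A)).Perm (c :: (A ++ c' :: B)) := by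
      have := List.perm_append_comm (l₁ := c' :: B) (l₂ := c :: A)
      simpa using this
    refine ⟨B ++ c :: A, ⟨hp.nodup_iff.2 h.nodup, fun hz => h.notMem (hp.mem_iff.1 hz), ?_⟩, hp⟩
    have hch := h.chain
    have e1 : c :: ((A ++ c' :: B) ++ [c]) = (c :: A) ++ c' :: (B ++ [c]) := by simp
    have e2 : c' :: ((B ++ c :: A) ++ [c']) = (c' :: B) ++ c :: (A ++ [c']) := by simp
    rw [e1, List.isChain_split] at hch
    rw [e2, List.isChain_split]
    exact ⟨by simpa using hch.2, by simpa using hch.1⟩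

end SimpleGraph

theorem List.exists_first_mem {α : Type*} {L : Set α} {l : List α} (h : ∃ y ∈ l, y ∈ L) :
    ∃ X c R, l = X ++ c :: R ∧ c ∈ L ∧ ∀ v ∈ X, v ∉ L := by
  induction l with
  | nil => simp at h
  | cons a l ih =>
    by_cases ha : a ∈ L
    · exact ⟨[], a, l, rfl, ha, by simp⟩
    · obtain ⟨X, c, R, rfl, hc, hX⟩ := ih (by
        obtain ⟨y, hy, hyL⟩ := h
        rcases List.mem_cons.1 hy with rfl | hy
        · exact absurd hyL ha
        · exact ⟨y, hy, hyL⟩)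
      exact ⟨a :: X, c, R, rfl, hc, by simpa [ha] using hX⟩

theorem IsThreeConnected.exists_walk {V : Type*} [Fintype V] {G : SimpleGraph V}
    (h : IsThreeConnected G) {S : Finset V} (hS : S.card < 3) {x y : V} (hx : x ∉ S)
    (hy : y ∉ S) : ∃ p : G.Walk x y, ∀ v ∈ p.support, v ∉ S := by
  obtain ⟨p⟩ := (h.2 S hS).preconnected ⟨x, by simpa using hx⟩ ⟨y, by simpa using hy⟩
  refine ⟨p.map (SimpleGraph.Embedding.induce _).toHom, fun v hv => ?_⟩
  obtain ⟨w, -, rfl⟩ := List.mem_map.1 ((SimpleGraph.Walk.support_map _ p) ▸ hv)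
  exact fun h => w.2 (Finset.mem_coe.2 h)

theorem List.IsChain.exists_rel_head {α : Type*} {R : α → α → Prop} {c : α} {X Y : List α}
    (h : (c :: (X ++ Y)).IsChain R) (hX : X ≠ []) : ∃ x ∈ X, R c x := by
  obtain ⟨x, X, rfl⟩ := List.exists_cons_of_ne_nil hX
  rw [List.cons_append, List.isChain_cons_cons] at h
  exact ⟨x, by simp, h.1⟩

theorem List.IsChain.exists_rel_last {α : Type*} {R : α → α → Prop} {c d : α} {X : List α}
    (h : (c :: (X ++ [d])).IsChain R) (hX : X ≠ []) : ∃ x ∈ X, R x d := by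
  obtain ⟨X, x, rfl⟩ : ∃ Y y, X = Y ++ [y] := ⟨_, _, (List.dropLast_append_getLast hX).symm⟩
  have e : c :: ((X ++ [x]) ++ [d]) = (c :: X) ++ x :: [d] := by simp
  rw [e, List.isChain_append_cons_cons] at h
  exact ⟨x, by simp, h.2.1⟩

-- An ear argument. Some cycle vertex c has a neighbour outside the cycle and different from z, and
-- deleting z and c leaves a path X from there to another cycle vertex c'. If c and c' are
-- consecutive on the cycle, X replaces the edge between them. Otherwise X and the two arcs A, B of
-- the cycle are each adjacent to c, c' and z, which is a K₃,₃ minor.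
open SimpleGraph in
theorem IsThreePolytope.exists_longer_cycle {V : Type*} [Fintype V] {G : SimpleGraph V}
    (hG : IsThreePolytope G) {z : V} (hz : ∀ v, v ≠ z → G.Adj z v) {c : V} {M : List V}
    (hM : M ≠ []) (h : G.IsCycleList z c M) (hv : ∃ v, v ≠ z ∧ v ∉ c :: M) :
    ∃ c' M', M' ≠ [] ∧ G.IsCycleList z c' M' ∧ M.length < M'.length := by
  classical
  obtain ⟨hpl, h3⟩ := hG
  obtain ⟨v, hvz, hvM⟩ := hv
  obtain ⟨p, hp⟩ := h3.exists_walk (S := {z}) (by simp)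
    (x := c) (y := v) (by simpa using fun e : c = z => h.notMem (by simp [e])) (by simpa using hvz)
  obtain ⟨d, hd, hd1, hd2⟩ := p.exists_boundary_dart {v | v ∈ c :: M} (by simp) hvM
  obtain ⟨M₁, h₁, hperm⟩ := h.rotate hd1
  have hlen : M₁.length = M.length := by simpa using hperm.length_eq
  rw [← hlen]
  have hM₁ : M₁ ≠ [] := by
    rw [← List.length_pos_iff, hlen, List.length_pos_iff]; exact hM
  have hx : d.snd ∉ d.fst :: M₁ := fun hh => hd2 (hperm.mem_iff.1 hh)
  have hxz : d.snd ≠ z := by simpa using hp _ (p.dart_snd_mem_support_of_mem_darts hd)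
  have hadj := d.adj
  generalize d.fst = c at *
  generalize d.snd = x at *
  obtain ⟨m, hm⟩ := List.exists_mem_of_ne_nil _ hM₁
  have hmc : m ≠ c := fun e => (List.nodup_cons.1 h₁.nodup).1 (e ▸ hm)
  have hmz : m ≠ z := fun e => h₁.notMem (by simp [← e, hm])
  -- This is where 3-connectedness is needed. `bypass` turns the walk into a path, and its part `X`
  -- before the first cycle vertex `c'` is the ear.
  obtain ⟨q, hq⟩ := h3.exists_walk (S := {z, c}) (Finset.card_le_two.trans_lt (by simp))
    (x := x) (y := m) (by simp only [Finset.mem_insert, Finset.mem_singleton, not_or]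
                          exact ⟨hxz, fun e => hx (by simp [e])⟩) (by simp [hmc, hmz])
  obtain ⟨X, c', R, hX, hc', hXL⟩ := List.exists_first_mem (L := {v | v ∈ c :: M₁})
    (l := q.bypass.support) ⟨m, by simp, by simp [hm]⟩
  have hsub : ∀ v ∈ X ++ c' :: R, v ≠ z ∧ v ≠ c := by
    intro v hv
    rw [← hX] at hv
    simpa using hq v (q.support_bypass_subset_support hv)
  have hXne : X ≠ [] := by
    rintro rfl
    have : (q.bypass.support).head? = some x := by
      rw [List.head?_eq_some_head (by simp)]; simp
    rw [hX] at this
    simp only [List.nil_append, List.head?_cons, Option.some.injEq] at this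
    exact hx (this ▸ hc')
  have hXch : (c :: (X ++ [c'])).IsChain G.Adj := by
    have hch := q.bypass.isChain_adj_support
    have hhd : (q.bypass.support).head? = some x := by
      rw [List.head?_eq_some_head (by simp)]; simp
    rw [hX] at hch hhd
    obtain ⟨y, Y, rfl⟩ := List.exists_cons_of_ne_nil hXne
    simp only [List.cons_append, List.head?_cons, Option.some.injEq] at hhd
    subst hhd
    rw [List.cons_append, List.isChain_cons_cons]
    exact ⟨hadj, by simpa using (List.isChain_split.1 hch).1⟩
  have hXnd : X.Nodup := by
    have := q.bypass_isPath.support_nodup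
    rw [hX] at this
    exact (List.nodup_append.1 this).1
  have hc'M : c' ∈ M₁ := by
    rcases List.mem_cons.1 hc' with e | e
    · exact absurd e (hsub c' (by simp)).2
    · exact e
  obtain ⟨A, B, rfl⟩ := List.append_of_mem hc'M
  have hXz : z ∉ X := fun hh => (hsub z (by simp [hh])).1 rfl
  have hch := h₁.chain
  have e1 : c :: ((A ++ c' :: B) ++ [c]) = (c :: A) ++ c' :: (B ++ [c]) := by simp
  rw [e1, List.isChain_split] at hch
  obtain ⟨hA, hB⟩ := hch
  rw [List.cons_append] at hA
  have nd := h₁.nodup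
  have nz := h₁.notMem
  simp only [List.nodup_cons, List.mem_append, List.mem_cons, not_or, List.nodup_append] at nd nz
  simp only [Set.mem_ofPred_eq, List.mem_cons, List.mem_append, not_or] at hXL
  have hXpos : 0 < X.length := List.length_pos_iff.2 hXne
  by_cases hA0 : A = []
  · subst hA0
    refine ⟨c, X ++ c' :: B, by simp, ⟨?_, ?_, ?_⟩, by simp; omega⟩
    · simp only [List.nodup_cons, List.mem_append, List.mem_cons, not_or, List.nodup_append]
      grind
    · simp only [List.mem_append, List.mem_cons, not_or]
      exact ⟨nz.1, hXz, nz.2.2⟩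
    · have e2 : c :: ((X ++ c' :: B) ++ [c]) = (c :: X) ++ c' :: (B ++ [c]) := by simp
      rw [e2, List.isChain_split]
      exact ⟨hXch, hB⟩
  by_cases hB0 : B = []
  · subst hB0
    refine ⟨c, A ++ c' :: X.reverse, by simp, ⟨?_, ?_, ?_⟩, by simp; omega⟩
    · simp only [List.nodup_cons, List.mem_append, List.mem_cons, not_or, List.nodup_append,
        List.mem_reverse, List.nodup_reverse]
      grind
    · simp only [List.mem_append, List.mem_cons, not_or, List.mem_reverse]
      exact ⟨nz.1, nz.2.1, nz.2.2.1, hXz⟩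
    · have e2 : c :: ((A ++ c' :: X.reverse) ++ [c]) = (c :: A) ++ c' :: (X.reverse ++ [c]) := by
        simp
      rw [e2, List.isChain_split]
      refine ⟨hA, ?_⟩
      have : (c :: (X ++ [c'])).reverse.IsChain G.Adj :=
        List.isChain_reverse.2 (hXch.imp fun _ _ h => h.symm)
      simpa using this
  · exfalso
    refine hpl.no_K33_minor (B := ![{c}, {c'}, {z}, {v | v ∈ X}, {v | v ∈ A}, {v | v ∈ B}])
      ?_ ?_ ?_ ?_
    · intro i
      fin_cases i
      · exact ⟨c, rfl⟩
      · exact ⟨c', rfl⟩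
      · exact ⟨z, rfl⟩
      · exact List.exists_mem_of_ne_nil _ hXne
      · exact List.exists_mem_of_ne_nil _ hA0
      · exact List.exists_mem_of_ne_nil _ hB0
    · intro i
      fin_cases i
      · exact joinedIn_singleton c
      · exact joinedIn_singleton c'
      · exact joinedIn_singleton z
      · exact JoinedIn.of_isChain (List.isChain_append.1 (List.isChain_cons.1 hXch).2).1
      · exact JoinedIn.of_isChain (List.isChain_append.1 (List.isChain_cons.1 hA).2).1
      · exact JoinedIn.of_isChain (List.isChain_append.1 (List.isChain_cons.1 hB).2).1
    · have key : ∀ i j : Fin 6, i < j → ∀ v,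
          v ∈ (![{c}, {c'}, {z}, {v | v ∈ X}, {v | v ∈ A}, {v | v ∈ B}] : Fin 6 → Set V) i →
          v ∉ (![{c}, {c'}, {z}, {v | v ∈ X}, {v | v ∈ A}, {v | v ∈ B}] : Fin 6 → Set V) j := by
        intro i j hij v
        fin_cases i <;> fin_cases j <;> first | exact absurd hij (by decide) | skip
        all_goals simp only [Fin.zero_eta, Fin.mk_one, Fin.reduceFinMk, Matrix.cons_val,
          Set.mem_singleton_iff, Set.mem_ofPred_eq]
        all_goals grind
      exact fun i j hij => Set.disjoint_left.2 (key i j hij)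
    · have a1 := hXch.exists_rel_head hXne
      have a2 := hXch.exists_rel_last hXne
      have b1 := hA.exists_rel_head hA0
      have b2 := hA.exists_rel_last hA0
      have c1 := hB.exists_rel_head hB0
      have c2 := hB.exists_rel_last hB0
      have dz : ∀ Y : List V, Y ≠ [] → z ∉ Y → ∃ y ∈ Y, G.Adj z y := by
        intro Y hY hzY
        obtain ⟨y, hy⟩ := List.exists_mem_of_ne_nil _ hY
        exact ⟨y, hy, hz y fun e => hzY (e ▸ hy)⟩
      have d1 := dz X hXne hXz
      have d2 := dz A hA0 nz.2.1
      have d3 := dz B hB0 nz.2.2.2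
      have sw : ∀ {Y : List V} {d : V}, (∃ x ∈ Y, G.Adj x d) → ∃ x ∈ Y, G.Adj d x :=
        fun ⟨x, hx, h⟩ => ⟨x, hx, h.symm⟩
      intro i j hi hj
      fin_cases i <;> fin_cases j <;>
        first
        | exact absurd hi (by decide)
        | exact absurd hj (by decide)
        | skip
      · exact ⟨c, rfl, a1⟩
      · exact ⟨c, rfl, b1⟩
      · exact ⟨c, rfl, sw c2⟩
      · exact ⟨c', rfl, sw a2⟩
      · exact ⟨c', rfl, sw b2⟩
      · exact ⟨c', rfl, c1⟩
      · exact ⟨z, rfl, d1⟩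
      · exact ⟨z, rfl, d2⟩
      · exact ⟨z, rfl, d3⟩

/-- The vertices other than `z` form a cycle `c 0, c 1, …, c (n - 1)`, and `z` is adjacent to all
of them. -/
structure SimpleGraph.IsRim {V : Type*} (G : SimpleGraph V) (z : V) (n : ℕ) (c : ℕ → V) :
    Prop where
  three_le : 3 ≤ n
  apex : ∀ v, v ≠ z → G.Adj z v
  adj : ∀ t, G.Adj (c t) (c (t + 1))
  eq_iff : ∀ s t, c s = c t ↔ s % n = t % n
  ne_apex : ∀ t, c t ≠ z
  surj : ∀ v, v ≠ z → ∃ t, t < n ∧ c t = v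

-- Start from a single edge, counted as a cycle, and lengthen. A list without repetitions has
-- bounded length, so at some point nothing but z is missed. The list is then indexed periodically.
open SimpleGraph in
theorem IsThreePolytope.exists_isRim {V : Type*} [Fintype V] {G : SimpleGraph V}
    (hG : IsThreePolytope G) {z : V} (hz : ∀ v, v ≠ z → G.Adj z v) :
    ∃ c : ℕ → V, G.IsRim z (Fintype.card V - 1) c := by
  classical
  have hcard := hG.2.1
  have base : ∃ c M, M ≠ [] ∧ G.IsCycleList z c M := by
    obtain ⟨x, hx⟩ : ∃ x, x ∉ ({z} : Finset V) := by
      by_contra! h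
      have := Finset.card_le_card (fun v _ => h v : (Finset.univ : Finset V) ⊆ {z})
      simp [Finset.card_univ] at this; omega
    obtain ⟨y, hy⟩ : ∃ y, y ∉ ({z, x} : Finset V) := by
      by_contra! h
      have := Finset.card_le_card (fun v _ => h v : (Finset.univ : Finset V) ⊆ {z, x})
      have h2 := Finset.card_le_two (a := z) (b := x)
      rw [Finset.card_univ] at this; omega
    simp only [Finset.mem_singleton, Finset.mem_insert, not_or] at hx hy
    obtain ⟨p, hp⟩ := hG.2.exists_walk (S := {z}) (by simp) (x := x) (y := y)
      (by simpa using hx) (by simpa using hy.1)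
    cases p with
    | nil => exact absurd rfl hy.2
    | @cons _ w _ hxw p =>
      have hw := hp w (by simp)
      refine ⟨x, [w], by simp, ⟨by simpa using hxw.ne, ?_, by simp [hxw, hxw.symm]⟩⟩
      simp at hw ⊢
      exact ⟨fun e => hx e.symm, fun e => hw e.symm⟩
  have long : ∃ c M, M ≠ [] ∧ G.IsCycleList z c M ∧ ∀ v, v ≠ z → v ∈ c :: M := by
    by_contra! hcon
    have : ∀ k, ∃ c M, M ≠ [] ∧ G.IsCycleList z c M ∧ k ≤ M.length := by
      intro k
      induction k with
      | zero => obtain ⟨c, M, h1, h2⟩ := base; exact ⟨c, M, h1, h2, by simp⟩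
      | succ k ih =>
        obtain ⟨c, M, h1, h2, h3⟩ := ih
        obtain ⟨c', M', h4, h5, h6⟩ := hG.exists_longer_cycle hz h1 h2 (hcon c M h1 h2)
        exact ⟨c', M', h4, h5, by omega⟩
    obtain ⟨c, M, -, h2, h3⟩ := this (Fintype.card V)
    have := h2.nodup.length_le_card
    simp at this; omega
  obtain ⟨c, M, -, hM, hall⟩ := long
  set L := c :: M with hL
  have hn : L.length = Fintype.card V - 1 := by
    have e : L.toFinset = Finset.univ.erase z := by
      ext v
      simp only [List.mem_toFinset, Finset.mem_erase, Finset.mem_univ, and_true]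
      exact ⟨fun h e => hM.notMem (e ▸ h), hall v⟩
    rw [← List.toFinset_card_of_nodup hM.nodup, e, Finset.card_erase_of_mem (Finset.mem_univ _),
      Finset.card_univ]
  rw [← hn]
  have hpos : 0 < L.length := by simp [hL]
  have hget : ∀ t, t < L.length → (c :: (M ++ [c]))[t]? = L[t]? := by
    intro t ht
    rw [← List.cons_append, List.getElem?_append_left ht]
  refine ⟨fun t => L[t % L.length]'(Nat.mod_lt _ hpos), ⟨by omega, hz, fun t => ?_, ?_, ?_, ?_⟩⟩
  · have hlt := Nat.mod_lt t hpos
    have hch := hM.chain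
    rw [List.isChain_iff_getElem] at hch
    have h1 := hch (t % L.length) (by simpa [hL] using hlt)
    have e0 : (c :: (M ++ [c]))[t % L.length]'(by simp [hL] at hlt ⊢; omega) = L[t % L.length] := by
      have := hget _ hlt
      rwa [List.getElem?_eq_getElem (by simp [hL] at hlt ⊢; omega), List.getElem?_eq_getElem hlt,
        Option.some.injEq] at this
    rw [e0] at h1
    convert h1 using 1
    rcases Nat.lt_or_ge (t % L.length + 1) L.length with hh | hh
    · have e2 : (t + 1) % L.length = t % L.length + 1 := by
        rw [Nat.add_mod, Nat.mod_eq_of_lt (a := 1) (by omega), Nat.mod_eq_of_lt hh]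
      have := hget _ hh
      rw [List.getElem?_eq_getElem (by simp [hL] at hlt ⊢; omega), List.getElem?_eq_getElem hh,
        Option.some.injEq] at this
      simp only [e2]
      exact this.symm
    · have e2 : (t + 1) % L.length = 0 := by
        have e3 : t % L.length + 1 = L.length := by omega
        rw [Nat.add_mod, Nat.mod_eq_of_lt (a := 1) (by omega), e3, Nat.mod_self]
      have e3 : t % L.length + 1 = M.length + 1 := by simp [hL] at hh hlt ⊢; omega
      simp only [e2, e3]
      simp [hL]
  · intro s t
    exact hM.nodup.getElem_inj_iff
  · intro t e
    exact hM.notMem (e ▸ List.getElem_mem _)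
  · intro v hv
    obtain ⟨t, ht, e⟩ := List.mem_iff_getElem.1 (hall v hv)
    exact ⟨t, ht, by simp only [Nat.mod_eq_of_lt ht, e]⟩

/-! ### Strips -/

/-- The vertices of a strip: the apex, two ends (`false` and `true`), and the two sides. -/
abbrev StripVertex (k l : ℕ) : Type := Unit ⊕ Bool ⊕ Fin (k + 1) ⊕ Fin (l + 1)

/-- An orientation of the edges of a strip whose two sides are joined according to `E`. -/
def stripRel (k l : ℕ) (E : ℕ → ℕ → Prop) : StripVertex k l → StripVertex k l → Prop
  | .inl _, _ => True
  | .inr (.inl false), .inr (.inr (.inl i)) => i.val = 0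
  | .inr (.inl false), .inr (.inr (.inr j)) => j.val = 0
  | .inr (.inl true), .inr (.inr (.inl i)) => i.val = k
  | .inr (.inl true), .inr (.inr (.inr j)) => j.val = l
  | .inr (.inr (.inl i)), .inr (.inr (.inl i')) => i'.val = i.val + 1
  | .inr (.inr (.inr j)), .inr (.inr (.inr j')) => j'.val = j.val + 1
  | .inr (.inr (.inl i)), .inr (.inr (.inr j)) => E i j
  | _, _ => False

/-- The graph of an apex joined to all vertices of an outerplanar strip. -/
def stripGraph (k l : ℕ) (E : ℕ → ℕ → Prop) : SimpleGraph (StripVertex k l) :=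
  SimpleGraph.fromRel (stripRel k l E)

namespace SimpleGraph.IsRim

variable {V : Type*} {G : SimpleGraph V} {z : V} {n : ℕ} {c : ℕ → V}

theorem add_period (h : G.IsRim z n c) (t : ℕ) : c (t + n) = c t :=
  (h.eq_iff _ _).2 (by simp)

theorem eq_add_period (h : G.IsRim z n c) {s t : ℕ} (e : s = t + n) : c s = c t :=
  e ▸ h.add_period t

theorem inj (h : G.IsRim z n c) {s t : ℕ} (hst : c s = c t) (h1 : s ≤ t) (h2 : t < s + n) :
    s = t := by
  have := (h.eq_iff _ _).1 hst
  by_contra hne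
  have h4 := Nat.sub_mod_eq_zero_of_mod_eq this.symm
  rw [Nat.mod_eq_of_lt (by omega)] at h4
  omega

theorem shift (h : G.IsRim z n c) (a : ℕ) : G.IsRim z n (fun t => c (t + a)) where
  three_le := h.three_le
  apex := h.apex
  adj t := by have := h.adj (t + a); rwa [show t + a + 1 = t + 1 + a by ring] at this
  eq_iff s t := by
    rw [h.eq_iff]
    exact ⟨fun e => Nat.ModEq.add_right_cancel' a e, fun e => Nat.ModEq.add_right a e⟩
  ne_apex t := h.ne_apex _
  surj v hv := by
    obtain ⟨t, ht, rfl⟩ := h.surj v hv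
    have hn : 0 < n := by have := h.three_le; omega
    refine ⟨(t + (n - a % n)) % n, Nat.mod_lt _ hn, ?_⟩
    rw [h.eq_iff]
    have h2 : (t + (n - a % n)) % n + a ≡ t [MOD n] := by
      have : (t + (n - a % n)) % n + a ≡ t + (n - a % n) + a % n [MOD n] :=
        Nat.ModEq.add (Nat.mod_modEq _ _) (Nat.mod_modEq _ _).symm
      refine this.trans ?_
      rw [show t + (n - a % n) + a % n = t + n by have := Nat.mod_lt a hn; omega]
      simp [Nat.ModEq]
    exact h2

/-- Two chords of the rim do not cross. -/
theorem not_crossing (h : G.IsRim z n c) (hG : IsPlanar G) {i j k l : ℕ} (hij : i < j)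
    (hjk : j < k) (hkl : k < l) (hl : l < i + n) (h1 : G.Adj (c i) (c k))
    (h2 : G.Adj (c j) (c l)) : False := by
  -- The four chord ends cut the rim into four arcs, each starting at one of them. The apex touches
  -- all arcs, consecutive arcs are joined by rim edges, and the two chords join the opposite pairs.
  refine hG.no_K5_minor (B := ![{z}, c '' Set.Ico i j, c '' Set.Ico j k, c '' Set.Ico k l,
    c '' Set.Ico l (i + n)]) ?_ ?_ ?_ ?_
  · intro a
    fin_cases a
    · exact ⟨z, rfl⟩
    · exact ⟨c i, i, by simp; omega, rfl⟩
    · exact ⟨c j, j, by simp; omega, rfl⟩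
    · exact ⟨c k, k, by simp; omega, rfl⟩
    · exact ⟨c l, l, by simp; omega, rfl⟩
  · intro a
    fin_cases a
    · exact joinedIn_singleton z
    all_goals exact JoinedIn.image_Ico h.adj _ _
  · have hz : ∀ a b, Disjoint ({z} : Set V) (c '' Set.Ico a b) := by
      intro a b
      rw [Set.disjoint_singleton_left]
      rintro ⟨t, -, ht⟩
      exact h.ne_apex t ht
    have hd : ∀ a b d e, i ≤ a → b ≤ d → e ≤ i + n →
        Disjoint (c '' Set.Ico a b) (c '' Set.Ico d e) := by
      intro a b d e ha hbd he
      rw [Set.disjoint_left]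
      rintro _ ⟨s, hs, rfl⟩ ⟨t, ht, hst⟩
      simp only [Set.mem_Ico] at hs ht
      have := h.inj hst.symm (by omega) (by omega)
      omega
    intro a b hab
    fin_cases a <;> fin_cases b <;> first | exact absurd hab (by decide) | skip
    · exact hz _ _
    · exact hz _ _
    · exact hz _ _
    · exact hz _ _
    · exact hd _ _ _ _ le_rfl le_rfl (by omega)
    · exact hd _ _ _ _ le_rfl hjk.le (by omega)
    · exact hd _ _ _ _ le_rfl (by omega) (by omega)
    · exact hd _ _ _ _ (by omega) le_rfl (by omega)
    · exact hd _ _ _ _ (by omega) hkl.le (by omega)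
    · exact hd _ _ _ _ (by omega) le_rfl (by omega)
  · have hz : ∀ a b, a < b → ∃ x ∈ ({z} : Set V), ∃ y ∈ c '' Set.Ico a b, G.Adj x y :=
      fun a b hab => ⟨z, rfl, c a, ⟨a, by simp [hab], rfl⟩, h.apex _ (h.ne_apex a)⟩
    have hs : ∀ a b d, a < b → b < d →
        ∃ x ∈ c '' Set.Ico a b, ∃ y ∈ c '' Set.Ico b d, G.Adj x y := by
      intro a b d hab hbd
      refine ⟨c (b - 1), ⟨b - 1, by simp; omega, rfl⟩, c b, ⟨b, by simp [hbd], rfl⟩, ?_⟩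
      have := h.adj (b - 1)
      rwa [Nat.sub_add_cancel (by omega)] at this
    intro a b hab
    fin_cases a <;> fin_cases b <;> first | exact absurd hab (by decide) | skip
    · exact hz _ _ hij
    · exact hz _ _ hjk
    · exact hz _ _ hkl
    · exact hz _ _ hl
    · exact hs _ _ _ hij hjk
    · exact ⟨c i, ⟨i, by simp [hij], rfl⟩, c k, ⟨k, by simp [hkl], rfl⟩, h1⟩
    · refine ⟨c i, ⟨i, by simp [hij], rfl⟩, c (i + n - 1), ⟨i + n - 1, by simp; omega, rfl⟩, ?_⟩
      have := h.adj (i + n - 1)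
      rw [Nat.sub_add_cancel (by omega), h.add_period] at this
      exact this.symm
    · exact hs _ _ _ hjk hkl
    · exact ⟨c j, ⟨j, by simp [hjk], rfl⟩, c l, ⟨l, by simp [hl], rfl⟩, h2⟩
    · exact hs _ _ _ hkl hl

/-- A vertex of the rim without chords has degree three. -/
theorem neighborSet_ncard_eq_three (h : G.IsRim z n c) {i : ℕ}
    (hi : ∀ t, i + 2 ≤ t → t ≤ i + n - 2 → ¬ G.Adj (c i) (c t)) :
    (G.neighborSet (c i)).ncard = 3 := by
  have hn := h.three_le
  have e : G.neighborSet (c i) = {z, c (i + 1), c (i + n - 1)} := by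
    ext v
    simp only [mem_neighborSet, Set.mem_insert_iff, Set.mem_singleton_iff]
    constructor
    · intro hv
      by_contra! hcon
      obtain ⟨h1, h2, h3⟩ := hcon
      obtain ⟨t, ht, rfl⟩ := (h.shift i).surj v h1
      have h4 : t ≠ 0 := by rintro rfl; simp at hv
      have h5 : t ≠ 1 := by rintro rfl; exact h2 (by rw [add_comm])
      have h6 : t ≠ n - 1 := by
        rintro rfl; exact h3 (by congr 1; omega)
      exact hi (t + i) (by omega) (by omega) hv
    · rintro (rfl | rfl | rfl)
      · exact (h.apex _ (h.ne_apex i)).symm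
      · exact h.adj i
      · have := h.adj (i + n - 1)
        rw [Nat.sub_add_cancel (by omega), h.add_period] at this
        exact this.symm
  have h1 := h.ne_apex (i + 1)
  have h2 := h.ne_apex (i + n - 1)
  have h3 : c (i + 1) ≠ c (i + n - 1) := by
    intro e
    have := h.inj e (by omega) (by omega)
    omega
  rw [e, Set.ncard_eq_three]
  exact ⟨_, _, _, h1.symm, h2.symm, h3, rfl⟩

/-- A vertex of degree three of the rim has no chords. -/
theorem not_adj_of_ncard_eq_three [Finite V] (h : G.IsRim z n c) {i : ℕ}
    (hi : (G.neighborSet (c i)).ncard = 3) {t : ℕ} (h1 : i + 2 ≤ t) (h2 : t ≤ i + n - 2) :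
    ¬ G.Adj (c i) (c t) := by
  intro hadj
  have hn := h.three_le
  have hsub : ({z, c (i + 1), c (i + n - 1), c t} : Set V) ⊆ G.neighborSet (c i) := by
    intro v
    simp only [mem_neighborSet, Set.mem_insert_iff, Set.mem_singleton_iff]
    rintro (rfl | rfl | rfl | rfl)
    · exact (h.apex _ (h.ne_apex i)).symm
    · exact h.adj i
    · have := h.adj (i + n - 1)
      rw [Nat.sub_add_cancel (by omega), h.add_period] at this
      exact this.symm
    · exact hadj
  have hcard : ({z, c (i + 1), c (i + n - 1), c t} : Set V).ncard = 4 := by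
    have n1 : c (i + 1) ≠ c (i + n - 1) := fun e => by
      have := h.inj e (by omega) (by omega); omega
    have n2 : c (i + 1) ≠ c t := fun e => by
      have := h.inj e (by omega) (by omega); omega
    have n3 : c (i + n - 1) ≠ c t := fun e => by
      have := h.inj e.symm (by omega) (by omega); omega
    rw [Set.ncard_insert_of_notMem, Set.ncard_insert_of_notMem, Set.ncard_pair n3]
    · simp [n1, n2]
    · simp [(h.ne_apex _).symm]
  have := Set.ncard_le_ncard hsub
  omega

/-- If exactly two rim vertices have degree three, then no chord has both ends on the same side
of them. -/
theorem not_adj_same_side [Finite V] (h : G.IsRim z n c) (hG : IsPlanar G) {q : ℕ}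
    (hq : ∀ t, t < n → (G.neighborSet (c t)).ncard = 3 → t = 0 ∨ t = q) (d : ℕ) :
    ∀ i j, j = i + d → 2 ≤ d → (0 < i ∧ j < q ∧ q ≤ n ∨ q < i ∧ j < n) → ¬ G.Adj (c i) (c j) := by
  induction d using Nat.strong_induction_on with
  | _ d ih =>
    rintro i j rfl hd hside hadj
    -- The vertex just after `i` lies on the same side, so it has a chord. Either that chord stays
    -- under the given one and is shorter, or it crosses the given one.
    have hv : (G.neighborSet (c (i + 1))).ncard ≠ 3 := fun e => by
      have := hq (i + 1) (by omega) e
      omega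
    obtain ⟨t, h1, h2, h3⟩ : ∃ t, i + 1 + 2 ≤ t ∧ t ≤ i + 1 + n - 2 ∧ G.Adj (c (i + 1)) (c t) := by
      by_contra! hcon
      exact hv (h.neighborSet_ncard_eq_three hcon)
    by_cases ht : t ≤ i + d
    · exact ih (t - (i + 1)) (by omega) (i + 1) t (by omega) (by omega) (by omega) h3
    · exact h.not_crossing hG (i := i) (j := i + 1) (k := i + d) (l := t) (by omega) (by omega)
        (by omega) (by omega) hadj h3

theorem exists_stripGraph_iso [Finite V] (h : G.IsRim z n c) (hG : IsPlanar G) {q : ℕ}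
    (hq0 : 0 < q) (hqn : q < n) (h0 : (G.neighborSet (c 0)).ncard = 3)
    (hq3 : (G.neighborSet (c q)).ncard = 3)
    (hq : ∀ t, t < n → (G.neighborSet (c t)).ncard = 3 → t = 0 ∨ t = q) :
    ∃ (k l : ℕ) (E : ℕ → ℕ → Prop), Nonempty (stripGraph k l E ≃g G) ∧
      (∀ i j i' j', i ≤ k → i' ≤ k → j ≤ l → j' ≤ l → E i j → E i' j' → i < i' → j ≤ j') ∧
      (∀ i ≤ k, ∃ j ≤ l, E i j) ∧ ∀ j ≤ l, ∃ i ≤ k, E i j := by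
  have hn := h.three_le
  have same : ∀ i j, i + 2 ≤ j → (0 < i ∧ j < q ∨ q < i ∧ j < n) → ¬ G.Adj (c i) (c j) :=
    fun i j hij hs => h.not_adj_same_side hG hq (j - i) i j (by omega) (by omega) (by omega)
  have no0 : ∀ t, 2 ≤ t → t ≤ n - 2 → ¬ G.Adj (c 0) (c t) := fun t h1 h2 =>
    h.not_adj_of_ncard_eq_three h0 (by omega) (by omega)
  have noq : ∀ t, q + 2 ≤ t → t ≤ q + n - 2 → ¬ G.Adj (c q) (c t) := fun t h1 h2 =>
    h.not_adj_of_ncard_eq_three hq3 (by omega) (by omega)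
  have noq' : ∀ t, t + 2 ≤ q → q ≤ t + n - 2 → ¬ G.Adj (c q) (c t) := fun t h1 h2 => by
    rw [← h.add_period t]; exact noq _ (by omega) (by omega)
  have chord : ∀ i, i < n → i ≠ 0 → i ≠ q →
      ∃ t, i + 2 ≤ t ∧ t ≤ i + n - 2 ∧ G.Adj (c i) (c t) := by
    intro i hi hi0 hiq
    by_contra! hcon
    rcases hq i hi (h.neighborSet_ncard_eq_three hcon) with e | e <;> contradiction
  -- The chord of a vertex on the first side cannot end on its own side or at a vertex of degree
  -- three; what remains is the other side. Indices beyond `n` are reduced by the period.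
  have chordA : ∀ i, 0 < i → i < q → ∃ t, q < t ∧ t < n ∧ G.Adj (c i) (c t) := by
    intro i hi hiq
    obtain ⟨t, h1, h2, h3⟩ := chord i (by omega) (by omega) (by omega)
    rcases lt_trichotomy t q with ht | ht | ht
    · exact absurd h3 (same i t (by omega) (by omega))
    · exact absurd (ht ▸ h3).symm (noq' i (by omega) (by omega))
    rcases lt_trichotomy t n with htn | htn | htn
    · exact ⟨t, ht, htn, h3⟩
    · rw [h.eq_add_period (s := t) (t := 0) (by omega)] at h3
      exact absurd h3.symm (no0 i (by omega) (by omega))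
    · rw [h.eq_add_period (s := t) (t := t - n) (by omega)] at h3
      exact absurd h3.symm (same (t - n) i (by omega) (by omega))
  have chordB : ∀ r, q < r → r < n → ∃ t, 0 < t ∧ t < q ∧ G.Adj (c t) (c r) := by
    intro r hr hrn
    obtain ⟨t, h1, h2, h3⟩ := chord r (by omega) (by omega) (by omega)
    rcases lt_trichotomy t n with ht | ht | ht
    · exact absurd h3 (same r t (by omega) (by omega))
    · rw [h.eq_add_period (s := t) (t := 0) (by omega)] at h3
      exact absurd h3.symm (no0 r (by omega) (by omega))
    rw [h.eq_add_period (s := t) (t := t - n) (by omega)] at h3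
    rcases lt_trichotomy (t - n) q with htn | htn | htn
    · exact ⟨t - n, by omega, htn, h3.symm⟩
    · rw [htn] at h3
      exact absurd h3.symm (noq r (by omega) (by omega))
    · exact absurd h3.symm (same (t - n) r (by omega) (by omega))
  have hq2 : 2 ≤ q := by
    by_contra hcon
    obtain rfl : q = 1 := by omega
    obtain ⟨t, h1, h2, -⟩ := chordB 2 (by omega) (by omega)
    omega
  have hqn2 : q + 2 ≤ n := by
    by_contra hcon
    obtain ⟨t, h1, h2, -⟩ := chordA 1 (by omega) (by omega)
    omega
  obtain ⟨k, rfl⟩ : ∃ k, q = k + 2 := ⟨q - 2, by omega⟩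
  obtain ⟨l, rfl⟩ : ∃ l, n = k + l + 4 := ⟨n - k - 4, by omega⟩
  have adjA : ∀ i j, i < j → 0 < i → j < k + 2 → (G.Adj (c i) (c j) ↔ j = i + 1) := by
    intro i j hij hi hj
    constructor
    · intro ha
      by_contra hne
      exact same i j (by omega) (by omega) ha
    · rintro rfl; exact h.adj i
  have adjB : ∀ i j, i < j → k + 2 < i → j < k + l + 4 → (G.Adj (c i) (c j) ↔ j = i + 1) := by
    intro i j hij hi hj
    constructor
    · intro ha
      by_contra hne
      exact same i j (by omega) (by omega) ha
    · rintro rfl; exact h.adj i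
  have adj0 : ∀ i, 0 < i → i < k + l + 4 → (G.Adj (c 0) (c i) ↔ i = 1 ∨ i = k + l + 3) := by
    intro i hi hin
    constructor
    · intro ha
      by_contra hne
      exact no0 i (by omega) (by omega) ha
    · rintro (rfl | rfl)
      · exact h.adj 0
      · have := h.adj (k + l + 3)
        rw [h.eq_add_period (s := k + l + 3 + 1) (t := 0) (by omega)] at this
        exact this.symm
  have adjq : ∀ i, i ≠ k + 2 → i < k + l + 4 →
      (G.Adj (c (k + 2)) (c i) ↔ i = k + 1 ∨ i = k + 3) := by
    intro i hi hin
    constructor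
    · intro ha
      by_contra hne
      rcases lt_or_gt_of_ne hi with hlt | hlt
      · exact noq' i (by omega) (by omega) ha
      · exact noq i (by omega) (by omega) ha
    · rintro (rfl | rfl)
      · exact (h.adj (k + 1)).symm
      · exact h.adj (k + 2)
  -- The first side occupies the positions 1, ..., k + 1, and the second is read backwards from k +
  -- l + 3 to k + 3. Both then run from the end 0 to the end k + 2, and not crossing becomes
  -- monotonicity of `E`.
  let E : ℕ → ℕ → Prop := fun i j => G.Adj (c (1 + i)) (c (k + l + 3 - j))
  refine ⟨k, l, E, ?_, ?_, ?_, ?_⟩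
  · let φ : StripVertex k l → V
      | .inl _ => z
      | .inr (.inl false) => c 0
      | .inr (.inl true) => c (k + 2)
      | .inr (.inr (.inl i)) => c (1 + i.val)
      | .inr (.inr (.inr j)) => c (k + l + 3 - j.val)
    have hinj : Function.Injective φ := by
      have key : ∀ s t, s < k + l + 4 → t < k + l + 4 → c s = c t → s = t := by
        intro s t hs ht e
        rcases le_total s t with hst | hst
        · exact h.inj e hst (by omega)
        · exact (h.inj e.symm hst (by omega)).symm
      rintro (_ | (_ | _) | i | j) (_ | (_ | _) | i' | j') e
      all_goals simp only [φ] at e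
      all_goals first
        | rfl
        | exact absurd e (h.ne_apex _)
        | exact absurd e.symm (h.ne_apex _)
        | skip
      all_goals have := key _ _ (by omega) (by omega) e
      all_goals first
        | (exfalso; omega)
        | skip
      · have : i = i' := Fin.ext (by omega)
        rw [this]
      · have : j = j' := Fin.ext (by omega)
        rw [this]
    have hsurj : Function.Surjective φ := by
      intro v
      by_cases hv : v = z
      · exact ⟨.inl (), hv.symm⟩
      obtain ⟨t, ht, rfl⟩ := h.surj v hv
      rcases Nat.eq_zero_or_pos t with rfl | ht0
      · exact ⟨.inr (.inl false), rfl⟩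
      rcases lt_trichotomy t (k + 2) with hlt | rfl | hlt
      · exact ⟨.inr (.inr (.inl ⟨t - 1, by omega⟩)), by simp only [φ]; congr 1; omega⟩
      · exact ⟨.inr (.inl true), rfl⟩
      · exact ⟨.inr (.inr (.inr ⟨k + l + 3 - t, by omega⟩)), by simp only [φ]; congr 1; omega⟩
    have hrel : ∀ x y, x ≠ y → (stripRel k l E x y ∨ stripRel k l E y x ↔ G.Adj (φ x) (φ y)) := by
      rintro (_ | (_ | _) | i | j) (_ | (_ | _) | i' | j') hne
      all_goals simp only [stripRel, φ, or_false, false_or, or_true, true_iff]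
      all_goals first
        | exact absurd rfl hne
        | exact h.apex _ (h.ne_apex _)
        | exact (h.apex _ (h.ne_apex _)).symm
        | skip
      · rw [adj0 _ (by omega) (by omega), false_iff]; omega
      · rw [adj0 _ (by omega) (by omega)]; omega
      · rw [adj0 _ (by omega) (by omega)]; omega
      · rw [adjq _ (by omega) (by omega), false_iff]; omega
      · rw [adjq _ (by omega) (by omega)]; omega
      · rw [adjq _ (by omega) (by omega)]; omega
      · rw [G.adj_comm, adj0 _ (by omega) (by omega)]; omega
      · rw [G.adj_comm, adjq _ (by omega) (by omega)]; omega
      · have hne' : i.val ≠ i'.val := fun e => hne (by rw [Fin.ext e])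
        rcases lt_or_gt_of_ne hne' with hlt | hlt
        · rw [adjA _ _ (by omega) (by omega) (by omega)]; omega
        · rw [G.adj_comm, adjA _ _ (by omega) (by omega) (by omega)]; omega
      · exact Iff.rfl
      · rw [G.adj_comm, adj0 _ (by omega) (by omega)]; omega
      · rw [G.adj_comm, adjq _ (by omega) (by omega)]; omega
      · exact G.adj_comm _ _
      · have hne' : j.val ≠ j'.val := fun e => hne (by rw [Fin.ext e])
        rcases lt_or_gt_of_ne hne' with hlt | hlt
        · rw [G.adj_comm, adjB _ _ (by omega) (by omega) (by omega)]; omega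
        · rw [adjB _ _ (by omega) (by omega) (by omega)]; omega
    refine ⟨⟨Equiv.ofBijective φ ⟨hinj, hsurj⟩, ?_⟩⟩
    intro x y
    change G.Adj (φ x) (φ y) ↔ (stripGraph k l E).Adj x y
    rw [stripGraph, SimpleGraph.fromRel_adj]
    constructor
    · intro ha
      have hne : x ≠ y := by rintro rfl; exact G.loopless.irrefl _ ha
      exact ⟨hne, (hrel x y hne).2 ha⟩
    · rintro ⟨hne, hr⟩
      exact (hrel x y hne).1 hr
  · intro i j i' j' hi hi' hj hj' h1 h2 hlt
    by_contra hcon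
    exact h.not_crossing hG (i := 1 + i) (j := 1 + i') (k := k + l + 3 - j) (l := k + l + 3 - j')
      (by omega) (by omega) (by omega) (by omega) h1 h2
  · intro i hi
    obtain ⟨t, h1, h2, h3⟩ := chordA (1 + i) (by omega) (by omega)
    refine ⟨k + l + 3 - t, by omega, ?_⟩
    simp only [E]
    rwa [show k + l + 3 - (k + l + 3 - t) = t by omega]
  · intro j hj
    obtain ⟨t, h1, h2, h3⟩ := chordB (k + l + 3 - j) (by omega) (by omega)
    refine ⟨t - 1, by omega, ?_⟩
    simp only [E]
    rwa [show 1 + (t - 1) = t by omega]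

end SimpleGraph.IsRim

/-! ### Words describing strips -/

/-- A step between consecutive chords of a strip: advance on the first side, on the second side,
or on both. -/
inductive StripStep
  | fst
  | snd
  | both

namespace StripStep

/-- The advance on the first side. -/
def dx : StripStep → ℕ
  | fst => 1
  | snd => 0
  | both => 1

/-- The advance on the second side. -/
def dy : StripStep → ℕ
  | fst => 0
  | snd => 1
  | both => 1

/-- Exchange of the two sides. -/
def swap : StripStep → StripStep
  | fst => snd
  | snd => fst
  | both => both

theorem dx_swap (s : StripStep) : s.swap.dx = s.dy := by cases s <;> rfl

theorem dy_swap (s : StripStep) : s.swap.dy = s.dx := by cases s <;> rfl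

/-- The total advance of a word on the first side. -/
def width (w : List StripStep) : ℕ := (w.map dx).sum

/-- The total advance of a word on the second side. -/
def height (w : List StripStep) : ℕ := (w.map dy).sum

/-- The chords of the strip described by a word. -/
def IsChord (w : List StripStep) (i j : ℕ) : Prop :=
  ∃ v, v <+: w ∧ width v = i ∧ height v = j

@[simp] theorem width_nil : width [] = 0 := rfl

@[simp] theorem height_nil : height [] = 0 := rfl

@[simp] theorem width_cons (s : StripStep) (w : List StripStep) :
    width (s :: w) = s.dx + width w := by simp [width]

@[simp] theorem height_cons (s : StripStep) (w : List StripStep) :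
    height (s :: w) = s.dy + height w := by simp [height]

@[simp] theorem width_append (v w : List StripStep) : width (v ++ w) = width v + width w := by
  simp [width]

@[simp] theorem height_append (v w : List StripStep) : height (v ++ w) = height v + height w := by
  simp [height]

@[simp] theorem width_reverse (w : List StripStep) : width w.reverse = width w := by
  simp [width, List.map_reverse, List.sum_reverse]

@[simp] theorem height_reverse (w : List StripStep) : height w.reverse = height w := by
  simp [height, List.map_reverse, List.sum_reverse]

@[simp] theorem width_map_swap (w : List StripStep) : width (w.map swap) = height w := by
  simp [width, height, Function.comp_def, dx_swap]

@[simp] theorem height_map_swap (w : List StripStep) : height (w.map swap) = width w := by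
  simp [width, height, Function.comp_def, dy_swap]

theorem isChord_nil {i j : ℕ} : IsChord [] i j ↔ i = 0 ∧ j = 0 := by
  simp [IsChord, List.prefix_nil, eq_comm]

theorem isChord_cons {s : StripStep} {w : List StripStep} {i j : ℕ} :
    IsChord (s :: w) i j ↔
      (i = 0 ∧ j = 0) ∨ ∃ i' j', IsChord w i' j' ∧ i = s.dx + i' ∧ j = s.dy + j' := by
  constructor
  · rintro ⟨v, hv, rfl, rfl⟩
    rcases List.prefix_cons_iff.1 hv with rfl | ⟨t, rfl, ht⟩
    · simp
    · exact Or.inr ⟨_, _, ⟨t, ht, rfl, rfl⟩, by simp, by simp⟩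
  · rintro (⟨rfl, rfl⟩ | ⟨_, _, ⟨t, ht, rfl, rfl⟩, rfl, rfl⟩)
    · exact ⟨[], List.nil_prefix, rfl, rfl⟩
    · exact ⟨s :: t, by simpa using ht, by simp, by simp⟩

theorem IsChord.le {w : List StripStep} {i j : ℕ} (h : IsChord w i j) :
    i ≤ width w ∧ j ≤ height w := by
  obtain ⟨v, ⟨u, rfl⟩, rfl, rfl⟩ := h
  simp

theorem isChord_map_swap {w : List StripStep} {i j : ℕ} :
    IsChord (w.map swap) i j ↔ IsChord w j i := by
  induction w generalizing i j with
  | nil => simp [isChord_nil, and_comm]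
  | cons s w ih =>
    rw [List.map_cons, isChord_cons, isChord_cons, dx_swap, dy_swap]
    constructor
    · rintro (h | ⟨a, b, h, rfl, rfl⟩)
      · exact Or.inl h.symm
      · exact Or.inr ⟨b, a, ih.1 h, rfl, rfl⟩
    · rintro (h | ⟨a, b, h, rfl, rfl⟩)
      · exact Or.inl h.symm
      · exact Or.inr ⟨b, a, ih.2 h, rfl, rfl⟩

theorem IsChord.reverse {w : List StripStep} {i j : ℕ} (h : IsChord w i j) :
    IsChord w.reverse (width w - i) (height w - j) := by
  obtain ⟨v, ⟨u, rfl⟩, rfl, rfl⟩ := h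
  exact ⟨u.reverse, by simp, by simp, by simp⟩

/-- A monotone relation that covers both sides is the chord relation of a word. -/
theorem exists_word (m : ℕ) : ∀ (k l : ℕ) (E : ℕ → ℕ → Prop), k + l = m →
    (∀ i j i' j', i ≤ k → i' ≤ k → j ≤ l → j' ≤ l → E i j → E i' j' → i < i' → j ≤ j') →
    (∀ i ≤ k, ∃ j ≤ l, E i j) → (∀ j ≤ l, ∃ i ≤ k, E i j) →
    ∃ w, width w = k ∧ height w = l ∧ ∀ i j, i ≤ k → j ≤ l → (E i j ↔ IsChord w i j) := by
  induction m using Nat.strong_induction_on with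
  | _ m ih =>
    intro k l E hm mono rows cols
    -- Both first vertices have a chord, say `(0, j)` and `(i, 0)`; if `i > 0`, monotonicity forces
    -- `j = 0`.
    have h00 : E 0 0 := by
      obtain ⟨j, hj, h1⟩ := rows 0 (by omega)
      obtain ⟨i, hi, h2⟩ := cols 0 (by omega)
      rcases Nat.eq_zero_or_pos i with rfl | hpos
      · exact h2
      · have := mono 0 j i 0 (by omega) hi hj (by omega) h1 h2 hpos
        obtain rfl : j = 0 := by omega
        exact h1
    -- The chord after `(0, 0)` decides the first letter: `(1, 0)` gives `fst`, `(0, 1)` gives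
    -- `snd`. The first vertex of that side then has no further chord and is removed.
    by_cases hA : 0 < k ∧ E 1 0
    · obtain ⟨k, rfl⟩ : ∃ k', k = k' + 1 := ⟨k - 1, by omega⟩
      have low : ∀ j ≤ l, E 0 j → j = 0 := fun j hj h => by
        have := mono 0 j 1 0 (by omega) (by omega) hj (by omega) h hA.2 (by omega)
        omega
      obtain ⟨w, hw, hh, hE⟩ := ih (k + l) (by omega) k l (fun i j => E (i + 1) j) rfl
        (fun i j i' j' a b c d e f g => mono _ _ _ _ (by omega) (by omega) c d e f (by omega))
        (fun i hi => rows (i + 1) (by omega))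
        (fun j hj => by
          obtain ⟨i, hi, h⟩ := cols j hj
          rcases Nat.eq_zero_or_pos i with rfl | hpos
          · obtain rfl := low j hj h
            exact ⟨0, by omega, hA.2⟩
          · exact ⟨i - 1, by omega, by rwa [Nat.sub_add_cancel hpos]⟩)
      refine ⟨fst :: w, by simp [hw, dx]; omega, by simp [hh, dy], fun i j hi hj => ?_⟩
      rw [isChord_cons]
      constructor
      · intro h
        rcases Nat.eq_zero_or_pos i with rfl | hpos
        · exact Or.inl ⟨rfl, low j hj h⟩
        · refine Or.inr ⟨i - 1, j, (hE (i - 1) j (by omega) hj).1 ?_, by simp [dx]; omega,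
            by simp [dy]⟩
          rwa [Nat.sub_add_cancel hpos]
      · rintro (⟨rfl, rfl⟩ | ⟨i', j', h, rfl, rfl⟩)
        · exact h00
        · have := (hE i' j' (by simp [dx] at hi; omega) (by simpa [dy] using hj)).2 h
          simpa [dx, dy, add_comm] using this
    by_cases hB : 0 < l ∧ E 0 1
    · obtain ⟨l, rfl⟩ : ∃ l', l = l' + 1 := ⟨l - 1, by omega⟩
      have low : ∀ i ≤ k, E i 0 → i = 0 := fun i hi h => by
        by_contra hne
        have := mono 0 1 i 0 (by omega) hi (by omega) (by omega) hB.2 h (by omega)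
        omega
      obtain ⟨w, hw, hh, hE⟩ := ih (k + l) (by omega) k l (fun i j => E i (j + 1)) rfl
        (fun i j i' j' a b c d e f g => by
          have := mono _ _ _ _ a b (by omega) (by omega) e f g; omega)
        (fun i hi => by
          obtain ⟨j, hj, h⟩ := rows i hi
          rcases Nat.eq_zero_or_pos j with rfl | hpos
          · obtain rfl := low i hi h
            exact ⟨0, by omega, hB.2⟩
          · exact ⟨j - 1, by omega, by rwa [Nat.sub_add_cancel hpos]⟩)
        (fun j hj => cols (j + 1) (by omega))
      refine ⟨snd :: w, by simp [hw, dx], by simp [hh, dy]; omega, fun i j hi hj => ?_⟩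
      rw [isChord_cons]
      constructor
      · intro h
        rcases Nat.eq_zero_or_pos j with rfl | hpos
        · exact Or.inl ⟨low i hi h, rfl⟩
        · refine Or.inr ⟨i, j - 1, (hE i (j - 1) hi (by omega)).1 ?_, by simp [dx],
            by simp [dy]; omega⟩
          rwa [Nat.sub_add_cancel hpos]
      · rintro (⟨rfl, rfl⟩ | ⟨i', j', h, rfl, rfl⟩)
        · exact h00
        · have := (hE i' j' (by simpa [dx] using hi) (by simp [dy] at hj; omega)).2 h
          simpa [dx, dy, add_comm] using this
    -- Without `(1, 0)` and `(0, 1)`, the first vertices have no chord but `(0, 0)`. Either both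
    -- sides end here or both first vertices are removed with the letter `both`.
    have lowA : ∀ j ≤ l, E 0 j → j = 0 := by
      intro j hj h
      by_contra hne
      obtain ⟨i, hi, h'⟩ := cols 1 (by omega)
      rcases Nat.eq_zero_or_pos i with rfl | hpos
      · exact hB ⟨by omega, h'⟩
      · have := mono 0 j i 1 (by omega) hi hj (by omega) h h' hpos
        obtain rfl : j = 1 := by omega
        exact hB ⟨by omega, h⟩
    have lowB : ∀ i ≤ k, E i 0 → i = 0 := by
      intro i hi h
      by_contra hne
      obtain ⟨j, hj, h'⟩ := rows 1 (by omega)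
      have : i ≠ 1 := by rintro rfl; exact hA ⟨by omega, h⟩
      have := mono 1 j i 0 (by omega) hi hj (by omega) h' h (by omega)
      obtain rfl : j = 0 := by omega
      exact hA ⟨by omega, h'⟩
    rcases Nat.eq_zero_or_pos k with rfl | hk
    · have hl : l = 0 := by
        by_contra hne
        obtain ⟨i, hi, h⟩ := cols 1 (by omega)
        obtain rfl : i = 0 := by omega
        exact hB ⟨by omega, h⟩
      subst hl
      refine ⟨[], rfl, rfl, fun i j hi hj => ?_⟩
      obtain rfl : i = 0 := by omega
      obtain rfl : j = 0 := by omega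
      simp [isChord_nil, h00]
    · have hl : 0 < l := by
        by_contra hne
        obtain ⟨j, hj, h⟩ := rows 1 (by omega)
        obtain rfl : j = 0 := by omega
        exact hA ⟨by omega, h⟩
      obtain ⟨k, rfl⟩ : ∃ k', k = k' + 1 := ⟨k - 1, by omega⟩
      obtain ⟨l, rfl⟩ : ∃ l', l = l' + 1 := ⟨l - 1, by omega⟩
      obtain ⟨w, hw, hh, hE⟩ := ih (k + l) (by omega) k l (fun i j => E (i + 1) (j + 1)) rfl
        (fun i j i' j' a b c d e f g => by
          have := mono (i + 1) (j + 1) (i' + 1) (j' + 1) (by omega) (by omega) (by omega)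
            (by omega) e f (by omega)
          omega)
        (fun i hi => by
          obtain ⟨j, hj, h⟩ := rows (i + 1) (by omega)
          rcases Nat.eq_zero_or_pos j with rfl | hpos
          · have := lowB _ (by omega) h; omega
          · exact ⟨j - 1, by omega, by rwa [Nat.sub_add_cancel hpos]⟩)
        (fun j hj => by
          obtain ⟨i, hi, h⟩ := cols (j + 1) (by omega)
          rcases Nat.eq_zero_or_pos i with rfl | hpos
          · have := lowA _ (by omega) h; omega
          · exact ⟨i - 1, by omega, by rwa [Nat.sub_add_cancel hpos]⟩)
      refine ⟨both :: w, by simp [hw, dx]; omega, by simp [hh, dy]; omega, fun i j hi hj => ?_⟩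
      rw [isChord_cons]
      constructor
      · intro h
        rcases Nat.eq_zero_or_pos i with rfl | hi0
        · exact Or.inl ⟨rfl, lowA j hj h⟩
        rcases Nat.eq_zero_or_pos j with rfl | hj0
        · exact Or.inl ⟨lowB i hi h, rfl⟩
        · refine Or.inr ⟨i - 1, j - 1, (hE (i - 1) (j - 1) (by omega) (by omega)).1 ?_,
            by simp [dx]; omega, by simp [dy]; omega⟩
          rwa [Nat.sub_add_cancel hi0, Nat.sub_add_cancel hj0]
      · rintro (⟨rfl, rfl⟩ | ⟨i', j', h, rfl, rfl⟩)
        · exact h00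
        · have := (hE i' j' (by simp [dx] at hi; omega) (by simp [dy] at hj; omega)).2 h
          simpa [dx, dy, add_comm] using this

end StripStep

/-! ### Isomorphisms of strips: exchange of the sides and reversal -/

theorem stripGraph_congr {k l : ℕ} {E E' : ℕ → ℕ → Prop}
    (h : ∀ i j, i ≤ k → j ≤ l → (E i j ↔ E' i j)) : stripGraph k l E = stripGraph k l E' := by
  have : stripRel k l E = stripRel k l E' := by
    funext x y
    rcases x with (_ | (_ | _) | i | j) <;> rcases y with (_ | (_ | _) | i' | j')
    all_goals first
      | rfl
      | exact propext (h _ _ (by omega) (by omega))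
  rw [stripGraph, this, stripGraph]

/-- Isomorphism of strips from a bijection of the vertices that respects the relation. -/
def stripGraphIso {k l k' l' : ℕ} {E E' : ℕ → ℕ → Prop} (φ : StripVertex k l ≃ StripVertex k' l')
    (h : ∀ x y, stripRel k' l' E' (φ x) (φ y) ∨ stripRel k' l' E' (φ y) (φ x) ↔
      stripRel k l E x y ∨ stripRel k l E y x) : stripGraph k l E ≃g stripGraph k' l' E' where
  toEquiv := φ
  map_rel_iff' {x y} := by
    rw [stripGraph, stripGraph, SimpleGraph.fromRel_adj, SimpleGraph.fromRel_adj, h, ne_eq, ne_eq,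
      φ.apply_eq_iff_eq]

theorem stripGraph_swap {k l : ℕ} {E E' : ℕ → ℕ → Prop}
    (h : ∀ i j, i ≤ k → j ≤ l → (E' j i ↔ E i j)) :
    Nonempty (stripGraph k l E ≃g stripGraph l k E') := by
  let φ : StripVertex k l ≃ StripVertex l k :=
    Equiv.sumCongr (Equiv.refl _) (Equiv.sumCongr (Equiv.refl _) (Equiv.sumComm _ _))
  refine ⟨stripGraphIso φ ?_⟩
  rintro (_ | (_ | _) | i | j) (_ | (_ | _) | i' | j')
  all_goals simp only [φ, Equiv.sumCongr_apply, Sum.map_inl, Sum.map_inr, Equiv.refl_apply,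
    Equiv.sumComm_apply, Sum.swap_inl, Sum.swap_inr, stripRel, or_false, false_or]
  · exact h _ _ (by omega) (by omega)
  · exact h _ _ (by omega) (by omega)

theorem stripGraph_reverse {k l : ℕ} {E E' : ℕ → ℕ → Prop}
    (h : ∀ i j, i ≤ k → j ≤ l → (E' (k - i) (l - j) ↔ E i j)) :
    Nonempty (stripGraph k l E ≃g stripGraph k l E') := by
  let φ : StripVertex k l ≃ StripVertex k l :=
    Equiv.sumCongr (Equiv.refl _) (Equiv.sumCongr Equiv.boolNot
      (Equiv.sumCongr Fin.revPerm Fin.revPerm))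
  refine ⟨stripGraphIso φ ?_⟩
  have e1 : ∀ i : Fin (k + 1), (Fin.rev i).val = k - i.val := fun i => by
    rw [Fin.val_rev]; omega
  have e2 : ∀ i : Fin (l + 1), (Fin.rev i).val = l - i.val := fun i => by
    rw [Fin.val_rev]; omega
  rintro (_ | (_ | _) | i | j) (_ | (_ | _) | i' | j')
  all_goals simp only [φ, Equiv.sumCongr_apply, Sum.map_inl, Sum.map_inr, Equiv.refl_apply,
    Equiv.boolNot_apply, Bool.not_true, Bool.not_false, Fin.revPerm_apply, e1, e2, stripRel,
    or_false, false_or]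
  all_goals first
    | exact h _ _ (by omega) (by omega)
    | omega

/-- The polytope described by a word. -/
def wordGraph (w : List StripStep) :
    SimpleGraph (StripVertex (StripStep.width w) (StripStep.height w)) :=
  stripGraph _ _ (StripStep.IsChord w)

open StripStep in
theorem wordGraph_map_swap (w : List StripStep) :
    Nonempty (wordGraph w ≃g wordGraph (w.map swap)) := by
  -- The vertex type depends on the width and the height, which agree only propositionally; hence
  -- the detour through variables.
  have : ∀ k l, k = width (w.map swap) → l = height (w.map swap) →
      Nonempty (stripGraph l k (IsChord w) ≃g wordGraph (w.map swap)) := by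
    rintro _ _ rfl rfl
    exact stripGraph_swap fun i j _ _ => isChord_map_swap
  exact this _ _ (width_map_swap w).symm (height_map_swap w).symm

open StripStep in
theorem wordGraph_reverse (w : List StripStep) :
    Nonempty (wordGraph w ≃g wordGraph w.reverse) := by
  have : ∀ k l, k = width w.reverse → l = height w.reverse →
      Nonempty (stripGraph k l (IsChord w) ≃g wordGraph w.reverse) := by
    rintro _ _ rfl rfl
    refine stripGraph_reverse fun i j hi hj => ?_
    rw [width_reverse, height_reverse] at *
    constructor
    · intro h
      have := h.reverse
      rw [width_reverse, height_reverse, List.reverse_reverse] at this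
      rwa [Nat.sub_sub_self hi, Nat.sub_sub_self hj] at this
    · exact IsChord.reverse
  exact this _ _ (width_reverse w).symm (height_reverse w).symm

/-! ### Every realisation comes from a word -/

theorem degreeSequence_eq {V : Type*} [Fintype V] (G : SimpleGraph V) :
    degreeSequence G = Finset.univ.val.map fun v => (G.neighborSet v).ncard := by
  classical
  unfold degreeSequence
  congr 1
  funext v
  rw [← SimpleGraph.card_neighborSet_eq_degree, Set.ncard_eq_toFinset_card', Set.toFinset_card]

/-- A vertex of eccentricity 1 serves as apex. The rim is shifted to start at one of the two
vertices of degree three, and the chord relation of the resulting strip is spelled as a word. -/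
theorem IsRadiusOneRealisation.exists_word {V : Type*} [Fintype V] {G : SimpleGraph V}
    {s : Multiset ℕ} (h : IsRadiusOneRealisation G s) (hs : s.count 3 = 2) :
    ∃ w, Nonempty (wordGraph w ≃g G) := by
  classical
  obtain ⟨hG, hr, rfl⟩ := h
  have hcard := hG.2.1
  have : Nonempty V := Fintype.card_pos_iff.1 (by omega)
  obtain ⟨z, hz⟩ := G.exists_eccent_eq_radius
  rw [hr] at hz
  have hz := (G.eccent_le_one_iff z).1 hz.le
  obtain ⟨c, hc⟩ := hG.exists_isRim (z := z) fun v hv => hz v hv.symm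
  rw [degreeSequence_eq, Multiset.count_map, ← Finset.filter_val, Finset.card_val,
    Finset.card_eq_two] at hs
  obtain ⟨x, y, hxy, hs⟩ := hs
  have hmem : ∀ v, (G.neighborSet v).ncard = 3 ↔ v = x ∨ v = y := by
    intro v
    have := Finset.ext_iff.1 hs v
    simpa [eq_comm] using this
  -- A rim of length three has no chords, so three vertices would have degree 3. It follows that the
  -- apex does not have degree 3 and that `x` and `y` lie on the rim.
  have hn : Fintype.card V - 1 ≠ 3 := by
    intro hn
    rw [hn] at hc
    have h3 : ∀ i, c i = x ∨ c i = y := fun i =>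
      (hmem _).1 (hc.neighborSet_ncard_eq_three fun t h1 h2 => by omega)
    have e : ∀ i j, i < 3 → j < 3 → c i = c j → i = j := fun i j hi hj h => by
      have := (hc.eq_iff i j).1 h
      omega
    rcases h3 0 with a | a <;> rcases h3 1 with b | b <;> rcases h3 2 with d | d
    all_goals first
      | exact absurd (e 0 1 (by omega) (by omega) (a.trans b.symm)) (by omega)
      | exact absurd (e 0 2 (by omega) (by omega) (a.trans d.symm)) (by omega)
      | exact absurd (e 1 2 (by omega) (by omega) (b.trans d.symm)) (by omega)
  have hdz : (G.neighborSet z).ncard ≠ 3 := by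
    have : G.neighborSet z = ((Finset.univ.erase z : Finset V) : Set V) := by
      ext v
      simp only [SimpleGraph.mem_neighborSet, Finset.coe_erase, Finset.coe_univ, Set.mem_sdiff,
        Set.mem_univ, Set.mem_singleton_iff, true_and]
      exact ⟨fun h e => h.ne e.symm, fun h => hz v fun e => h e.symm⟩
    rw [this, Set.ncard_coe_finset, Finset.card_erase_of_mem (Finset.mem_univ _), Finset.card_univ]
    exact hn
  have hxz : x ≠ z := by rintro rfl; exact hdz ((hmem _).2 (Or.inl rfl))
  have hyz : y ≠ z := by rintro rfl; exact hdz ((hmem _).2 (Or.inr rfl))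
  obtain ⟨a, ha, rfl⟩ := hc.surj x hxz
  have hc' := hc.shift a
  obtain ⟨q, hq, hqy⟩ := hc'.surj y hyz
  have hq0 : 0 < q := by
    rcases Nat.eq_zero_or_pos q with rfl | h
    · exact absurd (by simpa using hqy) hxy
    · exact h
  obtain ⟨k, l, E, ⟨φ⟩, mono, rows, cols⟩ := hc'.exists_stripGraph_iso hG.1 hq0 hq
    ((hmem _).2 (Or.inl (by simp))) ((hmem _).2 (Or.inr hqy)) (by
      intro t ht h3
      rcases (hmem _).1 h3 with e | e
      · left
        exact (hc'.inj (s := 0) (t := t) (by simpa using e.symm) (by omega) (by omega)).symm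
      · right
        rw [← hqy] at e
        rcases le_total t q with h | h
        · exact hc'.inj e h (by omega)
        · exact (hc'.inj e.symm h (by omega)).symm)
  obtain ⟨w, rfl, rfl, hE⟩ := StripStep.exists_word _ k l E rfl mono rows cols
  refine ⟨w, ?_⟩
  rw [wordGraph, ← stripGraph_congr hE]
  exact ⟨φ⟩

/-! ### Straight-line drawings with an apex -/

/-- Chords of the parabola lie on or above it, and the product formula for the height makes it
possible to compare two chords. -/
theorem mem_segment_parabola {a b : ℝ} (hab : a < b) {p : ℝ × ℝ}
    (hp : p ∈ segment ℝ ((a, a ^ 2) : ℝ × ℝ) (b, b ^ 2)) :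
    a ≤ p.1 ∧ p.1 ≤ b ∧ p.2 - p.1 ^ 2 = (p.1 - a) * (b - p.1) := by
  obtain ⟨s, t, hs, ht, hst, rfl⟩ := hp
  obtain rfl : s = 1 - t := by linarith
  simp only [Prod.smul_mk, Prod.mk_add_mk, smul_eq_mul]
  refine ⟨by nlinarith, by nlinarith, by ring⟩

/-- At parameter `t` the spoke lies (1 - t)(M - t c²) below the parabola. The second conclusion is
the equation of its line. -/
theorem mem_segment_apex {M c : ℝ} (hc : c ^ 2 < M) {p : ℝ × ℝ}
    (hp : p ∈ segment ℝ ((0, -M) : ℝ × ℝ) (c, c ^ 2)) :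
    (p = (c, c ^ 2) ∨ p.2 < p.1 ^ 2) ∧ p.1 * (c ^ 2 + M) = c * (p.2 + M) := by
  obtain ⟨s, t, hs, ht, hst, rfl⟩ := hp
  obtain rfl : s = 1 - t := by linarith
  simp only [Prod.smul_mk, Prod.mk_add_mk, smul_eq_mul]
  refine ⟨?_, by ring⟩
  rcases hs.eq_or_lt with h | h
  · left
    obtain rfl : t = 1 := by linarith
    simp
  · right
    have h1 : t * c ^ 2 < M := by nlinarith [sq_nonneg c]
    nlinarith [mul_pos h (sub_pos.2 h1)]

/-- If the vertices other than `z` can be placed on a line so that the edges between them, drawn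
as arcs on one side, do not cross, then the graph is planar. -/
theorem isPlanar_of_not_crossing {V : Type*} [Finite V] {G : SimpleGraph V} (z : V) (f : V → ℕ)
    (hf : ∀ u v, u ≠ z → v ≠ z → f u = f v → u = v)
    (hc : ∀ a b c d, a ≠ z → b ≠ z → c ≠ z → d ≠ z → G.Adj a b → G.Adj c d →
      f a < f c → f c < f b → f b < f d → False) : IsPlanar G := by
  classical
  obtain ⟨N, hN⟩ := (Set.finite_range f).bddAbove
  have hN : ∀ v, f v ≤ N := fun v => hN ⟨v, rfl⟩
  -- `M` exceeds all squares `(f v) ^ 2`. Thus the spokes stay below the parabola, and `f v * f v' <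
  -- M` will keep two spokes apart away from the apex.
  let M : ℝ := (N : ℝ) ^ 2 + 1
  have hM0 : 0 < M := by positivity
  have hM : ∀ v, (f v : ℝ) ^ 2 < M := fun v => by
    have : (f v : ℝ) ≤ N := by exact_mod_cast hN v
    have h0 : (0 : ℝ) ≤ f v := by positivity
    simp only [M]; nlinarith
  let pos : V → ℝ × ℝ := fun v => if v = z then (0, -M) else ((f v : ℝ), (f v : ℝ) ^ 2)
  have posz : pos z = (0, -M) := by simp [pos]
  have posv : ∀ v, v ≠ z → pos v = ((f v : ℝ), (f v : ℝ) ^ 2) := fun v hv => by simp [pos, hv]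
  have pos_inj : Function.Injective pos := by
    intro u v h
    by_cases hu : u = z <;> by_cases hv : v = z
    · rw [hu, hv]
    · subst hu
      rw [posz, posv v hv, Prod.mk.injEq] at h
      nlinarith [sq_nonneg (f v : ℝ), h.2]
    · subst hv
      rw [posz, posv u hu, Prod.mk.injEq] at h
      nlinarith [sq_nonneg (f u : ℝ), h.2]
    · rw [posv u hu, posv v hv, Prod.mk.injEq] at h
      exact hf u v hu hv (by exact_mod_cast h.1)
  let arc : Sym2 V → Set (ℝ × ℝ) := Sym2.lift ⟨fun u v => segment ℝ (pos u) (pos v),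
    fun u v => segment_symm ℝ _ _⟩
  have arc_mk : ∀ u v, arc s(u, v) = segment ℝ (pos u) (pos v) := fun u v => rfl
  have cases_edge : ∀ e ∈ G.edgeSet, (∃ v, v ≠ z ∧ e = s(z, v)) ∨
      ∃ a b, a ≠ z ∧ b ≠ z ∧ f a < f b ∧ G.Adj a b ∧ e = s(a, b) := by
    intro e he
    induction e with | _ a b =>
    have hab : G.Adj a b := he
    by_cases ha : a = z
    · exact Or.inl ⟨b, fun h => hab.ne (ha.trans h.symm), by rw [ha]⟩
    by_cases hb : b = z
    · exact Or.inl ⟨a, ha, by rw [hb, Sym2.eq_swap]⟩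
    rcases lt_trichotomy (f a) (f b) with h | h | h
    · exact Or.inr ⟨a, b, ha, hb, h, hab, rfl⟩
    · exact absurd (hf a b ha hb h) hab.ne
    · exact Or.inr ⟨b, a, hb, ha, h, hab.symm, Sym2.eq_swap⟩
  have chord : ∀ a b, a ≠ z → b ≠ z → f a < f b → ∀ p ∈ arc s(a, b),
      (f a : ℝ) ≤ p.1 ∧ p.1 ≤ f b ∧ p.2 - p.1 ^ 2 = (p.1 - f a) * (f b - p.1) := by
    intro a b ha hb hab p hp
    rw [arc_mk, posv a ha, posv b hb] at hp
    exact mem_segment_parabola (by exact_mod_cast hab) hp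
  have spoke : ∀ v, v ≠ z → ∀ p ∈ arc s(z, v), (p = pos v ∨ p.2 < p.1 ^ 2) ∧
      p.1 * ((f v : ℝ) ^ 2 + M) = f v * (p.2 + M) := by
    intro v hv p hp
    rw [arc_mk, posz, posv v hv] at hp
    rw [posv v hv]
    exact mem_segment_apex (hM v) hp
  have mem_arc : ∀ e ∈ G.edgeSet, ∀ w, pos w ∈ arc e → w ∈ e := by
    intro e he w hw
    rcases cases_edge e he with ⟨v, hv, rfl⟩ | ⟨a, b, ha, hb, hab, -, rfl⟩
    · rw [Sym2.mem_iff]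
      by_cases hwz : w = z
      · exact Or.inl hwz
      · right
        rcases (spoke v hv _ hw).1 with h | h
        · exact pos_inj h
        · rw [posv w hwz] at h
          exact absurd h (lt_irrefl _)
    · obtain ⟨h1, h2, h3⟩ := chord a b ha hb hab _ hw
      rw [Sym2.mem_iff]
      by_cases hwz : w = z
      · subst hwz
        rw [posz] at h1 h2 h3
        simp only at h1 h2 h3
        nlinarith [mul_nonneg (sub_nonneg.2 h1) (sub_nonneg.2 h2)]
      · rw [posv w hwz] at h3
        simp only [sub_self] at h3
        rcases mul_eq_zero.1 h3.symm with h | h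
        · exact Or.inl (hf _ _ hwz ha (by exact_mod_cast sub_eq_zero.1 h))
        · exact Or.inr (hf _ _ hwz hb (by exact_mod_cast (sub_eq_zero.1 h).symm))
  have spoke_chord : ∀ v a b, v ≠ z → a ≠ z → b ≠ z → f a < f b → G.Adj a b →
      ∀ p, p ∈ arc s(z, v) → p ∈ arc s(a, b) → p = pos v ∧ v ∈ s(a, b) := by
    intro v a b hv ha hb hab hadj p hp hp'
    have h : p = pos v := by
      rcases (spoke v hv p hp).1 with h | h
      · exact h
      · obtain ⟨h1, h2, h3⟩ := chord a b ha hb hab p hp'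
        nlinarith [mul_nonneg (sub_nonneg.2 h1) (sub_nonneg.2 h2)]
    exact ⟨h, mem_arc s(a, b) hadj v (h ▸ hp')⟩
  have chord_chord : ∀ a b c d, a ≠ z → b ≠ z → c ≠ z → d ≠ z → f a < f b → f c < f d →
      (f b ≤ f c ∨ f a ≤ f c ∧ f d ≤ f b) → s(a, b) ≠ s(c, d) →
      ∀ p, p ∈ arc s(a, b) → p ∈ arc s(c, d) → ∃ w, w ≠ z ∧ w ∈ s(a, b) ∧ w ∈ s(c, d) ∧
        p.1 = f w ∧ p.2 - p.1 ^ 2 = 0 := by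
    intro a b c d ha hb hc hd hab hcd hpos hne p hp hp'
    obtain ⟨h1, h2, h3⟩ := chord a b ha hb hab p hp
    obtain ⟨h4, h5, h6⟩ := chord c d hc hd hcd p hp'
    have hab' : (f a : ℝ) < f b := by exact_mod_cast hab
    have hcd' : (f c : ℝ) < f d := by exact_mod_cast hcd
    rcases hpos with h | ⟨hac, hdb⟩
    · have h' : (f b : ℝ) ≤ f c := by exact_mod_cast h
      have e1 : p.1 = f b := le_antisymm h2 (h'.trans h4)
      have e2 : (f b : ℝ) = f c := le_antisymm h' (h4.trans h2)
      have e3 : b = c := hf b c hb hc (by exact_mod_cast e2)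
      refine ⟨b, hb, by simp, by simp [e3], e1, ?_⟩
      rw [h3, e1]; ring
    · have hac' : (f a : ℝ) ≤ f c := by exact_mod_cast hac
      have hdb' : (f d : ℝ) ≤ f b := by exact_mod_cast hdb
      -- The point has the same height above the parabola on both chords. For nested intervals the
      -- difference of the two products is this sum of nonnegative terms, so each of them vanishes.
      have e : (f c - f a : ℝ) * (f b - p.1) + (p.1 - f c) * (f b - f d) = 0 := by
        rw [h6] at h3; linear_combination -h3
      have n1 : 0 ≤ (f c - f a : ℝ) * (f b - p.1) :=
        mul_nonneg (sub_nonneg.2 hac') (sub_nonneg.2 h2)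
      have n2 : 0 ≤ (p.1 - f c) * (f b - f d : ℝ) :=
        mul_nonneg (sub_nonneg.2 h4) (sub_nonneg.2 hdb')
      have z1 := mul_eq_zero.1 (le_antisymm (by linarith) n1)
      have z2 := mul_eq_zero.1 (le_antisymm (by linarith) n2)
      rcases z1 with z1 | z1 <;> rcases z2 with z2 | z2
      · have e3 : c = a := hf c a hc ha (by exact_mod_cast sub_eq_zero.1 z1)
        refine ⟨c, hc, by simp [e3], by simp, sub_eq_zero.1 z2, ?_⟩
        rw [h6, z2]; ring
      · have e3 : c = a := hf c a hc ha (by exact_mod_cast sub_eq_zero.1 z1)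
        have e4 : b = d := hf b d hb hd (by exact_mod_cast sub_eq_zero.1 z2)
        exact absurd (by rw [e3, e4]) hne
      · linarith
      · have e4 : b = d := hf b d hb hd (by exact_mod_cast sub_eq_zero.1 z2)
        refine ⟨b, hb, by simp, by simp [e4], (sub_eq_zero.1 z1).symm, ?_⟩
        rw [h3, z1]; ring
  refine ⟨⟨pos, arc, pos_inj, fun u v huv => ?_, mem_arc, ?_⟩⟩
  · exact ⟨Path.segment _ _, Path.segment_injective_of_ne fun h => huv.ne (pos_inj h),
      Path.range_segment _ _⟩
  · rintro e he g hg hne p ⟨hpe, hpg⟩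
    rcases cases_edge e he with ⟨v, hv, rfl⟩ | ⟨a, b, ha, hb, hab, hadj, rfl⟩ <;>
      rcases cases_edge g hg with ⟨v', hv', rfl⟩ | ⟨c, d, hc', hd, hcd, hadj', rfl⟩
    · refine ⟨z, by simp, by simp, ?_⟩
      have h1 := (spoke v hv p hpe).2
      have h2 := (spoke v' hv' p hpg).2
      have hvv : (f v : ℝ) ≠ f v' := fun h =>
        hne (by rw [hf v v' hv hv' (by exact_mod_cast h)])
      have hlt : (f v : ℝ) * f v' < M := by
        nlinarith [hM v, hM v', sq_nonneg ((f v : ℝ) - f v')]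
      -- The elimination of `p.1` from the equations of the two spokes; the last two factors are not
      -- zero.
      have e : (p.2 + M) * (((f v : ℝ) - f v') * (M - f v * f v')) = 0 := by
        linear_combination (-(f v' : ℝ) ^ 2 - M) * h1 + ((f v : ℝ) ^ 2 + M) * h2
      have hy : p.2 = -M := by
        rcases mul_eq_zero.1 e with h | h
        · linarith
        · rcases mul_eq_zero.1 h with h | h
          · exact absurd (sub_eq_zero.1 h) hvv
          · linarith
      have hx : p.1 = 0 := by
        rw [hy] at h1
        have : p.1 * ((f v : ℝ) ^ 2 + M) = 0 := by linarith
        rcases mul_eq_zero.1 this with h | h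
        · exact h
        · nlinarith [sq_nonneg (f v : ℝ)]
      rw [posz]
      exact Prod.ext hx hy
    · obtain ⟨h1, h2⟩ := spoke_chord v c d hv hc' hd hcd hadj' p hpe hpg
      exact ⟨v, by simp, h2, h1⟩
    · obtain ⟨h1, h2⟩ := spoke_chord v' a b hv' ha hb hab hadj p hpg hpe
      exact ⟨v', h2, by simp, h1⟩
    · have n1 := hc a b c d ha hb hc' hd hadj hadj'
      have n2 := hc c d a b hc' hd ha hb hadj' hadj
      have fin : (∃ w, w ≠ z ∧ w ∈ s(a, b) ∧ w ∈ s(c, d) ∧ p.1 = f w ∧ p.2 - p.1 ^ 2 = 0) →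
          ∃ w, w ∈ s(a, b) ∧ w ∈ s(c, d) ∧ p = pos w := by
        rintro ⟨w, hw, h1, h2, h3, h4⟩
        refine ⟨w, h1, h2, ?_⟩
        rw [posv w hw]
        refine Prod.ext h3 ?_
        simp only
        rw [← h3]; linarith
      apply fin
      by_cases hpos : f b ≤ f c ∨ f a ≤ f c ∧ f d ≤ f b
      · exact chord_chord a b c d ha hb hc' hd hab hcd hpos hne p hpe hpg
      · obtain ⟨w, h1, h2, h3, h4⟩ := chord_chord c d a b hc' hd ha hb hcd hab
          (by by_contra hcon
              rcases lt_trichotomy (f a) (f c) with h | h | h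
              · exact n1 h (by omega) (by omega)
              · omega
              · exact n2 h (by omega) (by omega)) hne.symm p hpg hpe
        exact ⟨w, h1, h3, h2, h4⟩

/-! ### Connectivity and invariance under isomorphism -/

theorem isThreeConnected_of_walks {V : Type*} [Fintype V] {G : SimpleGraph V}
    (hcard : 3 < Fintype.card V)
    (h : ∀ S : Finset V, S.card < 3 → ∃ x ∉ S, ∀ y ∉ S, ∃ p : G.Walk x y, ∀ v ∈ p.support, v ∉ S) :
    IsThreeConnected G := by
  refine ⟨hcard, fun S hS => ?_⟩
  obtain ⟨x, hx, hp⟩ := h S hS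
  have hx' : x ∈ (S : Set V)ᶜ := fun e => hx (Finset.mem_coe.1 e)
  rw [SimpleGraph.connected_iff_exists_forall_reachable]
  refine ⟨⟨x, hx'⟩, fun ⟨y, hy⟩ => ?_⟩
  obtain ⟨p, hp⟩ := hp y fun e => hy (Finset.mem_coe.2 e)
  exact ⟨p.induce _ fun v hv e => hp v hv (Finset.mem_coe.1 e)⟩

/-- If the apex survives, it is adjacent to every other vertex. If it is deleted, at most one rim
vertex goes with it, and a cycle minus a vertex is connected. -/
theorem SimpleGraph.IsRim.isThreeConnected {V : Type*} [Fintype V] {G : SimpleGraph V} {z : V}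
    {n : ℕ} {c : ℕ → V} (h : G.IsRim z n c) : IsThreeConnected G := by
  classical
  have hn := h.three_le
  have hcard : 3 < Fintype.card V := by
    have hinj : Function.Injective (fun o : Option (Fin n) => o.elim z fun i => c i) := by
      rintro (_ | i) (_ | j) e
      · rfl
      · exact absurd e.symm (h.ne_apex _)
      · exact absurd e (h.ne_apex _)
      · have := (h.eq_iff _ _).1 e
        rw [Nat.mod_eq_of_lt i.2, Nat.mod_eq_of_lt j.2] at this
        rw [Fin.ext this]
    have := Fintype.card_le_of_injective _ hinj
    simp at this; omega
  refine isThreeConnected_of_walks hcard fun S hS => ?_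
  by_cases hz : z ∈ S
  · have hc : (S.erase z).card ≤ 1 := by rw [Finset.card_erase_of_mem hz]; omega
    -- The position of the deleted rim vertex, or 0 if there is none. Walks will start at `a + 1`
    -- and go round.
    obtain ⟨a, ha⟩ : ∃ a, ∀ t, c t ∈ S → c t = c a := by
      by_cases hex : ∃ a, c a ∈ S
      · obtain ⟨a, ha⟩ := hex
        refine ⟨a, fun t ht => Finset.card_le_one.1 hc _ ?_ _ ?_⟩
        · exact Finset.mem_erase.2 ⟨h.ne_apex _, ht⟩
        · exact Finset.mem_erase.2 ⟨h.ne_apex _, ha⟩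
      · exact ⟨0, fun t ht => absurd ⟨t, ht⟩ hex⟩
    have hout : ∀ s, s + 1 < n → c (a + 1 + s) ∉ S := by
      intro s hs hS'
      have := h.inj (ha _ hS').symm (by omega) (by omega)
      omega
    have walk : ∀ s, s < n → c (a + 1 + s) ∉ S →
        ∃ p : G.Walk (c (a + 1)) (c (a + 1 + s)), ∀ v ∈ p.support, v ∉ S := by
      intro s
      induction s with
      | zero => exact fun _ h0 => ⟨Walk.nil, by simpa using h0⟩
      | succ s ih =>
        intro hs h1
        obtain ⟨p, hp⟩ := ih (by omega) (hout s hs)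
        refine ⟨p.append (Walk.cons (h.adj (a + 1 + s)) Walk.nil), fun v hv => ?_⟩
        rw [Walk.mem_support_append_iff] at hv
        rcases hv with hv | hv
        · exact hp v hv
        · simp only [Walk.support_cons, Walk.support_nil, List.mem_cons, List.not_mem_nil,
            or_false] at hv
          rcases hv with rfl | rfl
          · exact hout s hs
          · exact h1
    refine ⟨c (a + 1), by simpa using hout 0 (by omega), fun y hy => ?_⟩
    obtain ⟨t, ht, rfl⟩ := (h.shift (a + 1)).surj y (by rintro rfl; exact hy hz)
    rw [add_comm t (a + 1)] at hy ⊢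
    exact walk t ht hy
  · refine ⟨z, hz, fun y hy => ?_⟩
    by_cases hyz : y = z
    · subst hyz; exact ⟨Walk.nil, by simpa using hz⟩
    · exact ⟨Walk.cons (h.apex y hyz) Walk.nil, by simp [hz, hy]⟩

theorem IsPlanar.of_iso {V W : Type*} {G : SimpleGraph V} {H : SimpleGraph W} (φ : G ≃g H)
    (hH : IsPlanar H) : IsPlanar G := by
  obtain ⟨D⟩ := hH
  have hmap : ∀ e ∈ G.edgeSet, e.map φ ∈ H.edgeSet := by
    intro e he
    induction e with | _ a b => exact φ.map_rel_iff.2 he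
  refine ⟨⟨fun v => D.pos (φ v), fun e => D.arc (e.map φ),
    D.pos_injective.comp φ.injective, fun u v huv => D.isArc _ _ (φ.map_rel_iff.2 huv), ?_, ?_⟩⟩
  · intro e he w hw
    obtain ⟨v, hv, hvw⟩ := Sym2.mem_map.1 (D.mem_of_pos_mem_arc _ (hmap e he) _ hw)
    exact φ.injective hvw ▸ hv
  · intro e he f hf hne x hx
    obtain ⟨w, h1, h2, h3⟩ := D.inter_arc _ (hmap e he) _ (hmap f hf)
      (fun h => hne (Sym2.map.injective φ.injective h)) x hx
    obtain ⟨v, hv, rfl⟩ := Sym2.mem_map.1 h1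
    obtain ⟨v', hv', hvv⟩ := Sym2.mem_map.1 h2
    exact ⟨v, hv, φ.injective hvv ▸ hv', h3⟩

theorem IsThreeConnected.of_iso {V W : Type*} [Fintype V] [Fintype W] {G : SimpleGraph V}
    {H : SimpleGraph W} (φ : G ≃g H) (hH : IsThreeConnected H) : IsThreeConnected G := by
  have hcard := hH.1
  rw [← Fintype.card_congr φ.toEquiv] at hcard
  refine isThreeConnected_of_walks hcard fun S hS => ?_
  obtain ⟨x, hx⟩ : ∃ x, x ∉ S := by
    by_contra! hcon
    have := Finset.card_le_card (fun v _ => hcon v : (Finset.univ : Finset V) ⊆ S)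
    rw [Finset.card_univ] at this; omega
  refine ⟨x, hx, fun y hy => ?_⟩
  have hmem : ∀ v, φ v ∈ S.map φ.toEquiv.toEmbedding ↔ v ∈ S := fun v =>
    Finset.mem_map' φ.toEquiv.toEmbedding
  obtain ⟨p, hp⟩ := hH.exists_walk (S := S.map φ.toEquiv.toEmbedding) (by simpa using hS)
    (x := φ x) (y := φ y) (by rwa [hmem]) (by rwa [hmem])
  refine ⟨(p.map φ.symm.toHom).copy (φ.symm_apply_apply x) (φ.symm_apply_apply y), ?_⟩
  intro v hv
  rw [SimpleGraph.Walk.support_copy] at hv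
  obtain ⟨w, hw, rfl⟩ := List.mem_map.1 ((SimpleGraph.Walk.support_map _ p) ▸ hv)
  have := hp w hw
  rw [← hmem]
  change φ (φ.symm w) ∉ _
  rwa [φ.apply_symm_apply]

theorem SimpleGraph.Iso.ncard_neighborSet {V W : Type*} {G : SimpleGraph V} {H : SimpleGraph W}
    (φ : G ≃g H) (v : V) : (H.neighborSet (φ v)).ncard = (G.neighborSet v).ncard := by
  have : H.neighborSet (φ v) = φ '' G.neighborSet v := by
    ext w
    simp only [mem_neighborSet, Set.mem_image]
    constructor
    · intro h
      refine ⟨φ.symm w, ?_, φ.apply_symm_apply w⟩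
      rw [← φ.map_rel_iff]
      simpa using h
    · rintro ⟨u, hu, rfl⟩
      exact φ.map_rel_iff.2 hu
  rw [this, Set.ncard_image_of_injective _ φ.injective]

theorem degreeSequence_eq_of_iso {V W : Type*} [Fintype V] [Fintype W] {G : SimpleGraph V}
    {H : SimpleGraph W} (φ : G ≃g H) : degreeSequence G = degreeSequence H := by
  rw [degreeSequence_eq, degreeSequence_eq,
    ← Multiset.map_univ_val_equiv φ.toEquiv, Multiset.map_map]
  congr 1
  funext v
  exact (φ.ncard_neighborSet v).symm

theorem radius_eq_one_of_apex {V : Type*} [Nontrivial V] {G : SimpleGraph V} {z : V}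
    (hz : ∀ v, v ≠ z → G.Adj z v) : G.radius = 1 := by
  have h1 : G.radius ≤ 1 :=
    G.radius_le_eccent.trans ((G.eccent_le_one_iff z).2 fun v hv => hz v hv.symm)
  have h0 : G.radius ≠ 0 := SimpleGraph.radius_ne_zero_of_nontrivial
  exact le_antisymm h1 (Order.one_le_iff_ne_zero.2 h0)

/-! ### Word graphs are polytopes of radius one -/

/-- The position on the rim of a vertex of a strip. -/
def rimPosition (k l : ℕ) : StripVertex k l → ℕ
  | .inl _ => 0
  | .inr (.inl false) => 0
  | .inr (.inl true) => k + 2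
  | .inr (.inr (.inl i)) => 1 + i.val
  | .inr (.inr (.inr j)) => k + l + 3 - j.val

/-- The vertex of a strip at a given position of the rim. -/
def rimVertex (k l t : ℕ) : StripVertex k l :=
  if t = 0 then .inr (.inl false)
  else if h : t - 1 < k + 1 then .inr (.inr (.inl ⟨t - 1, h⟩))
  else if t = k + 2 then .inr (.inl true)
  -- The minimum only supplies the bound on the index; in this branch it equals `k + l + 3 - t`.
  else .inr (.inr (.inr ⟨min l (k + l + 3 - t), by omega⟩))

theorem rimPosition_lt {k l : ℕ} (v : StripVertex k l) : rimPosition k l v < k + l + 4 := by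
  rcases v with (_ | (_ | _) | i | j) <;> simp only [rimPosition] <;> omega

theorem rimVertex_rimPosition {k l : ℕ} {v : StripVertex k l} (hv : v ≠ .inl ()) :
    rimVertex k l (rimPosition k l v) = v := by
  rcases v with (_ | (_ | _) | i | j)
  · exact absurd rfl hv
  · simp [rimPosition, rimVertex]
  · simp [rimPosition, rimVertex]
  · have h : i.val < k + 1 := i.2
    have e : 1 + i.val - 1 = i.val := by omega
    simp [rimPosition, rimVertex, e, Nat.le_of_lt_succ h]
  · have h1 : ¬ (k + l + 3 - j.val - 1 < k + 1) := by omega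
    have h2 : ¬ (k + l + 3 - j.val = k + 2) := by omega
    have h3 : ¬ (k + l + 3 - j.val = 0) := by omega
    have h4 : min l (k + l + 3 - (k + l + 3 - j.val)) = j.val := by omega
    rw [rimPosition, rimVertex, if_neg h3, dif_neg h1, if_neg h2]
    simp only [h4]

theorem rimVertex_ne {k l t : ℕ} : rimVertex k l t ≠ .inl () := by
  unfold rimVertex
  split_ifs <;> simp

theorem rimPosition_rimVertex {k l t : ℕ} (ht : t < k + l + 4) :
    rimPosition k l (rimVertex k l t) = t := by
  unfold rimVertex
  split_ifs with h1 h2 h3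
  · simp [rimPosition, h1]
  · simp only [rimPosition]; omega
  · simp [rimPosition, h3]
  · simp only [rimPosition]; omega

section Strip

variable {k l : ℕ} {E : ℕ → ℕ → Prop}

theorem stripGraph_adj {x y : StripVertex k l} :
    (stripGraph k l E).Adj x y ↔ x ≠ y ∧ (stripRel k l E x y ∨ stripRel k l E y x) :=
  SimpleGraph.fromRel_adj _ _ _

theorem stripGraph_adj_apex {v : StripVertex k l} (hv : v ≠ .inl ()) :
    (stripGraph k l E).Adj (.inl ()) v :=
  stripGraph_adj.2 ⟨hv.symm, Or.inl trivial⟩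

theorem stripGraph_adj_of_position {x y : StripVertex k l} (hx : x ≠ .inl ()) (hy : y ≠ .inl ())
    (h : rimPosition k l y = rimPosition k l x + 1 ∨
      rimPosition k l x = k + l + 3 ∧ rimPosition k l y = 0) :
    (stripGraph k l E).Adj x y := by
  rw [stripGraph_adj]
  rcases x with (_ | (_ | _) | i | j) <;> rcases y with (_ | (_ | _) | i' | j')
  all_goals first
    | exact absurd rfl hx
    | exact absurd rfl hy
    | skip
  all_goals simp only [rimPosition] at h
  all_goals first
    | (exfalso; omega)
    | skip
  all_goals simp only [stripRel, ne_eq, Sum.inr.injEq, Sum.inl.injEq, reduceCtorEq, not_false_eq_true,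
    or_false, false_or, true_and, Fin.ext_iff]
  all_goals omega

theorem stripGraph_adj_cases {x y : StripVertex k l} (hx : x ≠ .inl ()) (hy : y ≠ .inl ())
    (h : (stripGraph k l E).Adj x y) (hlt : rimPosition k l x < rimPosition k l y) :
    rimPosition k l y = rimPosition k l x + 1 ∨
      rimPosition k l x = 0 ∧ rimPosition k l y = k + l + 3 ∨
      ∃ i j, i ≤ k ∧ j ≤ l ∧ E i j ∧ rimPosition k l x = 1 + i ∧
        rimPosition k l y = k + l + 3 - j := by
  obtain ⟨-, h⟩ := stripGraph_adj.1 h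
  rcases x with (_ | (_ | _) | i | j) <;> rcases y with (_ | (_ | _) | i' | j')
  all_goals first
    | exact absurd rfl hx
    | exact absurd rfl hy
    | skip
  all_goals simp only [rimPosition, stripRel, or_false, false_or, true_and] at h hlt ⊢
  all_goals first
    | (exfalso; omega)
    | (left; omega)
    | (right; left; omega)
    | skip
  exact Or.inr (Or.inr ⟨i, j', by omega, by omega, h, rfl, rfl⟩)

theorem stripGraph_isRim : (stripGraph k l E).IsRim (.inl ()) (k + l + 4)
    (fun t => rimVertex k l (t % (k + l + 4))) where
  three_le := by omega
  apex _ hv := stripGraph_adj_apex hv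
  adj t := by
    refine stripGraph_adj_of_position rimVertex_ne rimVertex_ne ?_
    rw [rimPosition_rimVertex (Nat.mod_lt _ (by omega)),
      rimPosition_rimVertex (Nat.mod_lt _ (by omega))]
    have hlt := Nat.mod_lt t (show 0 < k + l + 4 by omega)
    have e := Nat.add_mod t 1 (k + l + 4)
    rw [Nat.mod_eq_of_lt (a := 1) (by omega)] at e
    rcases Nat.lt_or_ge (t % (k + l + 4) + 1) (k + l + 4) with h | h
    · rw [Nat.mod_eq_of_lt h] at e
      exact Or.inl e
    · rw [show t % (k + l + 4) + 1 = k + l + 4 by omega, Nat.mod_self] at e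
      exact Or.inr ⟨by omega, e⟩
  eq_iff s t := by
    constructor
    · intro h
      have := congrArg (rimPosition k l) h
      rwa [rimPosition_rimVertex (Nat.mod_lt _ (by omega)),
        rimPosition_rimVertex (Nat.mod_lt _ (by omega))] at this
    · intro h; simp only [h]
  ne_apex _ := rimVertex_ne
  surj v hv := ⟨rimPosition k l v, rimPosition_lt v, by
    simp only [Nat.mod_eq_of_lt (rimPosition_lt v), rimVertex_rimPosition hv]⟩

/-- Edges between consecutive positions, or between the first and the last, cannot interleave with
any edge, and interleaving chords contradict monotonicity. -/
theorem stripGraph_isPlanar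
    (h : ∀ i j i' j', E i j → E i' j' → i < i' → j ≤ j') : IsPlanar (stripGraph k l E) := by
  refine isPlanar_of_not_crossing (.inl ()) (rimPosition k l) ?_ ?_
  · intro u v hu hv e
    rw [← rimVertex_rimPosition hu, e, rimVertex_rimPosition hv]
  · intro a b c d ha hb hc hd hab hcd h1 h2 h3
    have p1 := stripGraph_adj_cases ha hb hab (by omega)
    have p2 := stripGraph_adj_cases hc hd hcd (by omega)
    have := rimPosition_lt d
    rcases p1 with p1 | p1 | ⟨i, j, hi, hj, hE, e1, e2⟩
    · omega
    · omega
    rcases p2 with p2 | p2 | ⟨i', j', hi', hj', hE', e1', e2'⟩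
    · omega
    · omega
    have := h i j i' j' hE hE' (by omega)
    omega

/-! ### Degrees -/

theorem ncard_neighborSet_apex :
    ((stripGraph k l E).neighborSet (.inl ())).ncard = k + l + 4 := by
  have : (stripGraph k l E).neighborSet (.inl ()) =
      ((Finset.univ.erase (.inl ()) : Finset (StripVertex k l)) : Set (StripVertex k l)) := by
    ext v
    simp only [SimpleGraph.mem_neighborSet, Finset.coe_erase, Finset.coe_univ, Set.mem_sdiff,
      Set.mem_univ, Set.mem_singleton_iff, true_and]
    exact ⟨fun h => h.ne.symm, stripGraph_adj_apex⟩
  rw [this, Set.ncard_coe_finset, Finset.card_erase_of_mem (Finset.mem_univ _), Finset.card_univ]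
  simp
  omega

theorem neighborSet_left : (stripGraph k l E).neighborSet (.inr (.inl false)) =
    {.inl (), .inr (.inr (.inl 0)), .inr (.inr (.inr 0))} := by
  ext v
  rw [SimpleGraph.mem_neighborSet, stripGraph_adj]
  rcases v with (_ | (_ | _) | i | j) <;> simp [stripRel]

theorem neighborSet_right : (stripGraph k l E).neighborSet (.inr (.inl true)) =
    {.inl (), .inr (.inr (.inl (Fin.last k))), .inr (.inr (.inr (Fin.last l)))} := by
  ext v
  rw [SimpleGraph.mem_neighborSet, stripGraph_adj]
  rcases v with (_ | (_ | _) | i | j) <;> simp [stripRel, Fin.ext_iff]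

theorem ncard_neighborSet_end (b : Bool) :
    ((stripGraph k l E).neighborSet (.inr (.inl b))).ncard = 3 := by
  cases b
  · rw [neighborSet_left, Set.ncard_eq_three]
    exact ⟨_, _, _, by simp, by simp, by simp, rfl⟩
  · rw [neighborSet_right, Set.ncard_eq_three]
    exact ⟨_, _, _, by simp, by simp, by simp, rfl⟩

theorem ncard_neighborSet_fst (hE : ∀ i j, E i j → j ≤ l) (i : Fin (k + 1)) :
    ((stripGraph k l E).neighborSet (.inr (.inr (.inl i)))).ncard = 3 + {j | E i j}.ncard := by
  let ψ : ℕ → StripVertex k l := fun j => .inr (.inr (.inr ⟨min j l, by omega⟩))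
  have e : (stripGraph k l E).neighborSet (.inr (.inr (.inl i))) =
      -- The vertex itself has position `1 + i`. Naming its rim neighbours by position covers the
      -- ends of the strip without a case distinction.
      {.inl (), rimVertex k l i, rimVertex k l (i + 2)} ∪ ψ '' {j | E i j} := by
    have h1 : ∀ v : StripVertex k l, v ≠ .inl () → ∀ t, t < k + l + 4 →
        (v = rimVertex k l t ↔ rimPosition k l v = t) := by
      intro v hv t ht
      constructor
      · rintro rfl; exact rimPosition_rimVertex ht
      · rintro rfl; exact (rimVertex_rimPosition hv).symm
    ext v
    rw [SimpleGraph.mem_neighborSet, stripGraph_adj, Set.mem_union, Set.mem_insert_iff,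
      Set.mem_insert_iff, Set.mem_singleton_iff]
    by_cases hv : v = .inl ()
    · subst hv; simp [stripRel]
    rw [h1 v hv _ (by omega), h1 v hv _ (by omega)]
    have hψ : v ∈ ψ '' {j | E i j} ↔ ∃ j : Fin (l + 1), v = .inr (.inr (.inr j)) ∧ E i j := by
      constructor
      · rintro ⟨j, hj, rfl⟩
        have := hE _ _ hj
        exact ⟨⟨min j l, by omega⟩, rfl, by simpa [Nat.min_eq_left this] using hj⟩
      · rintro ⟨j, rfl, hj⟩
        refine ⟨j, hj, ?_⟩
        have : min j.val l = j.val := by omega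
        simp [ψ, this]
    rw [hψ]
    rcases v with (_ | (_ | _) | i' | j)
    · exact absurd rfl hv
    all_goals simp only [stripRel, rimPosition, ne_eq, Sum.inr.injEq, Sum.inl.injEq, reduceCtorEq,
      not_false_eq_true, or_false, false_or, true_and, false_and, exists_const, Fin.ext_iff]
    · omega
    · omega
    · omega
    · constructor
      · exact fun h => Or.inr ⟨j, rfl, h⟩
      · rintro (h | ⟨j', h, h'⟩)
        · omega
        · rwa [h]
  have hf : {j | E i j}.Finite := (Set.finite_Iic l).subset fun j hj => hE _ _ hj
  rw [e, Set.ncard_union_eq _ (Set.toFinite _) (hf.image _), Set.InjOn.ncard_image]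
  · congr 1
    rw [Set.ncard_eq_three]
    refine ⟨_, _, _, rimVertex_ne.symm, rimVertex_ne.symm, ?_, rfl⟩
    intro h
    have := congrArg (rimPosition k l) h
    rw [rimPosition_rimVertex (by omega), rimPosition_rimVertex (by omega)] at this
    omega
  · intro a ha b hb hab
    have h1 := hE _ _ ha
    have h2 := hE _ _ hb
    simp only [ψ, Sum.inr.injEq, Fin.mk.injEq] at hab
    omega
  · rw [Set.disjoint_left]
    rintro _ hv ⟨j, -, rfl⟩
    rw [Set.mem_insert_iff, Set.mem_insert_iff, Set.mem_singleton_iff] at hv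
    rcases hv with hv | hv | hv
    · simp [ψ] at hv
    all_goals
      have := congrArg (rimPosition k l) hv
      rw [rimPosition_rimVertex (by omega)] at this
      simp only [ψ, rimPosition] at this
      omega

end Strip

/-- Exchange of the sides of a strip. -/
def stripSwap (k l : ℕ) : StripVertex k l ≃ StripVertex l k :=
  Equiv.sumCongr (Equiv.refl _) (Equiv.sumCongr (Equiv.refl _) (Equiv.sumComm _ _))

/-- Exchange of the sides as an isomorphism of strips. -/
def stripSwapIso {k l : ℕ} {E E' : ℕ → ℕ → Prop} (h : ∀ i j, E' j i ↔ E i j) :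
    stripGraph k l E ≃g stripGraph l k E' :=
  stripGraphIso (stripSwap k l) <| by
    rintro (_ | (_ | _) | i | j) (_ | (_ | _) | i' | j')
    all_goals simp only [stripSwap, Equiv.sumCongr_apply, Sum.map_inl, Sum.map_inr,
      Equiv.refl_apply, Equiv.sumComm_apply, Sum.swap_inl, Sum.swap_inr, stripRel, or_false,
      false_or]
    · exact h _ _
    · exact h _ _

theorem ncard_neighborSet_snd {k l : ℕ} {E : ℕ → ℕ → Prop} (hE : ∀ i j, E i j → i ≤ k)
    (j : Fin (l + 1)) :
    ((stripGraph k l E).neighborSet (.inr (.inr (.inr j)))).ncard = 3 + {i | E i j}.ncard := by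
  rw [← ncard_neighborSet_fst (k := l) (l := k) (E := fun a b => E b a) (fun a b h => hE _ _ h) j]
  exact ((stripSwapIso (k := k) (l := l) (E := E) (E' := fun a b => E b a)
    fun _ _ => Iff.rfl).ncard_neighborSet (.inr (.inr (.inr j)))).symm

/-! ### Chord counts read off a word, and the reduction to words -/

namespace StripStep

/-- Add one to the first entry of a list. -/
def incHead : List ℕ → List ℕ
  | [] => []
  | a :: l => (a + 1) :: l

/-- The numbers of chords at the vertices of the first side. -/
def fstCounts : List StripStep → List ℕ
  | [] => [1]
  | fst :: w => 1 :: fstCounts w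
  | snd :: w => incHead (fstCounts w)
  | both :: w => 1 :: fstCounts w

/-- The numbers of chords at the vertices of the second side. -/
def sndCounts (w : List StripStep) : List ℕ := fstCounts (w.map swap)

/-- The numbers of chords at the vertices of both sides. -/
def counts (w : List StripStep) : Multiset ℕ := (fstCounts w : Multiset ℕ) + sndCounts w

theorem IsChord.mono {w : List StripStep} {i j i' j' : ℕ} (h : IsChord w i j)
    (h' : IsChord w i' j') (hlt : i < i') : j ≤ j' := by
  obtain ⟨v, hv, rfl, rfl⟩ := h
  obtain ⟨v', hv', rfl, rfl⟩ := h'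
  rcases List.prefix_or_prefix_of_prefix hv hv' with ⟨t, rfl⟩ | ⟨t, rfl⟩
  · simp
  · simp at hlt

theorem finite_isChord (w : List StripStep) (i : ℕ) : {j | IsChord w i j}.Finite :=
  (Set.finite_Iic (height w)).subset fun _ hj => hj.le.2

/-- A first letter `fst` or `both` leaves the chord `(0, 0)` as the only one at the first vertex; a
first letter `snd` adds `(0, 0)` to the chords which that vertex has in the rest of the word. -/
theorem map_range_ncard (w : List StripStep) :
    (List.range (width w + 1)).map (fun i => {j | IsChord w i j}.ncard) = fstCounts w := by
  have inj : ∀ s : Set ℕ, ((1 + ·) '' s).ncard = s.ncard := fun s =>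
    Set.ncard_image_of_injective s (add_right_injective 1)
  induction w with
  | nil =>
    have : {j | IsChord [] 0 j} = {0} := by ext j; simp [isChord_nil]
    simp [fstCounts, this]
  | cons s w ih =>
    cases s with
    | fst =>
      have h0 : {j | IsChord (fst :: w) 0 j} = {0} := by
        ext j; simp [isChord_cons, dx]; omega
      have h1 : ∀ i, {j | IsChord (fst :: w) (i + 1) j} = {j | IsChord w i j} := by
        intro i; ext j
        simp only [Set.mem_ofPred_eq, isChord_cons, dx, dy]
        constructor
        · rintro (h | ⟨i', j', h, h1, rfl⟩)
          · omega
          · obtain rfl : i = i' := by omega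
            simpa using h
        · exact fun h => Or.inr ⟨i, j, h, by omega, by omega⟩
      rw [width_cons, dx, fstCounts, ← ih, show 1 + width w + 1 = width w + 1 + 1 by omega,
        List.range_succ_eq_map (n := width w + 1), List.map_cons, List.map_map, h0,
        Set.ncard_singleton]
      simp [Function.comp_def, h1]
    | both =>
      have h0 : {j | IsChord (both :: w) 0 j} = {0} := by
        ext j; simp [isChord_cons, dx]; omega
      have h1 : ∀ i, {j | IsChord (both :: w) (i + 1) j} = (1 + ·) '' {j | IsChord w i j} := by
        intro i; ext j
        simp only [Set.mem_ofPred_eq, isChord_cons, dx, dy, Set.mem_image]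
        constructor
        · rintro (h | ⟨i', j', h, h1, rfl⟩)
          · omega
          · obtain rfl : i = i' := by omega
            exact ⟨j', h, rfl⟩
        · rintro ⟨j', h, rfl⟩
          exact Or.inr ⟨i, j', h, by omega, rfl⟩
      rw [width_cons, dx, fstCounts, ← ih, show 1 + width w + 1 = width w + 1 + 1 by omega,
        List.range_succ_eq_map (n := width w + 1), List.map_cons, List.map_map, h0,
        Set.ncard_singleton]
      simp [Function.comp_def, h1, inj]
    | snd =>
      have h0 : {j | IsChord (snd :: w) 0 j} = insert 0 ((1 + ·) '' {j | IsChord w 0 j}) := by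
        ext j
        simp only [Set.mem_ofPred_eq, isChord_cons, dx, dy, Set.mem_image, Set.mem_insert_iff]
        constructor
        · rintro (h | ⟨i', j', h, h1, rfl⟩)
          · exact Or.inl h.2
          · obtain rfl : i' = 0 := by omega
            exact Or.inr ⟨j', h, rfl⟩
        · rintro (rfl | ⟨j', h, rfl⟩)
          · simp
          · exact Or.inr ⟨0, j', h, by omega, rfl⟩
      have h1 : ∀ i, {j | IsChord (snd :: w) (i + 1) j} =
          (1 + ·) '' {j | IsChord w (i + 1) j} := by
        intro i; ext j
        simp only [Set.mem_ofPred_eq, isChord_cons, dx, dy, Set.mem_image]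
        constructor
        · rintro (h | ⟨i', j', h, h1, rfl⟩)
          · omega
          · obtain rfl : i' = i + 1 := by omega
            exact ⟨j', h, rfl⟩
        · rintro ⟨j', h, rfl⟩
          exact Or.inr ⟨i + 1, j', h, by omega, rfl⟩
      have h2 : {j | IsChord (snd :: w) 0 j}.ncard = {j | IsChord w 0 j}.ncard + 1 := by
        rw [h0, Set.ncard_insert_of_notMem _ ((finite_isChord w 0).image _), inj]
        rintro ⟨j, -, hj⟩
        simp at hj
      rw [width_cons, dx, zero_add, fstCounts, ← ih, List.range_succ_eq_map, List.map_cons,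
        List.map_cons, incHead, List.map_map, List.map_map, h2]
      simp [Function.comp_def, h1, inj]

/-- The degree sequence of the polytope described by a word. -/
def wordSequence (w : List StripStep) : Multiset ℕ :=
  {width w + height w + 4} + Multiset.replicate 2 3 + (counts w).map (3 + ·)

end StripStep

theorem Multiset.map_univ_fin {α : Type*} (n : ℕ) (g : ℕ → α) :
    (Finset.univ : Finset (Fin n)).val.map (fun i : Fin n => g i) = ((List.range n).map g : List α) := by
  rw [Fin.univ_val_map, List.ofFn_eq_map, ← List.map_coe_finRange_eq_range, List.map_map]
  rfl

open StripStep in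
theorem degreeSequence_wordGraph (w : List StripStep) :
    degreeSequence (wordGraph w) = wordSequence w := by
  have h1 : ∀ i : Fin (width w + 1), ((wordGraph w).neighborSet (.inr (.inr (.inl i)))).ncard =
      3 + {j | IsChord w i j}.ncard := ncard_neighborSet_fst fun i j h => h.le.2
  have h2 : ∀ j : Fin (height w + 1), ((wordGraph w).neighborSet (.inr (.inr (.inr j)))).ncard =
      3 + {i | IsChord (w.map swap) j i}.ncard := fun j => by
    simp only [isChord_map_swap]
    exact ncard_neighborSet_snd (fun i j h => h.le.1) j
  have h3 := map_range_ncard (w.map swap)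
  rw [width_map_swap] at h3
  have hend : ∀ b, ((wordGraph w).neighborSet (.inr (.inl b))).ncard = 3 := ncard_neighborSet_end
  have hap : ((wordGraph w).neighborSet (.inl ())).ncard = width w + height w + 4 :=
    ncard_neighborSet_apex
  rw [degreeSequence_eq]
  -- The vertex type is an iterated sum, so its universal multiset is by definition a disjoint sum:
  -- the apex, the ends and the two sides.
  change Multiset.map _ (Multiset.disjSum _ (Multiset.disjSum _ (Multiset.disjSum _ _))) = _
  rw [Multiset.map_disjSum, Multiset.map_disjSum, Multiset.map_disjSum]
  simp only [h1, h2, hend]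
  rw [Multiset.map_univ_fin _ (fun i => 3 + {j | IsChord w i j}.ncard),
    Multiset.map_univ_fin _ (fun j => 3 + {i | IsChord (w.map swap) j i}.ncard)]
  rw [StripStep.wordSequence, counts, sndCounts, ← h3, ← map_range_ncard w, Multiset.map_add]
  simp [hap, add_assoc, Function.comp_def]
  exact List.Perm.swap _ _ _

open StripStep in
theorem isRadiusOneRealisation_of_iso {V : Type*} [Fintype V] {G : SimpleGraph V}
    {w : List StripStep} (φ : G ≃g wordGraph w) : IsRadiusOneRealisation G (wordSequence w) := by
  have h3 : IsThreeConnected (wordGraph w) := stripGraph_isRim.isThreeConnected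
  refine ⟨⟨(stripGraph_isPlanar fun i j i' j' => IsChord.mono).of_iso φ, h3.of_iso φ⟩, ?_, ?_⟩
  · have : Nontrivial (StripVertex (width w) (height w)) := ⟨.inl (), .inr (.inl false), by simp⟩
    have : Nontrivial V := φ.toEquiv.nontrivial
    refine radius_eq_one_of_apex (z := φ.symm (.inl ())) fun v hv => ?_
    rw [← φ.map_rel_iff, RelIso.apply_symm_apply]
    exact stripGraph_adj_apex fun h => hv (by rw [← h, RelIso.symm_apply_apply])
  · rw [degreeSequence_eq_of_iso φ, degreeSequence_wordGraph]

open StripStep in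
/-- Unigraphic sequences in terms of words. -/
theorem isUnigraphicRadiusOne_iff {s : Multiset ℕ} (hs : s.count 3 = 2) :
    IsUnigraphicRadiusOne s ↔ ∃ w, wordSequence w = s ∧
      ∀ w', wordSequence w' = s → Nonempty (wordGraph w ≃g wordGraph w') := by
  have real : ∀ w, wordSequence w = s → ∃ F : SimpleGraph (Fin (Multiset.card s)),
      IsRadiusOneRealisation F s ∧ Nonempty (F ≃g wordGraph w) := by
    rintro w rfl
    have hc : Fintype.card (StripVertex (width w) (height w)) = Multiset.card (wordSequence w) := by
      rw [← degreeSequence_wordGraph]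
      simp [degreeSequence]
    let e := Fintype.equivFinOfCardEq hc
    let φ : (wordGraph w).map e.toEmbedding ≃g wordGraph w :=
      (SimpleGraph.Iso.map e (wordGraph w)).symm
    exact ⟨_, isRadiusOneRealisation_of_iso φ, ⟨φ⟩⟩
  constructor
  · rintro ⟨F, hF, huniq⟩
    obtain ⟨w, ⟨φ⟩⟩ := hF.exists_word hs
    have hw : wordSequence w = s := by
      rw [← degreeSequence_wordGraph, degreeSequence_eq_of_iso φ, hF.2.2]
    refine ⟨w, hw, fun w' hw' => ?_⟩
    obtain ⟨F', hF', ⟨φ'⟩⟩ := real w' hw'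
    obtain ⟨ψ⟩ := huniq F' hF'
    exact ⟨φ.trans (ψ.trans φ')⟩
  · rintro ⟨w, hw, huniq⟩
    obtain ⟨F, hF, ⟨φ⟩⟩ := real w hw
    refine ⟨F, hF, fun F' hF' => ?_⟩
    obtain ⟨w', ⟨φ'⟩⟩ := hF'.exists_word hs
    have hw' : wordSequence w' = s := by
      rw [← degreeSequence_wordGraph, degreeSequence_eq_of_iso φ', hF'.2.2]
    obtain ⟨ψ⟩ := huniq w' hw'
    exact ⟨φ.trans (ψ.trans φ')⟩

/-! ### Chord counts of words -/

namespace StripStep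

theorem swap_swap (s : StripStep) : s.swap.swap = s := by cases s <;> rfl

theorem map_swap_map_swap (w : List StripStep) : (w.map swap).map swap = w := by
  simp [Function.comp_def, swap_swap]

/-- The number of double steps in a word. -/
def doubles (w : List StripStep) : ℕ := (w.map fun s => s.dx * s.dy).sum

@[simp] theorem doubles_nil : doubles [] = 0 := rfl

@[simp] theorem doubles_cons (s : StripStep) (w : List StripStep) :
    doubles (s :: w) = s.dx * s.dy + doubles w := by simp [doubles]

theorem width_add_height (w : List StripStep) : width w + height w = w.length + doubles w := by
  induction w with
  | nil => rfl
  | cons s w ih => cases s <;> simp [dx, dy] <;> omega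

theorem fstCounts_ne_nil (w : List StripStep) : fstCounts w ≠ [] := by
  induction w with
  | nil => simp [fstCounts]
  | cons s w ih =>
    cases s
    · simp [fstCounts]
    · obtain ⟨a, l, h⟩ := List.exists_cons_of_ne_nil ih
      simp [fstCounts, h, incHead]
    · simp [fstCounts]

theorem pos_of_mem_fstCounts (w : List StripStep) : ∀ c ∈ fstCounts w, 0 < c := by
  induction w with
  | nil => simp [fstCounts]
  | cons s w ih =>
    cases s
    · simpa [fstCounts] using ih
    · obtain ⟨a, l, h⟩ := List.exists_cons_of_ne_nil (fstCounts_ne_nil w)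
      rw [h] at ih
      simp only [fstCounts, h, incHead, List.mem_cons, forall_eq_or_imp] at ih ⊢
      exact ⟨by omega, ih.2⟩
    · simpa [fstCounts] using ih

theorem length_fstCounts (w : List StripStep) : (fstCounts w).length = width w + 1 := by
  rw [← map_range_ncard]; simp

theorem sum_fstCounts (w : List StripStep) : (fstCounts w).sum = w.length + 1 := by
  induction w with
  | nil => simp [fstCounts]
  | cons s w ih =>
    cases s
    · simp [fstCounts, ih]; omega
    · obtain ⟨a, l, h⟩ := List.exists_cons_of_ne_nil (fstCounts_ne_nil w)
      simp only [h, List.sum_cons, fstCounts, incHead, List.length_cons] at ih ⊢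
      omega
    · simp [fstCounts, ih]; omega

theorem pos_of_mem_counts {w : List StripStep} {c : ℕ} (h : c ∈ counts w) : 0 < c := by
  rw [counts, Multiset.mem_add] at h
  rcases h with h | h
  · exact pos_of_mem_fstCounts _ _ h
  · exact pos_of_mem_fstCounts _ _ h

theorem card_counts (w : List StripStep) :
    Multiset.card (counts w) = width w + height w + 2 := by
  simp [counts, sndCounts, length_fstCounts]; omega

theorem sum_counts (w : List StripStep) : (counts w).sum = 2 * w.length + 2 := by
  simp [counts, sndCounts, sum_fstCounts]; omega

/-- The counts number `length + doubles + 2`, one for each vertex on a side, and add up to `2 *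
length + 2`, two for each chord. -/
theorem doubles_eq_of_counts_eq {w w' : List StripStep} (h : counts w = counts w') :
    doubles w = doubles w' ∧ w.length = w'.length := by
  have h1 := card_counts w
  have h2 := card_counts w'
  have h3 := sum_counts w
  have h4 := sum_counts w'
  rw [width_add_height] at h1 h2
  rw [h] at h1 h3
  omega

/-- The degree of the apex is the number of counts plus 2, so it carries no further information. -/
theorem wordSequence_eq_iff {w w' : List StripStep} :
    wordSequence w = wordSequence w' ↔ counts w = counts w' := by
  have key : ∀ v, wordSequence v = {Multiset.card (counts v) + 2} + Multiset.replicate 2 3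
      + (counts v).map (3 + ·) := fun v => by rw [card_counts]; rfl
  constructor
  · intro h
    have hc : Multiset.card (counts w) = Multiset.card (counts w') := by
      have := congrArg Multiset.card h
      simpa [key] using this
    rw [key, key, hc] at h
    exact Multiset.map_injective (add_right_injective 3) (add_left_cancel h)
  · intro h
    rw [key, key, h]

theorem counts_map_swap (w : List StripStep) : counts (w.map swap) = counts w := by
  rw [counts, counts, sndCounts, sndCounts, map_swap_map_swap, add_comm]

/-- A double step moves to new vertices on both sides, so no vertex has chords from both parts of
the word. -/
theorem fstCounts_append_both (v w : List StripStep) :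
    fstCounts (v ++ both :: w) = fstCounts v ++ fstCounts w := by
  induction v with
  | nil => simp [fstCounts]
  | cons s v ih =>
    cases s
    · simp [fstCounts, ih]
    · obtain ⟨a, l, h⟩ := List.exists_cons_of_ne_nil (fstCounts_ne_nil v)
      simp [fstCounts, ih, h, incHead]
    · simp [fstCounts, ih]

theorem counts_append_both (v w : List StripStep) :
    counts (v ++ both :: w) = counts v + counts w := by
  simp only [counts, sndCounts, List.map_append, List.map_cons, swap, fstCounts_append_both,
    ← Multiset.coe_add]
  abel

theorem counts_nil : counts [] = Multiset.replicate 2 1 := rfl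

theorem counts_replicate_both_append (n : ℕ) (w : List StripStep) :
    counts (List.replicate n both ++ w) = Multiset.replicate (2 * n) 1 + counts w := by
  induction n with
  | zero => simp
  | succ n ih =>
    have := counts_append_both [] (List.replicate n both ++ w)
    rw [List.replicate_succ, List.cons_append]
    rw [List.nil_append] at this
    rw [this, ih, counts_nil, ← add_assoc, ← Multiset.replicate_add]
    congr 2; omega

/-! ### Words as sequences of runs -/

/-- The step on one side. -/
def side : Bool → StripStep
  | true => fst
  | false => snd

theorem swap_side (b : Bool) : (side b).swap = side !b := by cases b <;> rfl

/-- The word whose maximal runs have the given lengths and alternate between the two sides. -/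
def alternating : Bool → List ℕ → List StripStep
  | _, [] => []
  | b, r :: L => List.replicate r (side b) ++ alternating (!b) L

theorem alternating_map_swap (b : Bool) (L : List ℕ) :
    (alternating b L).map swap = alternating (!b) L := by
  induction L generalizing b with
  | nil => rfl
  | cons r L ih => simp [alternating, swap_side, ih]

theorem exists_alternating {w : List StripStep} (h : doubles w = 0) :
    ∃ b L, (∀ r ∈ L, 0 < r) ∧ w = alternating b L := by
  induction w with
  | nil => exact ⟨true, [], by simp, rfl⟩
  | cons s w ih =>
    obtain ⟨c, rfl⟩ : ∃ c, s = side c := by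
      cases s
      · exact ⟨true, rfl⟩
      · exact ⟨false, rfl⟩
      · simp [dx, dy] at h
    obtain ⟨b, L, hL, rfl⟩ := ih (by simp at h; omega)
    cases L with
    | nil => exact ⟨c, [1], by simp, by simp [alternating]⟩
    | cons r L =>
      by_cases hbc : b = c
      · subst hbc
        refine ⟨b, (r + 1) :: L, ?_, by simp [alternating, List.replicate_succ]⟩
        simp only [List.mem_cons, forall_eq_or_imp] at hL ⊢
        exact ⟨by omega, hL.2⟩
      · obtain rfl : b = !c := by cases b <;> cases c <;> simp_all
        exact ⟨c, 1 :: r :: L, by simpa using hL, by simp [alternating]⟩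

theorem exists_append_both {w : List StripStep} (h : doubles w ≠ 0) :
    ∃ u v, w = u ++ both :: v ∧ doubles u = 0 ∧ doubles w = doubles v + 1 := by
  induction w with
  | nil => simp at h
  | cons s w ih =>
    by_cases hs : s = both
    · subst hs
      exact ⟨[], w, rfl, rfl, by simp [dx, dy]; omega⟩
    · have hs0 : s.dx * s.dy = 0 := by cases s <;> simp_all [dx, dy]
      obtain ⟨u, v, rfl, h1, h2⟩ := ih (by simpa [hs0] using h)
      exact ⟨s :: u, v, rfl, by simp [hs0, h1], by simp [hs0, h2]⟩

theorem fstCounts_replicate_fst_append (r : ℕ) (w : List StripStep) :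
    fstCounts (List.replicate r fst ++ w) = List.replicate r 1 ++ fstCounts w := by
  induction r with
  | zero => simp
  | succ r ih => simp [List.replicate_succ, fstCounts, ih]

theorem fstCounts_replicate_snd_append (r : ℕ) {w : List StripStep} {a : ℕ} {l : List ℕ}
    (h : fstCounts w = a :: l) :
    fstCounts (List.replicate r snd ++ w) = (a + r) :: l := by
  induction r with
  | zero => simpa using h
  | succ r ih => simp [List.replicate_succ, fstCounts, ih, incHead, add_assoc]

/-- The number of chords at the first vertex of the first side. -/
def lead (w : List StripStep) : ℕ := (fstCounts w).headI

/-- Whatever comes first, be it `fst`, `both` or the end of the word, the first vertex of the first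
side is left after one chord. -/
theorem lead_alternating_append {L : List ℕ} (hL : ∀ r ∈ L, 0 < r) {u : List StripStep}
    (hu : u = [] ∨ ∃ v, u = both :: v) : lead (alternating true L ++ u) = 1 := by
  have h0 : lead u = 1 := by
    rcases hu with rfl | ⟨v, rfl⟩
    · rfl
    · simp [lead, fstCounts]
  cases L with
  | nil => exact h0
  | cons r L =>
    obtain ⟨n, rfl⟩ : ∃ n, r = n + 1 := ⟨r - 1, by have := hL r (by simp); omega⟩
    simp [alternating, List.replicate_succ, side, lead, fstCounts]

/-- The new run passes r vertices with one chord each. On the opposite side the first vertex had a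
single chord, because the next run leaves it at once, and now it has r + 1. The extra `{1}` on the
left replaces a subtraction. -/
theorem counts_alternating_cons (b : Bool) (r : ℕ) {L : List ℕ} (hL : ∀ r ∈ L, 0 < r) :
    counts (alternating b (r :: L)) + {1} =
      Multiset.replicate r 1 + {r + 1} + counts (alternating (!b) L) := by
  have main : counts (alternating true (r :: L)) + {1} =
      Multiset.replicate r 1 + {r + 1} + counts (alternating false L) := by
    have h1 : lead (alternating true L) = 1 := by
      simpa using lead_alternating_append hL (u := []) (Or.inl rfl)
    obtain ⟨a, l, h⟩ := List.exists_cons_of_ne_nil (fstCounts_ne_nil (alternating true L))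
    rw [lead, h, List.headI_cons] at h1
    subst h1
    have h2 : sndCounts (alternating false L) = 1 :: l := by
      rw [sndCounts, alternating_map_swap]; exact h
    have h3 : sndCounts (alternating true (r :: L)) = (1 + r) :: l := by
      rw [sndCounts, alternating_map_swap]
      exact fstCounts_replicate_snd_append r h
    have h4 : fstCounts (alternating true (r :: L)) =
        List.replicate r 1 ++ fstCounts (alternating false L) :=
      fstCounts_replicate_fst_append r _
    rw [counts, counts, h2, h3, h4, ← Multiset.coe_add, ← Multiset.cons_coe, ← Multiset.cons_coe,
      Multiset.coe_replicate, ← Multiset.singleton_add, ← Multiset.singleton_add 1, add_comm 1 r]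
    abel
  cases b
  · rw [← counts_map_swap, alternating_map_swap, ← counts_map_swap (alternating _ L),
      alternating_map_swap]
    exact main
  · exact main

/-! ### Chord counts in terms of run lengths and double steps -/

/-- The multiset of chord counts has the run lengths `L` (increased by one) and `D` double
steps. -/
structure HasRuns (w : List StripStep) (L : List ℕ) (D : ℕ) : Prop where
  pos : ∀ r ∈ L, 0 < r
  counts_add : counts w + Multiset.replicate L.length 1 =
    ((L.map (· + 1) : List ℕ) : Multiset ℕ) + Multiset.replicate (L.sum + 2 * D + 2) 1

/-- Each run r adds r counts equal to 1 and turns one old 1 into r + 1, starting from the two ones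
of the empty word. -/
theorem hasRuns_alternating (b : Bool) {L : List ℕ} (hL : ∀ r ∈ L, 0 < r) :
    HasRuns (alternating b L) L 0 := by
  refine ⟨hL, ?_⟩
  induction L generalizing b with
  | nil => simp [alternating, counts_nil]
  | cons r L ih =>
    have hL' : ∀ r ∈ L, 0 < r := fun r hr => hL r (by simp [hr])
    have h := counts_alternating_cons b r hL'
    have ih := ih (!b) hL'
    rw [List.length_cons, add_comm L.length, Multiset.replicate_add, Multiset.replicate_one,
      ← add_assoc, h, add_assoc, ih, List.map_cons, ← Multiset.cons_coe, ← Multiset.singleton_add,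
      List.sum_cons, show r + L.sum + 2 * 0 + 2 = r + (L.sum + 2 * 0 + 2) by omega,
      Multiset.replicate_add r]
    abel

theorem HasRuns.append {v w : List StripStep} {L M : List ℕ} {D E : ℕ} (hv : HasRuns v L D)
    (hw : HasRuns w M E) : HasRuns (v ++ both :: w) (L ++ M) (D + E + 1) := by
  refine ⟨fun r hr => ?_, ?_⟩
  · rcases List.mem_append.1 hr with h | h
    · exact hv.pos r h
    · exact hw.pos r h
  · have h1 := hv.counts_add
    have h2 := hw.counts_add
    rw [counts_append_both, List.length_append, Multiset.replicate_add, List.map_append,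
      ← Multiset.coe_add, List.sum_append,
      show L.sum + M.sum + 2 * (D + E + 1) + 2 = (L.sum + 2 * D + 2) + (M.sum + 2 * E + 2) by omega,
      Multiset.replicate_add (L.sum + 2 * D + 2)]
    calc _ = (counts v + Multiset.replicate L.length 1)
          + (counts w + Multiset.replicate M.length 1) := by abel
      _ = _ := by rw [h1, h2]; abel

theorem HasRuns.perm {w : List StripStep} {L M : List ℕ} {D : ℕ} (h : HasRuns w L D)
    (hLM : L.Perm M) : HasRuns w M D := by
  refine ⟨fun r hr => h.pos r (hLM.mem_iff.2 hr), ?_⟩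
  rw [← hLM.length_eq, ← hLM.sum_eq, h.counts_add, Multiset.coe_eq_coe.2 (hLM.map _)]

theorem HasRuns.replicate_both_append {w : List StripStep} {L : List ℕ} {D : ℕ}
    (h : HasRuns w L D) (n : ℕ) : HasRuns (List.replicate n both ++ w) L (n + D) := by
  refine ⟨h.pos, ?_⟩
  rw [counts_replicate_both_append, add_assoc, h.counts_add,
    show L.sum + 2 * (n + D) + 2 = 2 * n + (L.sum + 2 * D + 2) by omega,
    Multiset.replicate_add (2 * n)]
  abel

theorem HasRuns.counts_eq {v w : List StripStep} {L : List ℕ} {D : ℕ} (hv : HasRuns v L D)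
    (hw : HasRuns w L D) : counts v = counts w :=
  add_right_cancel (hv.counts_add.trans hw.counts_add.symm)

theorem HasRuns.counts_congr {v w : List StripStep} {L : List ℕ} {D : ℕ} (hv : HasRuns v L D)
    (h : counts v = counts w) : HasRuns w L D :=
  ⟨hv.pos, h ▸ hv.counts_add⟩

/-- Runs are positive, so the run lengths are the counts other than 1, each diminished by one. -/
theorem HasRuns.runs_perm {w : List StripStep} {L M : List ℕ} {D E : ℕ} (h : HasRuns w L D)
    (h' : HasRuns w M E) : L.Perm M := by
  have key : ∀ {L : List ℕ} {D : ℕ}, HasRuns w L D →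
      (counts w).filter (· ≠ 1) = ((L.map (· + 1) : List ℕ) : Multiset ℕ) := by
    intro L D h
    have := congrArg (Multiset.filter (· ≠ 1)) h.counts_add
    rw [Multiset.filter_add, Multiset.filter_add] at this
    have e : ∀ n, (Multiset.replicate n 1).filter (· ≠ 1) = (0 : Multiset ℕ) := fun n => by
      rw [Multiset.filter_eq_nil]
      intro a ha
      simp [Multiset.eq_of_mem_replicate ha]
    rw [e, e, add_zero, add_zero] at this
    rw [this, Multiset.filter_eq_self]
    intro a ha
    obtain ⟨r, hr, rfl⟩ := List.mem_map.1 (Multiset.mem_coe.1 ha)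
    have := h.pos r hr
    omega
  have := (key h).symm.trans (key h')
  have := Multiset.coe_eq_coe.1 this
  have inj : Function.Injective (fun x : ℕ => x + 1) := add_left_injective 1
  have h2 := this.map (· - 1)
  simpa [List.map_map, Function.comp_def] using h2

/-- Take the counts other than 1, diminished by one. The cardinality and the sum of all counts then
determine how many ones there are. -/
theorem exists_hasRuns (w : List StripStep) : ∃ L, HasRuns w L (doubles w) := by
  obtain ⟨L, hL⟩ : ∃ L : List ℕ, (L : Multiset ℕ) = ((counts w).filter (· ≠ 1)).map (· - 1) :=
    Quot.exists_rep _
  have hpos : ∀ r ∈ L, 0 < r := by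
    intro r hr
    rw [← Multiset.mem_coe, hL, Multiset.mem_map] at hr
    obtain ⟨c, hc, rfl⟩ := hr
    rw [Multiset.mem_filter] at hc
    have := pos_of_mem_counts hc.1
    have := hc.2
    omega
  have hL1 : ((L.map (· + 1) : List ℕ) : Multiset ℕ) = (counts w).filter (· ≠ 1) := by
    rw [← Multiset.map_coe, hL, Multiset.map_map]
    conv_rhs => rw [← Multiset.map_id ((counts w).filter (· ≠ 1))]
    refine Multiset.map_congr rfl fun c hc => ?_
    have := pos_of_mem_counts (Multiset.mem_filter.1 hc).1
    simp only [Function.comp_apply, id]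
    omega
  have hC : counts w = ((L.map (· + 1) : List ℕ) : Multiset ℕ)
      + Multiset.replicate ((counts w).count 1) 1 := by
    rw [hL1, ← Multiset.filter_eq', add_comm]
    exact (Multiset.filter_add_not (· = 1) _).symm
  generalize (counts w).count 1 = n at hC
  have h1 := card_counts w
  have h2 := sum_counts w
  have h3 := width_add_height w
  have hs : ∀ M : List ℕ, (M.map (· + 1)).sum = M.sum + M.length := by
    intro M
    induction M with
    | nil => rfl
    | cons a M ih => simp [ih]; omega
  rw [hC] at h1 h2
  simp [hs] at h1 h2
  refine ⟨L, hpos, ?_⟩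
  rw [hC, add_assoc, ← Multiset.replicate_add]
  congr 2
  omega

theorem HasRuns.doubles_eq {w : List StripStep} {L : List ℕ} {D : ℕ} (h : HasRuns w L D) :
    doubles w = D := by
  obtain ⟨M, hM⟩ := exists_hasRuns w
  have := congrArg Multiset.card h.counts_add
  have h2 := congrArg Multiset.card (hM.perm (hM.runs_perm h)).counts_add
  simp at this h2
  omega

theorem HasRuns.length_le_sum {w : List StripStep} {L : List ℕ} {D : ℕ} (h : HasRuns w L D) :
    L.length ≤ L.sum := by
  have := h.pos
  clear h
  induction L with
  | nil => simp
  | cons a L ih =>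
    simp only [List.mem_cons, forall_eq_or_imp] at this
    have := ih this.2
    simp; omega

theorem HasRuns.width_add_height {w : List StripStep} {L : List ℕ} {D : ℕ} (h : HasRuns w L D) :
    width w + height w = L.sum + 2 * D := by
  have := congrArg Multiset.card h.counts_add
  simp [card_counts] at this
  omega

theorem HasRuns.wordSequence_eq {w : List StripStep} {L : List ℕ} {D : ℕ} (h : HasRuns w L D) :
    wordSequence w = {L.sum + 2 * D + 4} + ((L.map (4 + ·) : List ℕ) : Multiset ℕ)
      + Multiset.replicate (L.sum + 2 * D + 2 - L.length) 4 + Multiset.replicate 2 3 := by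
  have hle := h.length_le_sum
  have hC : counts w = ((L.map (· + 1) : List ℕ) : Multiset ℕ)
      + Multiset.replicate (L.sum + 2 * D + 2 - L.length) 1 := by
    apply add_right_cancel (b := Multiset.replicate L.length 1)
    rw [h.counts_add, add_assoc (Multiset.ofList _), ← Multiset.replicate_add]
    congr 2
    omega
  rw [wordSequence, h.width_add_height, hC, Multiset.map_add, Multiset.map_coe, List.map_map,
    Multiset.map_replicate]
  have : ((fun x => 3 + x) ∘ fun x => x + 1) = fun x : ℕ => 4 + x := by
    funext x; simp; omega
  rw [this]
  abel

end StripStep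

/-! ### The degrees around the ends of a strip -/

namespace StripStep

/-- The degrees of the neighbours of the first end of a strip. -/
def endDegrees (w : List StripStep) : Set ℕ :=
  {width w + height w + 4, 3 + lead w, 3 + lead (w.map swap)}

theorem ncard_isChord_zero (w : List StripStep) : {j | IsChord w 0 j}.ncard = lead w := by
  rw [lead, ← map_range_ncard, List.range_succ_eq_map]
  simp

theorem ncard_isChord_width (w : List StripStep) :
    {j | IsChord w (width w) j}.ncard = lead w.reverse := by
  have : {j | IsChord w.reverse 0 j} = (height w - ·) '' {j | IsChord w (width w) j} := by
    ext j
    constructor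
    · intro h
      have h1 := h.le.2
      have h2 := h.reverse
      rw [List.reverse_reverse, width_reverse, height_reverse, Nat.sub_zero] at h2
      rw [height_reverse] at h1
      exact ⟨_, h2, Nat.sub_sub_self h1⟩
    · rintro ⟨j, h, rfl⟩
      have := IsChord.reverse h
      rwa [Nat.sub_self] at this
  rw [← ncard_isChord_zero, this, Set.InjOn.ncard_image]
  intro a ha b hb hab
  have h1 := IsChord.le ha
  have h2 := IsChord.le hb
  simp only at hab
  omega

theorem ncard_neighborSet_wordGraph_fst (w : List StripStep) (i : Fin (width w + 1)) :
    ((wordGraph w).neighborSet (.inr (.inr (.inl i)))).ncard = 3 + {j | IsChord w i j}.ncard :=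
  ncard_neighborSet_fst (fun _ _ h => h.le.2) i

theorem ncard_neighborSet_wordGraph_snd (w : List StripStep) (j : Fin (height w + 1)) :
    ((wordGraph w).neighborSet (.inr (.inr (.inr j)))).ncard =
      3 + {i | IsChord (w.map swap) j i}.ncard := by
  simp only [isChord_map_swap]
  exact ncard_neighborSet_snd (fun i j h => h.le.1) j

theorem neighbor_degrees_left (w : List StripStep) :
    (fun y => ((wordGraph w).neighborSet y).ncard) '' (wordGraph w).neighborSet (.inr (.inl false))
      = endDegrees w := by
  have h : (wordGraph w).neighborSet (.inr (.inl false)) = _ := neighborSet_left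
  have hap : ((wordGraph w).neighborSet (.inl ())).ncard = _ := ncard_neighborSet_apex
  rw [h, Set.image_insert_eq, Set.image_insert_eq, Set.image_singleton, hap,
    ncard_neighborSet_wordGraph_fst, ncard_neighborSet_wordGraph_snd, Fin.val_zero, Fin.val_zero,
    ncard_isChord_zero, ncard_isChord_zero, endDegrees]

theorem neighbor_degrees_right (w : List StripStep) :
    (fun y => ((wordGraph w).neighborSet y).ncard) '' (wordGraph w).neighborSet (.inr (.inl true))
      = endDegrees w.reverse := by
  have h : (wordGraph w).neighborSet (.inr (.inl true)) = _ := neighborSet_right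
  have hap : ((wordGraph w).neighborSet (.inl ())).ncard = _ := ncard_neighborSet_apex
  have h1 := ncard_isChord_width (w.map swap)
  rw [width_map_swap] at h1
  rw [h, Set.image_insert_eq, Set.image_insert_eq, Set.image_singleton, hap,
    ncard_neighborSet_wordGraph_fst, ncard_neighborSet_wordGraph_snd, Fin.val_last, Fin.val_last,
    ncard_isChord_width, h1, endDegrees, width_reverse, height_reverse, List.map_reverse]

theorem eq_end_of_ncard_eq_three {w : List StripStep}
    {v : StripVertex (width w) (height w)} (h : ((wordGraph w).neighborSet v).ncard = 3) :
    ∃ b, v = .inr (.inl b) := by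
  have pos : ∀ u : List StripStep, ∀ i, i ≤ width u → {j | IsChord u i j}.ncard ≠ 0 := by
    intro u i hi h0
    have : {j | IsChord u i j}.ncard ∈ fstCounts u := by
      rw [← map_range_ncard]
      exact List.mem_map.2 ⟨i, List.mem_range.2 (by omega), rfl⟩
    have := pos_of_mem_fstCounts u _ this
    omega
  rcases v with (_ | b | i | j)
  · have hap : ((wordGraph w).neighborSet (.inl ())).ncard = _ := ncard_neighborSet_apex
    rw [hap] at h
    omega
  · exact ⟨b, rfl⟩
  · rw [ncard_neighborSet_wordGraph_fst] at h
    exact absurd (by omega) (pos w i (by omega))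
  · rw [ncard_neighborSet_wordGraph_snd] at h
    exact absurd (by omega) (pos (w.map swap) j (by rw [width_map_swap]; omega))

/-- The ends are the only vertices of degree three, so an isomorphism permutes them and preserves
the set of degrees around each. This unordered pair of sets is the invariant that separates graphs
with equal degree sequences. -/
theorem endDegrees_of_iso {w w' : List StripStep} (φ : wordGraph w ≃g wordGraph w') :
    (endDegrees w = endDegrees w' ∧ endDegrees w.reverse = endDegrees w'.reverse) ∨
      (endDegrees w = endDegrees w'.reverse ∧ endDegrees w.reverse = endDegrees w') := by
  have himage : ∀ v, (fun y => ((wordGraph w').neighborSet y).ncard) '' (wordGraph w').neighborSet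
      (φ v) = (fun y => ((wordGraph w).neighborSet y).ncard) '' (wordGraph w).neighborSet v := by
    intro v
    ext d
    simp only [Set.mem_image, SimpleGraph.mem_neighborSet]
    constructor
    · rintro ⟨y, hy, rfl⟩
      refine ⟨φ.symm y, ?_, ?_⟩
      · rw [← φ.map_rel_iff, RelIso.apply_symm_apply]; exact hy
      · rw [← φ.ncard_neighborSet, RelIso.apply_symm_apply]
    · rintro ⟨y, hy, rfl⟩
      exact ⟨φ y, φ.map_rel_iff.2 hy, φ.ncard_neighborSet y⟩
  have hend : ∀ b, ∃ b', φ (.inr (.inl b)) = .inr (.inl b') := by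
    intro b
    apply eq_end_of_ncard_eq_three
    rw [φ.ncard_neighborSet]
    exact ncard_neighborSet_end b
  obtain ⟨a, ha⟩ := hend false
  obtain ⟨b, hb⟩ := hend true
  have hab : a ≠ b := by
    rintro rfl
    have := φ.injective (ha.trans hb.symm)
    simp at this
  have h0 := himage (.inr (.inl false))
  have h1 := himage (.inr (.inl true))
  rw [ha, neighbor_degrees_left] at h0
  rw [hb, neighbor_degrees_right] at h1
  cases a <;> cases b
  · exact absurd rfl hab
  · rw [neighbor_degrees_left] at h0
    rw [neighbor_degrees_right] at h1
    exact Or.inl ⟨h0.symm, h1.symm⟩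
  · rw [neighbor_degrees_right] at h0
    rw [neighbor_degrees_left] at h1
    exact Or.inr ⟨h0.symm, h1.symm⟩
  · exact absurd rfl hab

theorem endDegrees_both_cons (u : List StripStep) :
    endDegrees (both :: u) = {width (both :: u) + height (both :: u) + 4, 4} := by
  simp [endDegrees, lead, fstCounts, swap]

theorem endDegrees_map_swap (w : List StripStep) : endDegrees (w.map swap) = endDegrees w := by
  rw [endDegrees, endDegrees, map_swap_map_swap, width_map_swap, height_map_swap,
    add_comm (height w), Set.pair_comm]

/-- The first run is a fan of r + 1 chords at one neighbour of the end; the other neighbour has one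
chord. -/
theorem endDegrees_alternating_append (b : Bool) {r : ℕ} {L : List ℕ} (hL : ∀ x ∈ r :: L, 0 < x)
    {u : List StripStep} (hu : u = [] ∨ ∃ v, u = both :: v) :
    endDegrees (alternating b (r :: L) ++ u) =
      {width (alternating b (r :: L) ++ u) + height (alternating b (r :: L) ++ u) + 4, 4, 4 + r} := by
  have main : ∀ u : List StripStep, (u = [] ∨ ∃ v, u = both :: v) →
      endDegrees (alternating true (r :: L) ++ u) =
      {width (alternating true (r :: L) ++ u) + height (alternating true (r :: L) ++ u) + 4,
        4, 4 + r} := by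
    intro u hu
    have hu' : u.map swap = [] ∨ ∃ v, u.map swap = both :: v := by
      rcases hu with rfl | ⟨v, rfl⟩
      · exact Or.inl rfl
      · exact Or.inr ⟨v.map swap, rfl⟩
    have h1 := lead_alternating_append hL hu
    have h2 : lead ((alternating true (r :: L) ++ u).map swap) = 1 + r := by
      have h3 := lead_alternating_append (L := L) (fun x hx => hL x (by simp [hx])) hu'
      obtain ⟨a, l, h⟩ := List.exists_cons_of_ne_nil
        (fstCounts_ne_nil (alternating true L ++ u.map swap))
      rw [lead, h, List.headI_cons] at h3
      have h4 := fstCounts_replicate_snd_append r h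
      rw [List.map_append, alternating_map_swap, alternating, List.append_assoc]
      simp only [side, Bool.not_true, Bool.not_false]
      rw [lead, h4, List.headI_cons, h3]
    rw [endDegrees, h1, h2, ← add_assoc]
  cases b
  · rw [← endDegrees_map_swap, List.map_append, alternating_map_swap, Bool.not_false, main]
    · have e := congrArg (fun v => width v + height v)
        (show alternating true (r :: L) ++ u.map swap =
          (alternating false (r :: L) ++ u).map swap by
            rw [List.map_append, alternating_map_swap, Bool.not_false])
      simp only [width_map_swap, height_map_swap] at e
      rw [e, add_comm (height _)]
    · rcases hu with rfl | ⟨v, rfl⟩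
      · exact Or.inl rfl
      · exact Or.inr ⟨v.map swap, rfl⟩
  · exact main u hu

theorem replicate_append_cons {α : Type*} (n : ℕ) (a : α) (l : List α) :
    List.replicate n a ++ a :: l = a :: (List.replicate n a ++ l) := by
  rw [← List.cons_append, ← List.replicate_succ, List.replicate_succ', List.append_assoc,
    List.singleton_append]

theorem alternating_append (b : Bool) (L M : List ℕ) :
    alternating b (L ++ M) = alternating b L ++ alternating (not^[L.length] b) M := by
  induction L generalizing b with
  | nil => rfl
  | cons r L ih => simp [alternating, ih]

/-- The reversed word starts on the side of the last run. The parity statement about `c` is what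
carries the induction. -/
theorem exists_alternating_reverse (b : Bool) (L : List ℕ) :
    ∃ c, (alternating b L).reverse = alternating c L.reverse ∧ not^[L.length] c = !b := by
  induction L generalizing b with
  | nil => exact ⟨!b, rfl, rfl⟩
  | cons r L ih =>
    obtain ⟨c, h1, h2⟩ := ih (!b)
    refine ⟨c, ?_, ?_⟩
    · rw [alternating, List.reverse_append, h1, List.reverse_cons, alternating_append,
        List.length_reverse, h2]
      simp [alternating]
    · rw [List.length_cons, Function.iterate_succ_apply', h2, Bool.not_not]

end StripStep

/-! ### Rigid words -/

open StripStep

/-- A word is rigid if its chord counts determine its graph. -/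
def IsRigid (w : List StripStep) : Prop :=
  ∀ w', counts w' = counts w → Nonempty (wordGraph w ≃g wordGraph w')

theorem IsRigid.iso {w v v' : List StripStep} {L : List ℕ} {D : ℕ} (h : IsRigid w)
    (hw : HasRuns w L D) (hv : HasRuns v L D) (hv' : HasRuns v' L D) :
    Nonempty (wordGraph v ≃g wordGraph v') := by
  obtain ⟨φ⟩ := h v (hv.counts_eq hw)
  obtain ⟨ψ⟩ := h v' (hv'.counts_eq hw)
  exact ⟨φ.symm.trans ψ⟩

/-- The counts determine the length and the number of double steps; if the two are equal, every
letter is `both`. -/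
theorem isRigid_replicate_both (n : ℕ) : IsRigid (List.replicate n both) := by
  have allboth : ∀ w : List StripStep, doubles w = w.length → w = List.replicate w.length both := by
    have hle : ∀ w : List StripStep, doubles w ≤ w.length := by
      intro w
      induction w with
      | nil => simp
      | cons s w ih => cases s <;> simp [dx, dy] <;> omega
    intro w
    induction w with
    | nil => simp
    | cons s w ih =>
      intro h
      have := hle w
      cases s
      · simp [dx, dy] at h; omega
      · simp [dx, dy] at h; omega
      · rw [List.length_cons, List.replicate_succ, ← ih (by simp [dx, dy] at h; omega)]
  have hd : ∀ n, doubles (List.replicate n both) = n := by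
    intro n
    induction n with
    | zero => rfl
    | succ n ih => simp [List.replicate_succ, ih, dx, dy]; omega
  intro w' h
  obtain ⟨h1, h2⟩ := doubles_eq_of_counts_eq h
  rw [List.length_replicate] at h2
  have := allboth w' (by rw [h1, h2, hd])
  rw [this, h2]
  exact ⟨SimpleGraph.Iso.refl⟩

theorem alternating_iso (b c : Bool) (L : List ℕ) :
    Nonempty (wordGraph (alternating b L) ≃g wordGraph (alternating c L)) := by
  by_cases h : b = c
  · subst h; exact ⟨SimpleGraph.Iso.refl⟩
  · obtain rfl : c = !b := by cases b <;> cases c <;> simp_all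
    rw [← alternating_map_swap]
    exact wordGraph_map_swap _

theorem exists_alternating_of_counts_eq {w : List StripStep} {b : Bool} {L : List ℕ}
    (hL : ∀ r ∈ L, 0 < r) (h : counts w = counts (alternating b L)) :
    ∃ c M, w = alternating c M ∧ M.Perm L := by
  have h0 := hasRuns_alternating b hL
  obtain ⟨c, M, hM, rfl⟩ := exists_alternating (w := w)
    (by rw [(doubles_eq_of_counts_eq h).1, h0.doubles_eq])
  exact ⟨c, M, rfl, (hasRuns_alternating c hM).runs_perm (h0.counts_congr h.symm)⟩

theorem isRigid_alternating_replicate (b : Bool) (n : ℕ) {r : ℕ} (hr : 0 < r) :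
    IsRigid (alternating b (List.replicate n r)) := by
  intro w' h
  obtain ⟨c, M, rfl, hM⟩ := exists_alternating_of_counts_eq
    (fun x hx => (List.eq_of_mem_replicate hx).symm ▸ hr) h
  rw [List.perm_replicate.1 hM]
  exact alternating_iso _ _ _

/-- The two orders of the runs are reversals of each other, up to exchange of the sides. -/
theorem isRigid_alternating_pair (b : Bool) {r s : ℕ} (hr : 0 < r) (hs : 0 < s) :
    IsRigid (alternating b [r, s]) := by
  intro w' h
  obtain ⟨c, M, rfl, hM⟩ := exists_alternating_of_counts_eq (by simp [hr, hs]) h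
  obtain ⟨x, y, rfl⟩ := List.length_eq_two.1 hM.length_eq
  have hM' : (x = r ∧ y = s) ∨ (x = s ∧ y = r) := by
    have hx : x = r ∨ x = s := by simpa using hM.mem_iff.1 (show x ∈ [x, y] by simp)
    have hsum := hM.sum_eq
    simp at hsum
    rcases hx with rfl | rfl
    · left; omega
    · right; omega
  rcases hM' with ⟨rfl, rfl⟩ | ⟨rfl, rfl⟩
  · exact alternating_iso _ _ _
  · obtain ⟨d, hd, -⟩ := exists_alternating_reverse b [y, x]
    obtain ⟨φ⟩ := wordGraph_reverse (alternating b [y, x])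
    rw [hd] at φ
    obtain ⟨ψ⟩ := alternating_iso d c [x, y]
    exact ⟨φ.trans ψ⟩

theorem hasRuns_both_cons_alternating (b : Bool) {r : ℕ} (hr : 0 < r) :
    HasRuns (both :: alternating b [r]) [r] 1 := by
  have := (hasRuns_alternating true (L := []) (by simp)).append
    (hasRuns_alternating b (L := [r]) (by simpa using hr))
  simpa [alternating] using this

/-- The only double step stands before or after the only run, and reversal exchanges the two cases.
-/
theorem isRigid_both_cons_alternating (b : Bool) {r : ℕ} (hr : 0 < r) :
    IsRigid (both :: alternating b [r]) := by
  intro w' h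
  have h0 := hasRuns_both_cons_alternating b hr
  have hd : doubles w' = 1 := by rw [(doubles_eq_of_counts_eq h).1, h0.doubles_eq]
  have hw' : HasRuns w' [r] 1 := h0.counts_congr h.symm
  obtain ⟨u, v, rfl, hu, hv⟩ := exists_append_both (w := w') (by omega)
  obtain ⟨c, L, hL, rfl⟩ := exists_alternating hu
  obtain ⟨d, M, hM, rfl⟩ := exists_alternating (w := v) (by omega)
  have hperm := ((hasRuns_alternating c hL).append (hasRuns_alternating d hM)).runs_perm hw'
  have hLM := List.perm_singleton.1 hperm
  have first : ∀ e, Nonempty (wordGraph (both :: alternating b [r]) ≃g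
      wordGraph (both :: alternating e [r])) := by
    intro e
    by_cases h : b = e
    · subst h; exact ⟨SimpleGraph.Iso.refl⟩
    · obtain rfl : e = !b := by cases b <;> cases e <;> simp_all
      have := wordGraph_map_swap (both :: alternating b [r])
      rwa [List.map_cons, alternating_map_swap] at this
  rcases List.append_eq_singleton_iff.1 hLM with ⟨rfl, rfl⟩ | ⟨rfl, rfl⟩
  · exact first d
  · obtain ⟨e, he, -⟩ := exists_alternating_reverse c [r]
    obtain ⟨φ⟩ := first e
    obtain ⟨ψ⟩ := wordGraph_reverse (alternating c [r] ++ both :: alternating d [])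
    have : (alternating c [r] ++ both :: alternating d []).reverse = both :: alternating e [r] := by
      rw [List.reverse_append, he]
      simp [alternating]
    rw [this] at ψ
    exact ⟨φ.trans ψ.symm⟩

/-! ### Obstructions to rigidity -/

theorem hasRuns_alternating_append (b c : Bool) {L M : List ℕ} (hL : ∀ r ∈ L, 0 < r)
    (hM : ∀ r ∈ M, 0 < r) (n : ℕ) :
    HasRuns (alternating b L ++ (List.replicate (n + 1) both ++ alternating c M)) (L ++ M)
      (n + 1) := by
  have := (hasRuns_alternating b hL).append
    ((hasRuns_alternating c hM).replicate_both_append n)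
  simpa [List.replicate_succ] using this

theorem sum_pos_of_pos {L : List ℕ} (hL : ∀ r ∈ L, 0 < r) : L.length ≤ L.sum :=
  (hasRuns_alternating true hL).length_le_sum

/-- With two or more double steps, the run can be put at an end of the word, where that end sees the
degree 4 + r, or between double steps, where neither end sees it. -/
theorem IsRigid.doubles_le_one {w : List StripStep} {r : ℕ} {D : ℕ} (hw : HasRuns w [r] D)
    (h : IsRigid w) : D ≤ 1 := by
  by_contra hD
  have hr : 0 < r := hw.pos r (by simp)
  obtain ⟨n, rfl⟩ : ∃ n, D = n + 1 + 1 := ⟨D - 2, by omega⟩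
  have hpos : ∀ x ∈ [r], 0 < x := by simpa using hr
  have h1 : HasRuns (alternating true [r] ++ (List.replicate (n + 2) both ++ alternating true []))
      [r] (n + 2) := hasRuns_alternating_append true true hpos (by simp) (n + 1)
  have h2 : HasRuns (both :: (alternating true [r] ++ (List.replicate (n + 1) both
      ++ alternating true []))) [r] (n + 2) := by
    have := (hasRuns_alternating_append true true hpos (M := []) (by simp)
      n).replicate_both_append 1
    rw [add_comm 1] at this
    simpa using this
  obtain ⟨φ⟩ := h.iso hw h1 h2
  have e1 := endDegrees_alternating_append true hpos
    (u := List.replicate (n + 2) both ++ alternating true []) (Or.inr ⟨_, by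
      rw [List.replicate_succ, List.cons_append]⟩)
  have e2 := endDegrees_both_cons (alternating true [r] ++ (List.replicate (n + 1) both
      ++ alternating true []))
  have e3 : endDegrees (both :: (alternating true [r] ++ (List.replicate (n + 1) both
      ++ alternating true []))).reverse = {[r].sum + 2 * (n + 2) + 4, 4} := by
    have k := h2.width_add_height
    rw [← width_reverse, ← height_reverse] at k
    obtain ⟨v, hv⟩ : ∃ v, (both :: (alternating true [r] ++ (List.replicate (n + 1) both
      ++ alternating true []))).reverse = both :: v :=
      ⟨List.replicate n both ++ ((alternating true [r]).reverse ++ [both]), by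
        simp [alternating, List.replicate_succ, replicate_append_cons]⟩
    rw [hv] at k ⊢
    rw [endDegrees_both_cons, k]
  rw [h1.width_add_height] at e1
  rw [h2.width_add_height] at e2
  have hmem : 4 + r ∈ ({[r].sum + 2 * (n + 2) + 4, 4} : Set ℕ) := by
    rcases endDegrees_of_iso φ with ⟨h, -⟩ | ⟨h, -⟩
    · rw [← e2, ← h, e1]; simp
    · rw [← e3, ← h, e1]; simp
  simp at hmem
  omega

/-- With a double step and at least two runs, either all runs come first, so that one end sees no
fan, or the run r is moved behind the double steps, so that both ends see one. -/
theorem IsRigid.doubles_eq_zero {w : List StripStep} {r s : ℕ} {L : List ℕ} {D : ℕ}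
    (hw : HasRuns w (r :: s :: L) D) (h : IsRigid w) : D = 0 := by
  by_contra hD
  obtain ⟨n, rfl⟩ : ∃ n, D = n + 1 := ⟨D - 1, by omega⟩
  have hpos := hw.pos
  have hr : 0 < r := hpos r (by simp)
  have hs : 0 < s := hpos s (by simp)
  have hposL : ∀ x ∈ s :: L, 0 < x := fun x hx => hpos x (by simp at hx ⊢; tauto)
  have h1 := hasRuns_alternating_append true true hpos (M := []) (by simp) n
  rw [List.append_nil] at h1
  have h2 : HasRuns (alternating true (s :: L) ++ (List.replicate (n + 1) both
      ++ alternating true [r])) (r :: s :: L) (n + 1) :=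
    (hasRuns_alternating_append true true hposL (M := [r]) (by simpa using hr) n).perm
      List.perm_append_comm
  obtain ⟨φ⟩ := h.iso hw h1 h2
  have e1 : endDegrees (alternating true (r :: s :: L) ++ (List.replicate (n + 1) both
      ++ alternating true [])).reverse = {(r :: s :: L).sum + 2 * (n + 1) + 4, 4} := by
    have k := h1.width_add_height
    rw [← width_reverse, ← height_reverse] at k
    obtain ⟨v, hv⟩ : ∃ v, (alternating true (r :: s :: L) ++ (List.replicate (n + 1) both
      ++ alternating true [])).reverse = both :: v :=
      ⟨List.replicate n both ++ (alternating true (r :: s :: L)).reverse, by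
        simp [alternating, List.replicate_succ, replicate_append_cons]⟩
    rw [hv] at k ⊢
    rw [endDegrees_both_cons, k]
  have e2 := endDegrees_alternating_append true hposL
    (u := List.replicate (n + 1) both ++ alternating true [r]) (Or.inr ⟨_, by
      rw [List.replicate_succ, List.cons_append]⟩)
  rw [h2.width_add_height] at e2
  have e3 : endDegrees (alternating true (s :: L) ++ (List.replicate (n + 1) both
      ++ alternating true [r])).reverse = {(r :: s :: L).sum + 2 * (n + 1) + 4, 4, 4 + r} := by
    have k := h2.width_add_height
    rw [← width_reverse, ← height_reverse] at k
    obtain ⟨c, hc, -⟩ := exists_alternating_reverse true [r]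
    have hv : (alternating true (s :: L) ++ (List.replicate (n + 1) both
      ++ alternating true [r])).reverse = alternating c [r] ++ (List.replicate (n + 1) both
      ++ (alternating true (s :: L)).reverse) := by
      rw [List.reverse_append, List.reverse_append, hc, List.reverse_replicate,
        List.reverse_singleton, List.append_assoc]
    rw [hv] at k ⊢
    rw [endDegrees_alternating_append c (by simpa using hr) (Or.inr ⟨_, by
      rw [List.replicate_succ, List.cons_append]⟩), k]
  have hmem : 4 + s ∈ ({(r :: s :: L).sum + 2 * (n + 1) + 4, 4} : Set ℕ) ∨
      4 + r ∈ ({(r :: s :: L).sum + 2 * (n + 1) + 4, 4} : Set ℕ) := by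
    rcases endDegrees_of_iso φ with ⟨-, h⟩ | ⟨-, h⟩
    · right; rw [← e1, h, e3]; simp
    · left; rw [← e1, h, e2]; simp
  simp at hmem
  omega

/-- Keep r first and put s or t last. The ends see r and s in one arrangement, r and t in the other,
and these pairs agree only if s = t. -/
theorem IsRigid.runs_eq {w : List StripStep} {r s t : ℕ} {M : List ℕ}
    (hw : HasRuns w (r :: s :: t :: M) 0) (h : IsRigid w) : s = t := by
  have hpos := hw.pos
  have hsum := sum_pos_of_pos (L := M) fun x hx => hpos x (by simp [hx])
  have hr : 0 < r := hpos r (by simp)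
  have hs : 0 < s := hpos s (by simp)
  have ht : 0 < t := hpos t (by simp)
  by_contra hst
  have ends : ∀ L' : List ℕ, ∀ y : ℕ, (r :: s :: t :: M).Perm (r :: L' ++ [y]) →
      HasRuns (alternating true (r :: L' ++ [y])) (r :: s :: t :: M) 0 ∧
      endDegrees (alternating true (r :: L' ++ [y])) = {r + s + t + M.sum + 4, 4, 4 + r} ∧
      endDegrees (alternating true (r :: L' ++ [y])).reverse =
        {r + s + t + M.sum + 4, 4, 4 + y} := by
    intro L' y hp
    have hpos' : ∀ x ∈ r :: L' ++ [y], 0 < x := fun x hx => hpos x (hp.mem_iff.2 hx)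
    have h1 : HasRuns (alternating true (r :: L' ++ [y])) (r :: s :: t :: M) 0 :=
      (hasRuns_alternating true hpos').perm hp.symm
    have k := h1.width_add_height
    have e1 := endDegrees_alternating_append true (L := L' ++ [y]) hpos' (Or.inl rfl)
    rw [List.append_nil] at e1
    have k' := k
    rw [← width_reverse, ← height_reverse] at k'
    obtain ⟨c, hc, -⟩ := exists_alternating_reverse true (r :: L' ++ [y])
    rw [List.reverse_append, List.reverse_singleton, List.singleton_append] at hc
    have e2 := endDegrees_alternating_append c (L := (r :: L').reverse) (r := y)
      (fun x hx => hpos' x (by simp at hx ⊢; tauto)) (Or.inl rfl)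
    rw [List.append_nil, ← hc, k'] at e2
    rw [List.cons_append] at k
    rw [k] at e1
    have ksum : (r :: s :: t :: M).sum + 2 * 0 + 4 = r + s + t + M.sum + 4 := by simp; omega
    rw [ksum] at e1 e2
    exact ⟨h1, e1, e2⟩
  obtain ⟨a1, a2, a3⟩ := ends (t :: M) s (List.Perm.cons _ (by
    have := List.perm_append_comm (l₁ := [s]) (l₂ := t :: M)
    simpa using this))
  obtain ⟨b1, b2, b3⟩ := ends (s :: M) t (List.Perm.cons _ (by
    have := List.perm_append_comm (l₁ := [t]) (l₂ := s :: M)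
    exact (List.Perm.swap _ _ _).trans (by simpa using this)))
  obtain ⟨φ⟩ := h.iso hw a1 b1
  -- The degree `4 + x` can be confused neither with 4 nor with the degree of the apex, since `x` is
  -- positive and less than the sum of the runs.
  have key : ∀ x y, 0 < x → x < r + s + t + M.sum → ({r + s + t + M.sum + 4, 4, 4 + x} : Set ℕ) =
      {r + s + t + M.sum + 4, 4, 4 + y} → x = y := by
    intro x y hx hlt e
    have : 4 + x ∈ ({r + s + t + M.sum + 4, 4, 4 + y} : Set ℕ) := by rw [← e]; simp
    simp at this
    omega
  rcases endDegrees_of_iso φ with ⟨-, h⟩ | ⟨h1, h2⟩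
  · rw [a3, b3] at h
    exact hst (key s t hs (by omega) h)
  · rw [a2, b3] at h1
    rw [a3, b2] at h2
    have e1 := key r t hr (by omega) h1
    have e2 := key s r hs (by omega) h2
    omega

/-! ### The classification -/

/-- The exponents are those of A3 at p = nr + 5 and x = r + 1, left unevaluated so as to match its
definition. -/
theorem StripStep.HasRuns.wordSequence_replicate {w : List StripStep} {n r : ℕ} (hr : 0 < r)
    (h : HasRuns w (List.replicate n r) 0) :
    wordSequence w = {n * r + 5 - 1}
      + Multiset.replicate ((n * r + 5 - 5) / (r + 1 - 1)) (r + 1 + 3)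
      + Multiset.replicate ((n * r + 5 - 5) * (r + 1 - 2) / (r + 1 - 1) + 2) 4
      + Multiset.replicate 2 3 := by
  obtain ⟨t, rfl⟩ : ∃ t, r = t + 1 := ⟨r - 1, by omega⟩
  have e1 : n * (t + 1) * t / (t + 1) = n * t := by
    rw [mul_right_comm, Nat.mul_div_cancel _ hr]
  have e2 : n * (t + 1) = n * t + n := by ring
  rw [h.wordSequence_eq, List.map_replicate, Multiset.coe_replicate, List.sum_replicate,
    List.length_replicate, smul_eq_mul, Nat.add_sub_cancel, Nat.add_sub_cancel,
    Nat.mul_div_cancel _ hr, show t + 1 + 1 - 2 = t by omega, e1, e2,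
    show n * t + n + 2 * 0 + 4 = n * t + n + 5 - 1 by omega,
    show n * t + n + 2 * 0 + 2 - n = n * t + 2 by omega,
    show 4 + (t + 1) = t + 1 + 1 + 3 by omega]

theorem StripStep.HasRuns.wordSequence_pair {w : List StripStep} {r s : ℕ} (h : HasRuns w [r, s] 0) :
    wordSequence w = {r + s + 4} + {r + 4} + {s + 4} + Multiset.replicate (r + s) 4
      + Multiset.replicate 2 3 := by
  rw [h.wordSequence_eq, show [r, s].sum + 2 * 0 + 2 - [r, s].length = r + s by simp,
    show [r, s].sum + 2 * 0 + 4 = r + s + 4 by simp, add_comm r 4, add_comm s 4]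
  have : (([r, s].map (4 + ·) : List ℕ) : Multiset ℕ) = {4 + r} + {4 + s} := rfl
  rw [this]
  abel

theorem StripStep.HasRuns.wordSequence_singleton {w : List StripStep} {r : ℕ} (h : HasRuns w [r] 1) :
    wordSequence w = {r + 6} + {r + 4} + Multiset.replicate (r + 3) 4
      + Multiset.replicate 2 3 := by
  rw [h.wordSequence_eq, show [r].sum + 2 * 1 + 2 - [r].length = r + 3 by simp,
    show [r].sum + 2 * 1 + 4 = r + 6 by simp, add_comm r 4]
  rfl

theorem StripStep.HasRuns.wordSequence_nil {w : List StripStep} {D : ℕ} (h : HasRuns w [] D) :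
    wordSequence w = {2 * D + 4} + Multiset.replicate (2 * D + 2) 4
      + Multiset.replicate 2 3 := by
  rw [h.wordSequence_eq]
  simp

theorem IsRigid.exists_type {w : List StripStep} (h : IsRigid w) :
    IsTypeA1 (wordSequence w) ∨ IsTypeA2 (wordSequence w) ∨ IsTypeA3 (wordSequence w) ∨
      IsTypeA4 (wordSequence w) := by
  obtain ⟨L, hL⟩ := exists_hasRuns w
  generalize doubles w = D at hL
  have typeA3 : ∀ n r, 0 < n → HasRuns w (List.replicate n r) 0 → IsTypeA3 (wordSequence w) := by
    intro n r hn hw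
    have hr : 0 < r := hw.pos r (by simp; omega)
    have := Nat.mul_pos hn hr
    exact ⟨n * r + 5, r + 1, by omega, by omega, by simp, hw.wordSequence_replicate hr⟩
  rcases L with _ | ⟨r, _ | ⟨s, _ | ⟨t, M⟩⟩⟩
  · left
    refine ⟨2 * D + 5, by omega, ⟨D + 2, by ring⟩, ?_⟩
    rw [hL.wordSequence_nil]
    rfl
  · have := h.doubles_le_one hL
    have hr : 0 < r := hL.pos r (by simp)
    obtain rfl | rfl : D = 0 ∨ D = 1 := by omega
    · exact Or.inr (Or.inr (Or.inl (typeA3 1 r one_pos hL)))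
    · refine Or.inr (Or.inl ⟨r + 7, by omega, ?_⟩)
      rw [hL.wordSequence_singleton]
      rfl
  · obtain rfl := h.doubles_eq_zero hL
    -- With p = r + s + 5 and x = r + 1, the lower bound on x in A4 says exactly that `s < r`, and
    -- the upper bound says that s is positive.
    have typeA4 : ∀ r s, s < r → HasRuns w [r, s] 0 → IsTypeA4 (wordSequence w) := by
      intro r s hlt hw
      have hs : 0 < s := hw.pos s (by simp)
      refine ⟨r + s + 5, r + 1, by omega, by omega, by omega, ?_⟩
      rw [hw.wordSequence_pair, show r + s + 5 - (r + 1) = s + 4 by omega]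
      rfl
    rcases lt_trichotomy r s with hlt | rfl | hlt
    · exact Or.inr (Or.inr (Or.inr (typeA4 s r hlt (hL.perm (List.Perm.swap _ _ _)))))
    · exact Or.inr (Or.inr (Or.inl (typeA3 2 r two_pos hL)))
    · exact Or.inr (Or.inr (Or.inr (typeA4 r s hlt hL)))
  · obtain rfl := h.doubles_eq_zero hL
    -- Rigidity does not depend on the order in which the runs are listed, so `runs_eq` applies to
    -- every reordering and makes all runs equal.
    have hr : r = t := h.runs_eq (hL.perm (List.Perm.swap _ _ _))
    have hall : ∀ x ∈ t :: M, x = s := by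
      intro x hx
      exact (h.runs_eq (hL.perm (((List.perm_cons_erase hx).cons s).cons r))).symm
    have hs : t = s := hall t (by simp)
    refine Or.inr (Or.inr (Or.inl (typeA3 (M.length + 3) s (by omega) ?_)))
    have e : r :: s :: t :: M = List.replicate (M.length + 3) s := by
      rw [List.eq_replicate_iff]
      refine ⟨by simp, fun x hx => ?_⟩
      rcases List.mem_cons.1 hx with rfl | hx
      · exact hr.trans hs
      rcases List.mem_cons.1 hx with rfl | hx
      · rfl
      · exact hall x hx
    rwa [e] at hL

theorem exists_isRigid_of_type {s : Multiset ℕ}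
    (h : IsTypeA1 s ∨ IsTypeA2 s ∨ IsTypeA3 s ∨ IsTypeA4 s) :
    ∃ w, wordSequence w = s ∧ IsRigid w := by
  rcases h with ⟨p, hp, ⟨m, rfl⟩, rfl⟩ | ⟨p, hp, rfl⟩ | ⟨p, x, hp, hx, ⟨n, hn⟩, rfl⟩ |
    ⟨p, x, hp, hx, hxp, rfl⟩
  · refine ⟨List.replicate (m - 2) both, ?_, isRigid_replicate_both _⟩
    have := (hasRuns_alternating true (L := []) (by simp)).replicate_both_append (m - 2)
    rw [alternating, List.append_nil, add_zero] at this
    rw [this.wordSequence_nil, show 2 * (m - 2) + 4 = 2 * m + 1 - 1 by omega,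
      show 2 * (m - 2) + 2 = 2 * m + 1 - 3 by omega]
  · refine ⟨_, ?_, isRigid_both_cons_alternating true (r := p - 7) (by omega)⟩
    rw [(hasRuns_both_cons_alternating true (r := p - 7) (by omega)).wordSequence_singleton,
      show p - 7 + 6 = p - 1 by omega, show p - 7 + 4 = p - 3 by omega,
      show p - 7 + 3 = p - 4 by omega]
  · obtain ⟨r, rfl⟩ : ∃ r, x = r + 1 := ⟨x - 1, by omega⟩
    obtain rfl : p = n * r + 5 := by
      rw [Nat.add_sub_cancel, mul_comm] at hn; omega
    have hr : 0 < r := by omega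
    refine ⟨_, ?_, isRigid_alternating_replicate true n hr⟩
    exact (hasRuns_alternating true fun x hx =>
      (List.eq_of_mem_replicate hx).symm ▸ hr).wordSequence_replicate hr
  -- The two runs are x - 1 and p - x - 4; `p ≥ 8` gives `x ≥ 3`, and `x ≤ p - 5` makes the second
  -- run positive.
  · have h1 : 0 < x - 1 := by omega
    have h2 : 0 < p - x - 4 := by omega
    refine ⟨_, ?_, isRigid_alternating_pair true h1 h2⟩
    rw [(hasRuns_alternating true (L := [x - 1, p - x - 4])
      (by simp only [List.mem_cons, List.not_mem_nil, or_false]; omega)).wordSequence_pair,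
      show x - 1 + (p - x - 4) + 4 = p - 1 by omega, show x - 1 + 4 = x + 3 by omega,
      show p - x - 4 + 4 = p - x by omega, show x - 1 + (p - x - 4) = p - 5 by omega]

theorem theorem1 (s : Multiset ℕ) (hs : s.count 3 = 2) :
    IsUnigraphicRadiusOne s ↔ IsTypeA1 s ∨ IsTypeA2 s ∨ IsTypeA3 s ∨ IsTypeA4 s := by
  rw [isUnigraphicRadiusOne_iff hs]
  constructor
  · rintro ⟨w, rfl, h⟩
    exact IsRigid.exists_type fun w' hw' => h w' (wordSequence_eq_iff.2 hw')
  · intro h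
    obtain ⟨w, rfl, hw⟩ := exists_isRigid_of_type h
    exact ⟨w, rfl, fun w' hw' => hw w' (wordSequence_eq_iff.1 hw')⟩
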